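/- Let $X$ be a smooth $n$-dimensional manifold (Hausdorff, second countable), let $\beta$ and $\gamma$ be smooth real vector bundles of finite rank on $X$, and let $\nabla$ be a flat smooth connection on $\gamma$. Write $\Omega^j(\gamma)=\Gamma(\Lambda^j_X\otimes\gamma)$ for the smooth $\gamma$-valued $j$-forms, placed in degree $j$, put $\Omega^\bullet(\gamma)=\bigoplus_j\Omega^j(\gamma)$, and let $d^\nabla:\Omega^j(\gamma)\to\Omega^{j+1}(\gamma)$ be the de Rham operator twisted by $\nabla$. For $l\ge 1$ let $\mathrm{Sym}^l\mathcal D(\Lambda^\bullet_X\otimes\gamma,\beta)$ be the $C^\infty(X)$-module of $l$-linear differential operators $\Phi:\Omega^\bullet(\gamma)^{l}\to\Gamma(\beta)$ (of some finite order in each argument) which are symmetric in the graded sense: exchanging two neighbouring homogeneous arguments of degrees $a$ and $b$ multiplies the value by $(-1)^{ab}$. Such a $\Phi$ has degree $i$ if it vanishes on all homogeneous arguments whose degrees do not add up to $-i$. Put $\mathrm{Sym}^+\mathcal D(\Lambda^\bullet_X\otimes\gamma,\beta)=\bigoplus_{l\ge1}\mathrm{Sym}^l\mathcal D(\Lambda^\bullet_X\otimes\gamma,\beta)$,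 and let $\delta_{\mathrm{DR}}$ be right composition with $d^\nabla$, extended to several arguments by the graded Leibniz rule: for homogeneous $m_1,\dots,m_l$, $$(\delta_{\mathrm{DR}}\Phi)(m_1,\dots,m_l)=\sum_{k=1}^l(-1)^{|m_1|+\dots+|m_{k-1}|}\,\Phi(m_1,\dots,d^\nabla m_k,\dots,m_l).$$ Then $\delta_{\mathrm{DR}}$ is $C^\infty(X)$-linear, raises the degree by one and satisfies $\delta_{\mathrm{DR}}^2=0$, and $$H^i\big(\mathrm{Sym}^+\mathcal D(\Lambda^\bullet_X\otimes\gamma,\beta),\delta_{\mathrm{DR}}\big)\cong\begin{cases}\Gamma\big(\mathrm{Sym}^+(\gamma^*)\otimes\beta\big), & i=0,\\ 0,& i<0,\end{cases}$$ where $\Gamma(\mathrm{Sym}^+(\gamma^*)\otimes\beta)=\bigoplus_{l\ge1}\Gamma(\mathrm{Sym}^l(\gamma^*)\otimes\beta)$. More precisely, the isomorphism for $i=0$ is $C^\infty(X)$-linear and sends a section $s$ of $\mathrm{Sym}^l(\gamma^*)\otimes\beta$ to the class of the operator of order zero that applies $s$ pointwise to the degree $0$ components of its arguments. -/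

import Mathlib

open scoped Manifold ContDiff Topology DirectSum
open Bundle

namespace TwistedDeRham

noncomputable section

set_option linter.unusedSectionVars false

section Sections

variable {n : ℕ} {X : Type*} [TopologicalSpace X] [ChartedSpace (EuclideanSpace ℝ (Fin n)) X]

/-- The algebra `C^∞(X)` of smooth real functions on the `n`-manifold `X`. -/
abbrev SmoothFun (n : ℕ) (X : Type*) [TopologicalSpace X]
    [ChartedSpace (EuclideanSpace ℝ (Fin n)) X] : Type _ :=
  ContMDiffMap (𝓡 n) 𝓘(ℝ, ℝ) X ℝ ∞

/-- The space `Γ(V)` of smooth global sections of the vector bundle `V` with model fibre `F`. -/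
abbrev SmoothSection (n : ℕ) {X : Type*} [TopologicalSpace X]
    [ChartedSpace (EuclideanSpace ℝ (Fin n)) X]
    (F : Type*) [NormedAddCommGroup F] [NormedSpace ℝ F]
    (V : X → Type*) [TopologicalSpace (TotalSpace F V)] [∀ x, TopologicalSpace (V x)]
    [FiberBundle F V] : Type _ :=
  ContMDiffSection (𝓡 n) F ∞ V

/-- The space of smooth vector fields on `X`. -/
abbrev VecField (n : ℕ) (X : Type*) [TopologicalSpace X]
    [ChartedSpace (EuclideanSpace ℝ (Fin n)) X] [IsManifold (𝓡 n) ∞ X] : Type _ :=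
  SmoothSection n (EuclideanSpace ℝ (Fin n)) (fun x : X => TangentSpace (𝓡 n) x)

variable {F : Type*} [NormedAddCommGroup F] [NormedSpace ℝ F]
  {V : X → Type*} [TopologicalSpace (TotalSpace F V)]
  [∀ x, AddCommGroup (V x)] [∀ x, Module ℝ (V x)] [∀ x, TopologicalSpace (V x)]
  [FiberBundle F V] [VectorBundle ℝ F V]

/-- Pointwise multiplication of sections by functions. -/
instance : SMul (SmoothFun n X) (SmoothSection n F V) :=
  ⟨fun f s => ⟨fun x => f x • s x, f.contMDiff.smul_section s.contMDiff⟩⟩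

@[simp]
theorem smul_section_apply (f : SmoothFun n X) (s : SmoothSection n F V) (x : X) :
    (f • s) x = f x • s x := rfl

instance : Module (SmoothFun n X) (SmoothSection n F V) where
  one_smul s := by ext x; simp
  mul_smul f g s := by ext x; simp [mul_smul]
  smul_zero f := by ext x; simp
  smul_add f s t := by ext x; simp
  add_smul f g s := by ext x; simp [add_smul]
  zero_smul s := by ext x; simp

instance : IsScalarTower ℝ (SmoothFun n X) (SmoothSection n F V) :=
  ⟨fun r f s => by ext x; exact smul_assoc r (f x) (s x)⟩

instance : SMulCommClass ℝ (SmoothFun n X) (SmoothSection n F V) :=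
  ⟨fun r f s => by ext x; exact smul_comm r (f x) (s x)⟩

instance : SMulCommClass (SmoothFun n X) ℝ (SmoothSection n F V) := SMulCommClass.symm _ _ _

/-- Evaluation of smooth sections at a point. -/
def evalAt (x : X) : SmoothSection n F V →ₗ[ℝ] V x where
  toFun s := s x
  map_add' _ _ := rfl
  map_smul' _ _ := rfl

@[simp]
theorem evalAt_apply (x : X) (s : SmoothSection n F V) :
    evalAt (n := n) (F := F) x s = s x := rfl

theorem sum_section_apply {ι : Type*} (t : Finset ι) (s : ι → SmoothSection n F V) (x : X) :
    (∑ i ∈ t, s i) x = ∑ i ∈ t, s i x :=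
  map_sum (evalAt (n := n) (F := F) x) s t

theorem exists_bump [T2Space X] [IsManifold (𝓡 n) ∞ X] {x : X} {u : Set X} (hu : u ∈ 𝓝 x) :
    ∃ ψ : SmoothFun n X, (∀ᶠ y in 𝓝 x, ψ y = 1) ∧ tsupport ψ ⊆ u := by
  obtain ⟨f, -, hf⟩ := (SmoothBumpFunction.nhds_basis_tsupport (I := 𝓡 n) x).mem_iff.1 hu
  exact ⟨⟨f, f.contMDiff⟩, f.eventuallyEq_one, hf⟩

/-- A section that is smooth on an open neighbourhood of `x` agrees near `x` with a global
smooth section. -/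
theorem exists_global_section [T2Space X] [IsManifold (𝓡 n) ∞ X] {x : X} {u : Set X}
    (hu : IsOpen u) (hx : x ∈ u) (σ : ∀ y, V y)
    (hσ : ContMDiffOn (𝓡 n) ((𝓡 n).prod 𝓘(ℝ, F)) ∞ (fun y => TotalSpace.mk' F y (σ y)) u) :
    ∃ s : SmoothSection n F V, ∀ᶠ y in 𝓝 x, s y = σ y := by
  obtain ⟨ψ, h1, h2⟩ := exists_bump (n := n) (hu.mem_nhds hx)
  refine ⟨⟨(ψ : X → ℝ) • σ, ContMDiffOn.smul_section_of_tsupport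
    (ψ.contMDiff.contMDiffOn) hu h2 hσ⟩, ?_⟩
  filter_upwards [h1] with y hy
  simp [hy]

theorem exists_global_fun [T2Space X] [IsManifold (𝓡 n) ∞ X] {x : X} {u : Set X}
    (hu : IsOpen u) (hx : x ∈ u) (f : X → ℝ)
    (hf : ContMDiffOn (𝓡 n) 𝓘(ℝ, ℝ) ∞ f u) :
    ∃ g : SmoothFun n X, ∀ᶠ y in 𝓝 x, g y = f y := by
  obtain ⟨ψ, h1, h2⟩ := exists_bump (n := n) (hu.mem_nhds hx)
  refine ⟨⟨fun y => ψ y • f y, ?_⟩, ?_⟩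
  · intro y
    by_cases hy : y ∈ tsupport ψ
    · exact (ψ.contMDiff y).smul (hf.contMDiffAt (hu.mem_nhds (h2 hy)))
    · have : (fun y => ψ y • f y) =ᶠ[𝓝 y] fun _ => (0 : ℝ) := by
        filter_upwards [(isClosed_tsupport ψ).isOpen_compl.mem_nhds hy] with z hz
        simp [image_eq_zero_of_notMem_tsupport hz]
      exact contMDiffAt_const.congr_of_eventuallyEq this
  · filter_upwards [h1] with y hy
    simp [hy]

theorem evalAt_surjective [T2Space X] [IsManifold (𝓡 n) ∞ X] [ContMDiffVectorBundle ∞ F V (𝓡 n)]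
    (x : X) : Function.Surjective (evalAt (n := n) (F := F) (V := V) x) := by
  intro v
  obtain ⟨s, hs, hσ⟩ := FiberBundle.exists_contMDiffOn_extend (k := ∞) (𝓡 n) F v
  obtain ⟨u, hus, hu, hx⟩ := mem_nhds_iff.1 hs
  obtain ⟨t, ht⟩ := exists_global_section hu hx (FiberBundle.extend F v) (hσ.mono hus)
  exact ⟨t, by simpa using ht.self_of_nhds⟩

/-- Tensoriality: a `C^∞(X)`-linear operation on smooth sections depends at `x` only on the
value of its argument at `x`. -/
theorem tensorial_eq_zero [T2Space X] [IsManifold (𝓡 n) ∞ X] [ContMDiffVectorBundle ∞ F V (𝓡 n)]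
    [FiniteDimensional ℝ F]
    {W : Type*} [AddCommGroup W] [Module ℝ W] (x : X) (Φ : SmoothSection n F V →ₗ[ℝ] W)
    (hΦ : ∀ (f : SmoothFun n X) s, Φ (f • s) = f x • Φ s)
    (s : SmoothSection n F V) (hs : s x = 0) : Φ s = 0 := by
  classical
  have : ContMDiffVectorBundle 1 F V (𝓡 n) := ContMDiffVectorBundle.of_le (n := ∞) (by simp)
  let e := trivializationAt F V x
  have hx : x ∈ e.baseSet := FiberBundle.mem_baseSet_trivializationAt F V x
  let b := Module.finBasis ℝ F
  have h1 (i) : ∃ t : SmoothSection n F V, ∀ᶠ y in 𝓝 x, t y = e.localFrame b i y :=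
    exists_global_section e.open_baseSet hx _ (e.contMDiffOn_localFrame_baseSet (I := 𝓡 n) ∞ b i)
  have h2 (i) : ∃ g : SmoothFun n X, ∀ᶠ y in 𝓝 x, g y = e.localFrameCoeff (𝓡 n) b i y (s y) :=
    exists_global_fun e.open_baseSet hx _
      (contMDiffOn_baseSet_localFrameCoeff (I := 𝓡 n) b (s.contMDiff.contMDiffOn) i)
  choose t ht using h1
  choose g hg using h2
  have h3 : ∀ᶠ y in 𝓝 x, s y = (∑ i, g i • t i) y := by
    filter_upwards [Filter.eventually_all.2 ht, Filter.eventually_all.2 hg,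
      e.open_baseSet.mem_nhds hx] with y h1 h2 h3
    rw [sum_section_apply]
    simp only [smul_section_apply, h1, h2]
    exact e.eq_sum_localFrameCoeff_smul (I := 𝓡 n) (s := fun y => s y) (b := b) h3
  obtain ⟨u, hus, hu, hxu⟩ := mem_nhds_iff.1 h3
  obtain ⟨ψ, hψ, hψu⟩ := exists_bump (n := n) (hu.mem_nhds hxu)
  have h4 : ψ • s = ψ • ∑ i, g i • t i := by
    ext y
    by_cases hy : y ∈ tsupport ψ
    · have := hus (hψu hy)
      simp only [Set.mem_ofPred_eq] at this
      simp only [smul_section_apply, this]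
    · simp [image_eq_zero_of_notMem_tsupport hy]
  have h5 := congrArg Φ h4
  rw [hΦ, hΦ, hψ.self_of_nhds, one_smul, one_smul, map_sum] at h5
  rw [h5]
  refine Finset.sum_eq_zero fun i _ => ?_
  rw [hΦ, (hg i).self_of_nhds, hs, map_zero, zero_smul]

end Sections

section Forms

variable {n : ℕ} {X : Type*} [TopologicalSpace X] [ChartedSpace (EuclideanSpace ℝ (Fin n)) X]
  [IsManifold (𝓡 n) ∞ X]

theorem isManifold_two (n : ℕ) (X : Type*) [TopologicalSpace X]
    [ChartedSpace (EuclideanSpace ℝ (Fin n)) X] [IsManifold (𝓡 n) ∞ X] :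
    IsManifold (𝓡 n) (minSmoothness ℝ 2) X :=
  IsManifold.of_le (n := ∞) (by simpa using ENat.LEInfty.out)

/-- The Lie bracket of smooth vector fields. -/
def bracket (n : ℕ) (X : Type*) [TopologicalSpace X] [ChartedSpace (EuclideanSpace ℝ (Fin n)) X]
    [IsManifold (𝓡 n) ∞ X] : VecField n X →ₗ[ℝ] VecField n X →ₗ[ℝ] VecField n X :=
  haveI := isManifold_two n X
  haveI : IsManifold (𝓡 n) (((⊤ : ℕ∞) : WithTop ℕ∞) + 1) X := by simpa
  LinearMap.mk₂ ℝ
    (fun U W => ⟨fun x => VectorField.mlieBracket (𝓡 n) U W x, fun x =>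
      ContMDiffAt.mlieBracket_vectorField (m := ⊤) (n := ⊤) (U.contMDiff x) (W.contMDiff x)
        (by simp)⟩)
    (fun U U' W => by
      ext x; exact VectorField.mlieBracket_add_left U.mdifferentiableAt U'.mdifferentiableAt)
    (fun c U W => by
      ext x; exact VectorField.mlieBracket_const_smul_left U.mdifferentiableAt)
    (fun U W W' => by
      ext x; exact VectorField.mlieBracket_add_right W.mdifferentiableAt W'.mdifferentiableAt)
    (fun c U W => by
      ext x; exact VectorField.mlieBracket_const_smul_right W.mdifferentiableAt)

theorem bracket_apply (U W : VecField n X) (x : X) :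
    bracket n X U W x = VectorField.mlieBracket (𝓡 n) U W x := rfl

variable {F : Type*} [NormedAddCommGroup F] [NormedSpace ℝ F]
  {V : X → Type*} [TopologicalSpace (TotalSpace F V)]
  [∀ x, AddCommGroup (V x)] [∀ x, Module ℝ (V x)] [∀ x, TopologicalSpace (V x)]
  [FiberBundle F V] [VectorBundle ℝ F V]

variable (n F V) in
/-- `Γ(Λ^j_X ⊗ V)`: the smooth `j`-forms on `X` with values in the bundle `V`, that is, families of
alternating `j`-linear maps `θ x` on `T_x X` with values in `V x` which depend smoothly on `x`
(smooth vector fields are sent to smooth sections). -/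
def TwistedForm (j : ℕ) :
    Submodule ℝ (∀ x : X, AlternatingMap ℝ (TangentSpace (𝓡 n) x) (V x) (Fin j)) where
  carrier := {θ | ∀ U : Fin j → VecField n X, ContMDiff (𝓡 n) ((𝓡 n).prod 𝓘(ℝ, F)) ∞
    (fun x => TotalSpace.mk' F x (θ x fun i => U i x))}
  add_mem' hθ hη U := (hθ U).add_section (hη U)
  zero_mem' _ := (0 : SmoothSection n F V).contMDiff
  smul_mem' _ _ hθ U := (hθ U).const_smul_section

namespace TwistedForm

variable {j : ℕ}

theorem ext {θ η : TwistedForm n F V j} (h : ∀ x, θ.1 x = η.1 x) : θ = η :=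
  Subtype.ext (funext h)

/-- Pointwise multiplication of forms by functions. -/
instance : SMul (SmoothFun n X) (TwistedForm n F V j) :=
  ⟨fun f θ => ⟨fun x => f x • θ.1 x, fun U => f.contMDiff.smul_section (θ.2 U)⟩⟩

@[simp]
theorem smul_val_apply (f : SmoothFun n X) (θ : TwistedForm n F V j) (x : X) :
    (f • θ).1 x = f x • θ.1 x := rfl

instance : Module (SmoothFun n X) (TwistedForm n F V j) where
  one_smul θ := ext fun x => by simp
  mul_smul f g θ := ext fun x => by simp [mul_smul]
  smul_zero f := ext fun x => by simp
  smul_add f θ η := ext fun x => by simp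
  add_smul f g θ := ext fun x => by simp [add_smul]
  zero_smul θ := ext fun x => by simp

instance : IsScalarTower ℝ (SmoothFun n X) (TwistedForm n F V j) :=
  ⟨fun r f θ => ext fun x => smul_assoc r (f x) (θ.1 x)⟩

instance : SMulCommClass ℝ (SmoothFun n X) (TwistedForm n F V j) :=
  ⟨fun r f θ => ext fun x => smul_comm r (f x) (θ.1 x)⟩

instance : SMulCommClass (SmoothFun n X) ℝ (TwistedForm n F V j) := SMulCommClass.symm _ _ _

/-- A twisted form, evaluated on smooth vector fields. -/
def eval (θ : TwistedForm n F V j) :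
    AlternatingMap ℝ (VecField n X) (SmoothSection n F V) (Fin j) where
  toFun U := ⟨fun x => θ.1 x fun i => U i x, θ.2 U⟩
  map_update_add' U i u u' := by
    ext x
    have h (w : VecField n X) : (fun k => (Function.update U i w k) x) =
        Function.update (fun k => U k x) i (w x) :=
      funext fun k => by by_cases hk : k = i <;> [subst hk; skip] <;> simp [*]
    simp [h]
  map_update_smul' U i c u := by
    ext x
    have h (w : VecField n X) : (fun k => (Function.update U i w k) x) =
        Function.update (fun k => U k x) i (w x) :=
      funext fun k => by by_cases hk : k = i <;> [subst hk; skip] <;> simp [*]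
    simp [h]
  map_eq_zero_of_eq' U i k h hik := by
    ext x
    exact (θ.1 x).map_eq_zero_of_eq _ (congrArg (fun u : VecField n X => u x) h) hik

@[simp]
theorem eval_apply (θ : TwistedForm n F V j) (U : Fin j → VecField n X) (x : X) :
    eval θ U x = θ.1 x fun i => U i x := rfl

/-- A linear choice of smooth vector fields with prescribed value at `x`. -/
theorem exists_extension [T2Space X] (x : X) :
    ∃ e : TangentSpace (𝓡 n) x →ₗ[ℝ] VecField n X, ∀ v, e v x = v := by
  obtain ⟨e, he⟩ := LinearMap.exists_rightInverse_of_surjective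
    (evalAt (n := n) (F := EuclideanSpace ℝ (Fin n))
      (V := fun x : X => TangentSpace (𝓡 n) x) x)
    (LinearMap.range_eq_top.2 (evalAt_surjective x))
  exact ⟨e, fun v => LinearMap.congr_fun he v⟩

theorem alternating_congr [T2Space X]
    (K : AlternatingMap ℝ (VecField n X) (SmoothSection n F V) (Fin j))
    (hK : ∀ (f : SmoothFun n X) (U : Fin j → VecField n X) (i : Fin j) (u : VecField n X),
      K (Function.update U i (f • u)) = f • K (Function.update U i u))
    (x : X) (U W : Fin j → VecField n X) (h : ∀ i, U i x = W i x) : K U x = K W x := by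
  classical
  have key (i : Fin j) (U : Fin j → VecField n X) (u u' : VecField n X) (h : u x = u' x) :
      K (Function.update U i u) x = K (Function.update U i u') x := by
    have := tensorial_eq_zero (n := n) (F := EuclideanSpace ℝ (Fin n))
      (V := fun x : X => TangentSpace (𝓡 n) x) x
      ((evalAt (n := n) (F := F) x) ∘ₗ (K.toMultilinearMap.toLinearMap U i))
      (fun f s => by simp [hK]) (u - u') (by simp [h])
    rw [map_sub, sub_eq_zero] at this
    exact this
  have main (s : Finset (Fin j)) : K (s.piecewise U W) x = K W x := by
    induction s using Finset.induction_on with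
    | empty => simp
    | insert i s hi ih =>
      rw [Finset.piecewise_insert, ← ih, key i _ (U i) ((s.piecewise U W) i)]
      · simp
      · simp [hi, h]
  simpa using main Finset.univ

/-- The twisted form defined by a `C^∞(X)`-multilinear alternating map on vector fields. -/
def ofTensorial [T2Space X]
    (K : AlternatingMap ℝ (VecField n X) (SmoothSection n F V) (Fin j))
    (hK : ∀ (f : SmoothFun n X) (U : Fin j → VecField n X) (i : Fin j) (u : VecField n X),
      K (Function.update U i (f • u)) = f • K (Function.update U i u)) :
    TwistedForm n F V j :=
  ⟨fun x => ((evalAt (n := n) (F := F) x).compAlternatingMap K).compLinearMap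
      (exists_extension x).choose, fun U => by
    refine (K U).contMDiff.congr fun x => ?_
    have := alternating_congr K hK x (fun i => (exists_extension x).choose (U i x)) U
      (fun i => (exists_extension x).choose_spec (U i x))
    exact congrArg (TotalSpace.mk' F x) this⟩

theorem eval_ofTensorial [T2Space X]
    (K : AlternatingMap ℝ (VecField n X) (SmoothSection n F V) (Fin j))
    (hK : ∀ (f : SmoothFun n X) (U : Fin j → VecField n X) (i : Fin j) (u : VecField n X),
      K (Function.update U i (f • u)) = f • K (Function.update U i u)) :
    eval (ofTensorial K hK) = K := by
  ext U x
  exact alternating_congr K hK x (fun i => (exists_extension x).choose (U i x)) U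
      (fun i => (exists_extension x).choose_spec (U i x))

theorem eval_injective [T2Space X] :
    Function.Injective (eval : TwistedForm n F V j → _) := by
  intro θ η h
  refine ext fun x => AlternatingMap.ext fun v => ?_
  obtain ⟨e, he⟩ := exists_extension (n := n) x
  have := congrArg (fun s : SmoothSection n F V => s x) (AlternatingMap.congr_fun h fun i => e (v i))
  simpa [he] using this

theorem eval_smul (f : SmoothFun n X) (θ : TwistedForm n F V j) (U : Fin j → VecField n X) :
    eval (f • θ) U = f • eval θ U := by
  ext x; simp

theorem eval_update_smul (θ : TwistedForm n F V j) (f : SmoothFun n X) (U : Fin j → VecField n X)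
    (i : Fin j) (u : VecField n X) :
    eval θ (Function.update U i (f • u)) = f • eval θ (Function.update U i u) := by
  ext x
  have h (w : VecField n X) : (fun k => (Function.update U i w k) x) =
      Function.update (fun k => U k x) i (w x) :=
    funext fun k => by by_cases hk : k = i <;> [subst hk; skip] <;> simp [*]
  simp [h]

end TwistedForm

end Forms

section Connection

variable {n : ℕ} {X : Type*} [TopologicalSpace X] [ChartedSpace (EuclideanSpace ℝ (Fin n)) X]
  [IsManifold (𝓡 n) ∞ X]
variable {F : Type*} [NormedAddCommGroup F] [NormedSpace ℝ F]
  {V : X → Type*} [TopologicalSpace (TotalSpace F V)]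
  [∀ x, AddCommGroup (V x)] [∀ x, Module ℝ (V x)] [∀ x, TopologicalSpace (V x)]
  [∀ x, IsTopologicalAddGroup (V x)] [∀ x, ContinuousSMul ℝ (V x)]
  [FiberBundle F V] [VectorBundle ℝ F V]

/-- The covariant derivative `∇_U s` of a smooth section `s` along a smooth vector field `U`. -/
def nabla (cov : CovariantDerivative (𝓡 n) F V) [ContMDiffVectorBundle ∞ F V (𝓡 n)]
    [cov.ContMDiffCovariantDerivative ∞] :
    VecField n X →ₗ[ℝ] SmoothSection n F V →ₗ[ℝ] SmoothSection n F V :=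
  LinearMap.mk₂ ℝ
    (fun U s => ⟨fun x => cov s x (U x), by
      have h := (CovariantDerivative.ContMDiffCovariantDerivative.contMDiff
        (cov := cov) (k := ∞)).contMDiff (σ := s) (by simpa using s.contMDiff.contMDiffOn)
      exact (contMDiffOn_univ.1 h).clm_bundle_apply U.contMDiff⟩)
    (fun U U' s => by ext x; exact (cov s x).map_add (U x) (U' x))
    (fun c U s => by ext x; exact (cov s x).map_smul c (U x))
    (fun U s s' => by
      ext x
      have := cov.isCovariantDerivativeOnUniv.add (x := x) (σ := s) (σ' := s')
        s.mdifferentiableAt s'.mdifferentiableAt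
      exact congrArg (fun L => L (U x)) this)
    (fun c U s => by
      ext x
      have := cov.isCovariantDerivativeOnUniv.smul_const (x := x) c (σ := s)
        s.mdifferentiableAt
      exact congrArg (fun L => L (U x)) this)

/-- The connection is flat: its curvature `∇_U ∇_W - ∇_W ∇_U - ∇_[U,W]` vanishes. -/
def IsFlat (cov : CovariantDerivative (𝓡 n) F V) [ContMDiffVectorBundle ∞ F V (𝓡 n)]
    [cov.ContMDiffCovariantDerivative ∞] : Prop :=
  ∀ (U W : VecField n X) (s : SmoothSection n F V),
    nabla cov U (nabla cov W s) - nabla cov W (nabla cov U s) = nabla cov (bracket n X U W) s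

/-- `U ↦ ∇_U ∘ K` for an alternating map `K` on vector fields. -/
def covTerm (cov : CovariantDerivative (𝓡 n) F V) [ContMDiffVectorBundle ∞ F V (𝓡 n)]
    [cov.ContMDiffCovariantDerivative ∞] {j : ℕ}
    (K : AlternatingMap ℝ (VecField n X) (SmoothSection n F V) (Fin j)) :
    VecField n X →ₗ[ℝ] AlternatingMap ℝ (VecField n X) (SmoothSection n F V) (Fin j) where
  toFun U := (nabla cov U).compAlternatingMap K
  map_add' U W := by ext; simp
  map_smul' c U := by ext; simp

/-- `(U, W) ↦ K([U, W], …)` for an alternating map `K` on vector fields. -/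
def bracketTerm {j : ℕ}
    (K : AlternatingMap ℝ (VecField n X) (SmoothSection n F V) (Fin (j + 1))) :
    VecField n X →ₗ[ℝ] VecField n X →ₗ[ℝ]
      AlternatingMap ℝ (VecField n X) (SmoothSection n F V) (Fin j) :=
  (bracket n X).compr₂ K.curryLeft

/-- The exterior covariant derivative on alternating maps, by the invariant formula
`∑ i, (-1)^i ∇_{U i} (K (…, omit U i, …))
  + ∑ i < k, (-1)^(i+k) K ([U i, U k], …, omit U i, …, omit U k, …)`.
The second sum is written as `-1/2` times a twofold alternation, see `koszul_apply`. -/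
def koszul (cov : CovariantDerivative (𝓡 n) F V) [ContMDiffVectorBundle ∞ F V (𝓡 n)]
    [cov.ContMDiffCovariantDerivative ∞] : (j : ℕ) →
    AlternatingMap ℝ (VecField n X) (SmoothSection n F V) (Fin j) →
    AlternatingMap ℝ (VecField n X) (SmoothSection n F V) (Fin (j + 1))
  | 0, K => AlternatingMap.alternatizeUncurryFin (covTerm cov K)
  | _ + 1, K => AlternatingMap.alternatizeUncurryFin (covTerm cov K) -
      (1 / 2 : ℝ) • AlternatingMap.alternatizeUncurryFin
        (AlternatingMap.alternatizeUncurryFinLM ∘ₗ bracketTerm K)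

section Koszul

variable (cov : CovariantDerivative (𝓡 n) F V) [ContMDiffVectorBundle ∞ F V (𝓡 n)]
  [cov.ContMDiffCovariantDerivative ∞]

theorem covTerm_apply {j : ℕ}
    (K : AlternatingMap ℝ (VecField n X) (SmoothSection n F V) (Fin j))
    (u : VecField n X) (U : Fin j → VecField n X) :
    covTerm cov K u U = nabla cov u (K U) := rfl

theorem bracketTerm_apply {j : ℕ}
    (K : AlternatingMap ℝ (VecField n X) (SmoothSection n F V) (Fin (j + 1)))
    (u w : VecField n X) (U : Fin j → VecField n X) :
    bracketTerm K u w U = K (Fin.cons (bracket n X u w) U) := rfl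

theorem koszul_zero_apply
    (K : AlternatingMap ℝ (VecField n X) (SmoothSection n F V) (Fin 0))
    (U : Fin 1 → VecField n X) :
    koszul cov 0 K U = nabla cov (U 0) (K fun i => i.elim0) := by
  simp only [koszul, AlternatingMap.alternatizeUncurryFin_apply, covTerm_apply]
  simp
  congr 1
  exact congrArg K (Subsingleton.elim _ _)

theorem nabla_smul_left (f : SmoothFun n X) (u : VecField n X) (s : SmoothSection n F V) :
    nabla cov (f • u) s = f • nabla cov u s := by
  ext x
  exact (cov s x).map_smul (f x) (u x)

theorem nabla_smul_right (f : SmoothFun n X) (u : VecField n X) (s : SmoothSection n F V) (x : X) :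
    nabla cov u (f • s) x = f x • nabla cov u s x + mvfderiv (𝓡 n) f x (u x) • s x := by
  have := cov.isCovariantDerivativeOnUniv.leibniz (x := x) (σ := s) (g := f)
    s.mdifferentiableAt (f.contMDiff.mdifferentiable (by simp) x)
  exact congrArg (fun L => L (u x)) this

/-- The invariant formula for the exterior covariant derivative. The pair `i ≤ k` in the second
sum stands for the pair `i < k + 1` of positions, whence the sign. -/
theorem koszul_apply {j : ℕ}
    (K : AlternatingMap ℝ (VecField n X) (SmoothSection n F V) (Fin (j + 1)))
    (U : Fin (j + 2) → VecField n X) :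
    koszul cov (j + 1) K U =
      (∑ i : Fin (j + 2), (-1 : ℤ) ^ (i : ℕ) • nabla cov (U i) (K (i.removeNth U))) -
        ∑ i : Fin (j + 1), ∑ k ≥ i, (-1 : ℤ) ^ (i + k : ℕ) •
          K (Fin.cons (bracket n X (U i.castSucc) (U k.succ))
            (k.removeNth (i.castSucc.removeNth U))) := by
  have h (u w : VecField n X) (W : Fin j → VecField n X) :
      bracketTerm K u w W - bracketTerm K w u W = (2 : ℝ) • bracketTerm K u w W := by
    have : bracket n X w u = - bracket n X u w := by
      ext x
      exact VectorField.mlieBracket_swap_apply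
    have h2 : bracketTerm K w u = - bracketTerm K u w := by
      simp only [bracketTerm, LinearMap.compr₂_apply, this, map_neg]
    rw [h2, AlternatingMap.neg_apply, sub_neg_eq_add, two_smul]
  simp only [koszul, AlternatingMap.sub_apply, AlternatingMap.smul_apply,
    AlternatingMap.alternatizeUncurryFin_alternatizeUncurryFinLM_comp_apply, h]
  simp only [AlternatingMap.alternatizeUncurryFin_apply, covTerm_apply, Finset.smul_sum]
  congr 1
  refine Finset.sum_congr rfl fun i _ => Finset.sum_congr rfl fun k _ => ?_
  rw [smul_comm ((-1 : ℤ) ^ (i + k : ℕ)) (2 : ℝ), smul_smul]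
  norm_num
  rfl

theorem koszul_add (j : ℕ)
    (K L : AlternatingMap ℝ (VecField n X) (SmoothSection n F V) (Fin j)) :
    koszul cov j (K + L) = koszul cov j K + koszul cov j L := by
  have h1 : covTerm cov (K + L) = covTerm cov K + covTerm cov L := by
    ext u U x; simp [covTerm_apply]
  cases j with
  | zero => simp only [koszul, h1, AlternatingMap.alternatizeUncurryFin_add]
  | succ j =>
    have h2 : bracketTerm (K + L) = bracketTerm K + bracketTerm L := by
      ext u w U x; simp [bracketTerm_apply]
    simp only [koszul, h1, h2, AlternatingMap.alternatizeUncurryFin_add, LinearMap.comp_add,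
      smul_add]
    abel

theorem koszul_smul (j : ℕ) (c : ℝ)
    (K : AlternatingMap ℝ (VecField n X) (SmoothSection n F V) (Fin j)) :
    koszul cov j (c • K) = c • koszul cov j K := by
  have h1 : covTerm cov (c • K) = c • covTerm cov K := by
    ext u U x; simp [covTerm_apply]
  cases j with
  | zero => simp only [koszul, h1, AlternatingMap.alternatizeUncurryFin_smul]
  | succ j =>
    have h2 : bracketTerm (c • K) = c • bracketTerm K := by
      ext u w U x; simp [bracketTerm_apply]
    have h3 : (AlternatingMap.alternatizeUncurryFinLM ∘ₗ (c • bracketTerm K)) =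
        c • (AlternatingMap.alternatizeUncurryFinLM ∘ₗ bracketTerm K) := by
      refine LinearMap.ext fun u => ?_
      exact map_smul AlternatingMap.alternatizeUncurryFinLM c (bracketTerm K u)
    simp only [koszul, h1, h2, h3, AlternatingMap.alternatizeUncurryFin_smul, smul_sub]
    rw [smul_comm c]

theorem zsmul_section_apply (z : ℤ) (s : SmoothSection n F V) (x : X) :
    (z • s) x = z • s x := by simp

theorem alternatize_apply {j : ℕ}
    (g : VecField n X →ₗ[ℝ] AlternatingMap ℝ (VecField n X) (SmoothSection n F V) (Fin j))
    (U : Fin (j + 1) → VecField n X) (x : X) :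
    AlternatingMap.alternatizeUncurryFin g U x =
      ∑ i : Fin (j + 1), (-1 : ℤ) ^ (i : ℕ) • g (U i) (i.removeNth U) x := by
  rw [AlternatingMap.alternatizeUncurryFin_apply, sum_section_apply]
  simp only [zsmul_section_apply]

theorem alternatize_cons_apply {j : ℕ}
    (g : VecField n X →ₗ[ℝ] AlternatingMap ℝ (VecField n X) (SmoothSection n F V) (Fin (j + 1)))
    (u : VecField n X) (W : Fin (j + 1) → VecField n X) (x : X) :
    AlternatingMap.alternatizeUncurryFin g (Fin.cons u W) x =
      g u W x - ∑ i : Fin (j + 1), (-1 : ℤ) ^ (i : ℕ) • g (W i) (Fin.cons u (i.removeNth W)) x := by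
  have hs (i : Fin (j + 1)) :
      i.succ.removeNth (Fin.cons u W : Fin (j + 2) → VecField n X) =
        Fin.cons u (i.removeNth W) := by
    funext k
    refine Fin.cases ?_ (fun k => ?_) k <;> simp [Fin.removeNth_apply]
  rw [alternatize_apply, Fin.sum_univ_succ, sub_eq_add_neg, ← Finset.sum_neg_distrib]
  congr 1
  · simp
  · refine Finset.sum_congr rfl fun i _ => ?_
    rw [hs, Fin.cons_succ, Fin.val_succ, pow_succ, mul_neg, mul_one, neg_smul]

theorem bracket_smul_right_apply (f : SmoothFun n X) (u w : VecField n X) (x : X) :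
    bracket n X w (f • u) x = mvfderiv (𝓡 n) f x (w x) • u x + f x • bracket n X w u x :=
  haveI := isManifold_two n X
  VectorField.mlieBracket_smul_right (V := w) (W := u) (f := f)
    (f.contMDiff.mdifferentiable (by simp) x) u.mdifferentiableAt

theorem bracket_swap (u w : VecField n X) : bracket n X w u = - bracket n X u w := by
  ext x
  exact VectorField.mlieBracket_swap_apply

theorem koszul_cons_smul [T2Space X] (j : ℕ)
    (K : AlternatingMap ℝ (VecField n X) (SmoothSection n F V) (Fin j))
    (hK : ∀ (f : SmoothFun n X) (U : Fin j → VecField n X) (i : Fin j) (u : VecField n X),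
      K (Function.update U i (f • u)) = f • K (Function.update U i u))
    (f : SmoothFun n X) (W : Fin j → VecField n X) (u : VecField n X) :
    koszul cov j K (Fin.cons (f • u) W) = f • koszul cov j K (Fin.cons u W) := by
  cases j with
  | zero => rw [koszul_zero_apply, koszul_zero_apply]; exact nabla_smul_left cov f u _
  | succ j =>
    ext x
    have hK0 (u : VecField n X) (S : Fin j → VecField n X) :
        K (Fin.cons (f • u) S) = f • K (Fin.cons u S) := by
      have := hK f (Fin.cons u S) 0 u
      simpa using this
    have hbr (a u : VecField n X) (S : Fin j → VecField n X) :
        K (Fin.cons (bracket n X a (f • u)) S) x =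
          f x • K (Fin.cons (bracket n X a u) S) x +
            mvfderiv (𝓡 n) f x (a x) • K (Fin.cons u S) x := by
      have h1 := TwistedForm.alternating_congr K hK x (Fin.cons (bracket n X a (f • u)) S)
        (Fin.cons (f • bracket n X a u + (mvfderiv (𝓡 n) f x (a x) : ℝ) • u) S) (by
          intro i
          refine Fin.cases ?_ (fun i => ?_) i
          · simp only [Fin.cons_zero, bracket_smul_right_apply]
            simp [add_comm]
          · simp)
      rw [h1]
      have h2 := K.toMultilinearMap.cons_add S (f • bracket n X a u)
        ((mvfderiv (𝓡 n) f x (a x) : ℝ) • u)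
      have h3 := K.toMultilinearMap.cons_smul S (mvfderiv (𝓡 n) f x (a x) : ℝ) u
      simp only [AlternatingMap.coe_multilinearMap] at h2 h3
      rw [h2, h3, hK0]
      simp
    set C := ∑ i : Fin (j + 1), (-1 : ℤ) ^ (i : ℕ) •
      mvfderiv (𝓡 n) f x (W i x) • K (Fin.cons u (i.removeNth W)) x with hC
    have hA1 : ∑ i : Fin (j + 1), (-1 : ℤ) ^ (i : ℕ) •
          nabla cov (W i) (K (Fin.cons (f • u) (i.removeNth W))) x =
        f x • (∑ i : Fin (j + 1), (-1 : ℤ) ^ (i : ℕ) •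
          nabla cov (W i) (K (Fin.cons u (i.removeNth W))) x) + C := by
      rw [hC, Finset.smul_sum, ← Finset.sum_add_distrib]
      refine Finset.sum_congr rfl fun i _ => ?_
      rw [hK0, nabla_smul_right, smul_add, smul_comm (f x)]
    have hB0 : ∑ i : Fin (j + 1), (-1 : ℤ) ^ (i : ℕ) •
          K (Fin.cons (bracket n X (f • u) (W i)) (i.removeNth W)) x =
        f x • (∑ i : Fin (j + 1), (-1 : ℤ) ^ (i : ℕ) •
          K (Fin.cons (bracket n X u (W i)) (i.removeNth W)) x) - C := by
      rw [hC, Finset.smul_sum, ← Finset.sum_sub_distrib]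
      refine Finset.sum_congr rfl fun i _ => ?_
      have h4 (v w : VecField n X) : K (Fin.cons (bracket n X v w) (i.removeNth W)) x =
          - K (Fin.cons (bracket n X w v) (i.removeNth W)) x := by
        rw [bracket_swap w v]
        have h3 := K.toMultilinearMap.cons_smul (i.removeNth W) (-1 : ℝ) (bracket n X w v)
        simp only [AlternatingMap.coe_multilinearMap, neg_one_smul] at h3
        rw [h3]
        simp
      rw [h4, hbr, h4 u]
      simp only [smul_neg, smul_add, neg_add, smul_comm (f x)]
      abel
    have hB1 : ∑ i : Fin (j + 1), (-1 : ℤ) ^ (i : ℕ) •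
          AlternatingMap.alternatizeUncurryFin (bracketTerm K (W i))
            (Fin.cons (f • u) (i.removeNth W)) x =
        f x • (∑ i : Fin (j + 1), (-1 : ℤ) ^ (i : ℕ) •
          AlternatingMap.alternatizeUncurryFin (bracketTerm K (W i))
            (Fin.cons u (i.removeNth W)) x) + C := by
      rw [hC, Finset.smul_sum, ← Finset.sum_add_distrib]
      refine Finset.sum_congr rfl fun i _ => ?_
      rw [smul_comm (f x), ← smul_add]
      congr 1
      simp only [alternatize_apply, Fin.sum_univ_succ, bracketTerm_apply]
      simp only [Fin.val_zero, pow_zero, one_smul, Fin.cons_zero, Fin.cons_succ, Fin.removeNth_zero,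
        Fin.tail_cons, smul_add, Finset.smul_sum]
      rw [hbr, add_right_comm]
      congr 2
      refine Finset.sum_congr rfl fun k _ => ?_
      cases j with
      | zero => exact k.elim0
      | succ j =>
        have hs' (u : VecField n X) (R : Fin (j + 1) → VecField n X) :
            k.succ.removeNth (Fin.cons u R : Fin (j + 2) → VecField n X) =
              Fin.cons u (k.removeNth R) := by
          funext l
          refine Fin.cases ?_ (fun l => ?_) l <;> simp [Fin.removeNth_apply]
        have hK1 (a u : VecField n X) (S : Fin j → VecField n X) :
            K (Fin.cons a (Fin.cons (f • u) S)) = f • K (Fin.cons a (Fin.cons u S)) := by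
          have := hK f (Fin.cons a (Fin.cons u S)) 1 u
          have h1 (w : VecField n X) : Function.update
              (Fin.cons a (Fin.cons u S) : Fin (j + 2) → VecField n X) 1 w =
              Fin.cons a (Fin.cons w S) := by
            have := Fin.cons_update (α := fun _ => VecField n X) a
              (Fin.cons u S : Fin (j + 1) → VecField n X) 0 w
            rw [← Fin.succ_zero_eq_one, ← this, Fin.update_cons_zero]
          simpa only [h1] using this
        rw [hs', hs', hK1]
        exact smul_comm ((-1 : ℤ) ^ ((k.succ : Fin (j + 2)) : ℕ)) (f x)
          (K (Fin.cons (bracket n X (W i) (i.removeNth W k))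
            (Fin.cons u (k.removeNth (i.removeNth W)))) x)
    have expand (u : VecField n X) : koszul cov (j + 1) K (Fin.cons u W) x =
        nabla cov u (K W) x -
          (∑ i : Fin (j + 1), (-1 : ℤ) ^ (i : ℕ) •
            nabla cov (W i) (K (Fin.cons u (i.removeNth W))) x) -
        (1 / 2 : ℝ) • ((∑ i : Fin (j + 1), (-1 : ℤ) ^ (i : ℕ) •
          K (Fin.cons (bracket n X u (W i)) (i.removeNth W)) x) -
          ∑ i : Fin (j + 1), (-1 : ℤ) ^ (i : ℕ) •
          AlternatingMap.alternatizeUncurryFin (bracketTerm K (W i))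
            (Fin.cons u (i.removeNth W)) x) := by
      simp only [koszul, AlternatingMap.sub_apply, AlternatingMap.smul_apply,
        ContMDiffSection.coe_sub, ContMDiffSection.coe_smul, Pi.sub_apply, Pi.smul_apply]
      rw [alternatize_cons_apply, alternatize_cons_apply]
      simp only [LinearMap.comp_apply, AlternatingMap.alternatizeUncurryFinLM_apply]
      rw [alternatize_apply (bracketTerm K u)]
      rfl
    rw [smul_section_apply, expand, expand, hA1, hB0, hB1, nabla_smul_left, smul_section_apply]
    module

/-- The exterior covariant derivative of a `C^∞(X)`-multilinear map is `C^∞(X)`-multilinear. -/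
theorem koszul_update_smul [T2Space X] (j : ℕ)
    (K : AlternatingMap ℝ (VecField n X) (SmoothSection n F V) (Fin j))
    (hK : ∀ (f : SmoothFun n X) (U : Fin j → VecField n X) (i : Fin j) (u : VecField n X),
      K (Function.update U i (f • u)) = f • K (Function.update U i u))
    (f : SmoothFun n X) (U : Fin (j + 1) → VecField n X) (i : Fin (j + 1)) (u : VecField n X) :
    koszul cov j K (Function.update U i (f • u)) = f • koszul cov j K (Function.update U i u) := by
  have h (w : VecField n X) : Function.update U i w = i.insertNth w (i.removeNth U) := by
    rw [Fin.insertNth_removeNth]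
  rw [h, h, AlternatingMap.map_insertNth, AlternatingMap.map_insertNth, smul_comm]
  congr 1
  exact koszul_cons_smul cov j K hK f _ u

/-- The exterior covariant derivative is a first order operator. -/
theorem koszul_smul_fun (j : ℕ)
    (K L : AlternatingMap ℝ (VecField n X) (SmoothSection n F V) (Fin j))
    (f : SmoothFun n X) (hL : ∀ U, L U = f • K U) (U : Fin (j + 1) → VecField n X) (x : X) :
    koszul cov j L U x = f x • koszul cov j K U x +
      ∑ i : Fin (j + 1), (-1 : ℤ) ^ (i : ℕ) • mvfderiv (𝓡 n) f x (U i x) • K (i.removeNth U) x := by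
  have hn (i : Fin (j + 1)) : (-1 : ℤ) ^ (i : ℕ) • nabla cov (U i) (L (i.removeNth U)) x =
      f x • ((-1 : ℤ) ^ (i : ℕ) • nabla cov (U i) (K (i.removeNth U)) x) +
        (-1 : ℤ) ^ (i : ℕ) • mvfderiv (𝓡 n) f x (U i x) • K (i.removeNth U) x := by
    rw [hL, nabla_smul_right, smul_add, smul_comm (f x)]
  have expand (K : AlternatingMap ℝ (VecField n X) (SmoothSection n F V) (Fin j)) :
      AlternatingMap.alternatizeUncurryFin (covTerm cov K) U x =
        ∑ i : Fin (j + 1), (-1 : ℤ) ^ (i : ℕ) • nabla cov (U i) (K (i.removeNth U)) x := by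
    rw [alternatize_apply]
    rfl
  have main : AlternatingMap.alternatizeUncurryFin (covTerm cov L) U x =
      f x • AlternatingMap.alternatizeUncurryFin (covTerm cov K) U x +
      ∑ i : Fin (j + 1), (-1 : ℤ) ^ (i : ℕ) •
        mvfderiv (𝓡 n) f x (U i x) • K (i.removeNth U) x := by
    rw [expand, expand, Finset.smul_sum, ← Finset.sum_add_distrib]
    exact Finset.sum_congr rfl fun i _ => hn i
  cases j with
  | zero => exact main
  | succ j =>
    have hB : AlternatingMap.alternatizeUncurryFin
          (AlternatingMap.alternatizeUncurryFinLM ∘ₗ bracketTerm L) U x =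
        f x • AlternatingMap.alternatizeUncurryFin
          (AlternatingMap.alternatizeUncurryFinLM ∘ₗ bracketTerm K) U x := by
      simp only [alternatize_apply, LinearMap.comp_apply,
        AlternatingMap.alternatizeUncurryFinLM_apply, bracketTerm_apply, hL, Finset.smul_sum,
        smul_section_apply]
      refine Finset.sum_congr rfl fun i _ => Finset.sum_congr rfl fun k _ => ?_
      rw [smul_comm (f x), smul_comm (f x)]
    simp only [koszul, AlternatingMap.sub_apply, AlternatingMap.smul_apply,
      ContMDiffSection.coe_sub, ContMDiffSection.coe_smul, Pi.sub_apply, Pi.smul_apply, main, hB]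
    module

end Koszul

/-- The de Rham operator `Γ(Λ^j_X ⊗ V) → Γ(Λ^{j+1}_X ⊗ V)` twisted by the connection on `V`
(the exterior covariant derivative). -/
def dTwisted [T2Space X] (cov : CovariantDerivative (𝓡 n) F V) [ContMDiffVectorBundle ∞ F V (𝓡 n)]
    [cov.ContMDiffCovariantDerivative ∞] (j : ℕ) :
    TwistedForm n F V j →ₗ[ℝ] TwistedForm n F V (j + 1) where
  toFun θ := TwistedForm.ofTensorial (koszul cov j (TwistedForm.eval θ))
    (koszul_update_smul cov j (TwistedForm.eval θ) (TwistedForm.eval_update_smul θ))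
  map_add' θ η := TwistedForm.eval_injective <| by
    have h1 : TwistedForm.eval (θ + η) = (TwistedForm.eval θ) + (TwistedForm.eval η) := rfl
    have h2 (θ η : TwistedForm n F V (j + 1)) : TwistedForm.eval (θ + η) = (TwistedForm.eval θ) + (TwistedForm.eval η) := rfl
    simp only [h2, TwistedForm.eval_ofTensorial, h1, koszul_add]
  map_smul' c θ := TwistedForm.eval_injective <| by
    have h1 : TwistedForm.eval (c • θ) = c • (TwistedForm.eval θ) := rfl
    have h2 (θ : TwistedForm n F V (j + 1)) : TwistedForm.eval (c • θ) = c • (TwistedForm.eval θ) := rfl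
    simp only [RingHom.id_apply, h2, TwistedForm.eval_ofTensorial, h1, koszul_smul]

theorem eval_dTwisted [T2Space X] (cov : CovariantDerivative (𝓡 n) F V)
    [ContMDiffVectorBundle ∞ F V (𝓡 n)]
    [cov.ContMDiffCovariantDerivative ∞] (j : ℕ) (θ : TwistedForm n F V j) :
    TwistedForm.eval (dTwisted cov j θ) = koszul cov j (TwistedForm.eval θ) :=
  TwistedForm.eval_ofTensorial _ (koszul_update_smul cov j (TwistedForm.eval θ)
    (TwistedForm.eval_update_smul θ))

theorem dTwisted_smul [T2Space X] (cov : CovariantDerivative (𝓡 n) F V)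
    [ContMDiffVectorBundle ∞ F V (𝓡 n)]
    [cov.ContMDiffCovariantDerivative ∞] (j : ℕ) (θ : TwistedForm n F V j) (f : SmoothFun n X)
    (U : Fin (j + 1) → VecField n X) (x : X) :
    TwistedForm.eval (dTwisted cov j (f • θ)) U x = f x • TwistedForm.eval (dTwisted cov j θ) U x +
      ∑ i : Fin (j + 1), (-1 : ℤ) ^ (i : ℕ) •
        mvfderiv (𝓡 n) f x (U i x) • (TwistedForm.eval θ) (i.removeNth U) x := by
  simp only [eval_dTwisted]
  exact koszul_smul_fun cov j (TwistedForm.eval θ) (TwistedForm.eval (f • θ)) f (fun U => TwistedForm.eval_smul f θ U) U x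

/-- `[[d, f], g] = 0`. -/
theorem dTwisted_comm [T2Space X] (cov : CovariantDerivative (𝓡 n) F V)
    [ContMDiffVectorBundle ∞ F V (𝓡 n)]
    [cov.ContMDiffCovariantDerivative ∞] (j : ℕ) (θ : TwistedForm n F V j) (f g : SmoothFun n X) :
    dTwisted cov j (f • g • θ) - f • dTwisted cov j (g • θ) =
      g • (dTwisted cov j (f • θ) - f • dTwisted cov j θ) := by
  have e1 (a b : TwistedForm n F V (j + 1)) : TwistedForm.eval (a - b) = (TwistedForm.eval a) - (TwistedForm.eval b) := rfl
  refine TwistedForm.eval_injective (AlternatingMap.ext fun U => ?_)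
  ext x
  have h1 := dTwisted_smul cov j (g • θ) f U x
  have h2 := dTwisted_smul cov j θ f U x
  simp only [e1, TwistedForm.eval_smul, AlternatingMap.sub_apply, ContMDiffSection.coe_sub,
    Pi.sub_apply, smul_section_apply, h1, h2, add_sub_cancel_left, Finset.smul_sum]
  refine Finset.sum_congr rfl fun i _ => ?_
  rw [smul_comm (g x), smul_comm (g x)]

end Connection

section MultiOperators

variable {A : Type*} [CommRing A] [Algebra ℝ A]
  {M : Type*} [AddCommGroup M] [Module ℝ M] [Module A M] [IsScalarTower ℝ A M]
  {Q : Type*} [AddCommGroup Q] [Module ℝ Q] [Module A Q] [IsScalarTower ℝ A Q]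
  {l : ℕ}

/-- The commutator of an `l`-linear operator `Φ` with multiplication by `f` in the `i`-th argument,
`Φ (…, f • m_i, …) - f • Φ (…, m_i, …)`. -/
def slotComm (i : Fin l) (f : A) :
    MultilinearMap ℝ (fun _ : Fin l => M) Q →ₗ[A] MultilinearMap ℝ (fun _ : Fin l => M) Q where
  toFun Φ := Φ.compLinearMap
    (Function.update (fun _ => LinearMap.id) i (Algebra.lsmul ℝ ℝ M f)) - f • Φ
  map_add' Φ Ψ := by ext m; simp; abel
  map_smul' g Φ := by ext m; simp [smul_sub, smul_comm f g]

theorem slotComm_apply (i : Fin l) (f : A) (Φ : MultilinearMap ℝ (fun _ : Fin l => M) Q)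
    (m : Fin l → M) :
    slotComm i f Φ m = Φ (Function.update m i (f • m i)) - f • Φ m := by
  have : (fun k => (Function.update (fun _ : Fin l => (LinearMap.id : M →ₗ[ℝ] M)) i
      (Algebra.lsmul ℝ ℝ M f) k) (m k)) = Function.update m i (f • m i) := by
    funext k
    by_cases hk : k = i
    · subst hk; simp
    · simp [hk]
  simp [slotComm, this]

/-- The `l`-linear operators which are differential operators of order at most `k` in the `i`-th
argument: all `(k + 1)`-fold commutators with multiplications by functions vanish. -/
def orderLE (A M Q : Type*) [CommRing A] [Algebra ℝ A]
    [AddCommGroup M] [Module ℝ M] [Module A M] [IsScalarTower ℝ A M]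
    [AddCommGroup Q] [Module ℝ Q] [Module A Q] [IsScalarTower ℝ A Q]
    {l : ℕ} (i : Fin l) : ℕ → Submodule A (MultilinearMap ℝ (fun _ : Fin l => M) Q)
  | 0 => ⨅ f : A, LinearMap.ker (slotComm i f)
  | k + 1 => ⨅ f : A, (orderLE A M Q i k).comap (slotComm i f)

theorem mem_orderLE_zero {i : Fin l} {Φ : MultilinearMap ℝ (fun _ : Fin l => M) Q} :
    Φ ∈ orderLE A M Q i 0 ↔ ∀ f : A, slotComm i f Φ = 0 := by
  simp [orderLE]

theorem mem_orderLE_succ {i : Fin l} {k : ℕ} {Φ : MultilinearMap ℝ (fun _ : Fin l => M) Q} :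
    Φ ∈ orderLE A M Q i (k + 1) ↔ ∀ f : A, slotComm i f Φ ∈ orderLE A M Q i k := by
  simp [orderLE]

theorem orderLE_le_succ (i : Fin l) (k : ℕ) : orderLE A M Q i k ≤ orderLE A M Q i (k + 1) := by
  induction k with
  | zero =>
    intro Φ h
    rw [mem_orderLE_zero] at h
    rw [mem_orderLE_succ]
    intro f
    rw [h f]
    exact zero_mem _
  | succ k ih =>
    intro Φ h
    rw [mem_orderLE_succ] at h ⊢
    exact fun f => ih (h f)

theorem orderLE_mono (i : Fin l) : Monotone (orderLE A M Q i) :=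
  monotone_nat_of_le_succ (orderLE_le_succ i)

/-- The `l`-linear differential operators: those of some finite order in each argument. -/
def multiDiffOp (A M Q : Type*) [CommRing A] [Algebra ℝ A]
    [AddCommGroup M] [Module ℝ M] [Module A M] [IsScalarTower ℝ A M]
    [AddCommGroup Q] [Module ℝ Q] [Module A Q] [IsScalarTower ℝ A Q]
    (l : ℕ) : Submodule A (MultilinearMap ℝ (fun _ : Fin l => M) Q) where
  carrier := {Φ | ∃ k, ∀ i, Φ ∈ orderLE A M Q i k}
  add_mem' := by
    rintro Φ Ψ ⟨k, hk⟩ ⟨k', hk'⟩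
    exact ⟨max k k', fun i => add_mem (orderLE_mono i (le_max_left k k') (hk i))
      (orderLE_mono i (le_max_right k k') (hk' i))⟩
  zero_mem' := ⟨0, fun i => zero_mem _⟩
  smul_mem' := by
    rintro f Φ ⟨k, hk⟩
    exact ⟨k, fun i => (orderLE A M Q i k).smul_mem f (hk i)⟩

theorem compLinearMap_mem_orderLE_of_linear (T : Fin l → M →ₗ[ℝ] M) (i : Fin l)
    (hT : ∀ (f : A) (m : M), T i (f • m) = f • T i m) (k : ℕ) :
    ∀ Φ : MultilinearMap ℝ (fun _ : Fin l => M) Q,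
      Φ ∈ orderLE A M Q i k → Φ.compLinearMap T ∈ orderLE A M Q i k := by
  have key (Φ : MultilinearMap ℝ (fun _ : Fin l => M) Q) (f : A) :
      slotComm i f (Φ.compLinearMap T) = (slotComm i f Φ).compLinearMap T := by
    ext m
    have : (fun k => T k (Function.update m i (f • m i) k)) =
        Function.update (fun k => T k (m k)) i (f • T i (m i)) := by
      funext k
      by_cases hk : k = i
      · subst hk; simp [hT]
      · simp [hk]
    simp [slotComm_apply, this]
  induction k with
  | zero =>
    intro Φ hΦ
    rw [mem_orderLE_zero] at hΦ ⊢
    intro f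
    rw [key, hΦ f]
    ext m; simp
  | succ k ih =>
    intro Φ hΦ
    rw [mem_orderLE_succ] at hΦ ⊢
    intro f
    rw [key]
    exact ih _ (hΦ f)

/-- Precomposition in each argument with an operator of order at most one in the `i`-th argument
raises the order by at most one. -/
theorem compLinearMap_mem_orderLE (T : Fin l → M →ₗ[ℝ] M) (i : Fin l)
    (hT : ∀ (f g : A) (m : M),
      T i (f • g • m) - f • T i (g • m) = g • (T i (f • m) - f • T i m)) (k : ℕ) :
    ∀ Φ : MultilinearMap ℝ (fun _ : Fin l => M) Q,
      Φ ∈ orderLE A M Q i k → Φ.compLinearMap T ∈ orderLE A M Q i (k + 1) := by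
  let S (f : A) : M →ₗ[ℝ] M :=
    T i ∘ₗ Algebra.lsmul ℝ ℝ M f - Algebra.lsmul ℝ ℝ M f ∘ₗ T i
  have hS (f : A) (m : M) : S f m = T i (f • m) - f • T i m := rfl
  have key (Φ : MultilinearMap ℝ (fun _ : Fin l => M) Q) (f : A) :
      slotComm i f (Φ.compLinearMap T) = (slotComm i f Φ).compLinearMap T +
        Φ.compLinearMap (Function.update T i (S f)) := by
    ext m
    have h1 : (fun k => T k (Function.update m i (f • m i) k)) =
        Function.update (fun k => T k (m k)) i (f • T i (m i) + S f (m i)) := by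
      funext k
      by_cases hk : k = i
      · subst hk; simp [hS]
      · simp [hk]
    have h2 : (fun k => (Function.update T i (S f) k) (m k)) =
        Function.update (fun k => T k (m k)) i (S f (m i)) := by
      funext k
      by_cases hk : k = i
      · subst hk; simp
      · simp [hk]
    simp only [slotComm_apply, MultilinearMap.compLinearMap_apply, add_apply, h1, h2,
      MultilinearMap.map_update_add]
    abel
  have hlin (Φ : MultilinearMap ℝ (fun _ : Fin l => M) Q) (f : A) (k : ℕ)
      (hΦ : Φ ∈ orderLE A M Q i k) :
      Φ.compLinearMap (Function.update T i (S f)) ∈ orderLE A M Q i k :=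
    compLinearMap_mem_orderLE_of_linear _ i (fun g m => by simpa [hS] using hT f g m) k Φ hΦ
  induction k with
  | zero =>
    intro Φ hΦ
    rw [mem_orderLE_succ]
    intro f
    rw [key, (mem_orderLE_zero.1 hΦ) f]
    refine add_mem ?_ (hlin Φ f 0 hΦ)
    have : (0 : MultilinearMap ℝ (fun _ : Fin l => M) Q).compLinearMap T = 0 := by ext m; simp
    rw [this]
    exact zero_mem _
  | succ k ih =>
    intro Φ hΦ
    rw [mem_orderLE_succ]
    intro f
    rw [key]
    exact add_mem (ih _ (mem_orderLE_succ.1 hΦ f)) (hlin Φ f (k + 1) hΦ)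

theorem compLinearMap_mem_multiDiffOp (T : Fin l → M →ₗ[ℝ] M)
    (hT : ∀ i (f g : A) (m : M),
      T i (f • g • m) - f • T i (g • m) = g • (T i (f • m) - f • T i m))
    (Φ : MultilinearMap ℝ (fun _ : Fin l => M) Q)
    (hΦ : Φ ∈ multiDiffOp A M Q l) : Φ.compLinearMap T ∈ multiDiffOp A M Q l := by
  obtain ⟨k, hk⟩ := hΦ
  exact ⟨k + 1, fun i => compLinearMap_mem_orderLE T i (hT i) k Φ (hk i)⟩

end MultiOperators

section GradedOperators

variable {A : Type*} [CommRing A] [Algebra ℝ A]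
  {M : ℕ → Type*} [∀ j, AddCommGroup (M j)] [∀ j, Module ℝ (M j)] [∀ j, Module A (M j)]
  [∀ j, IsScalarTower ℝ A (M j)]
  {Q : Type*} [AddCommGroup Q] [Module ℝ Q] [Module A Q] [IsScalarTower ℝ A Q]
  {l : ℕ}

/-- The homogeneous elements of degree `a` of a graded module. -/
def homog (M : ℕ → Type*) [∀ j, AddCommGroup (M j)] [∀ j, Module ℝ (M j)] (a : ℕ) :
    Submodule ℝ (⨁ j, M j) :=
  LinearMap.range (DirectSum.lof ℝ ℕ M a)

/-- The parity operator, multiplication by `(-1)^j` in degree `j`. -/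
def parity (M : ℕ → Type*) [∀ j, AddCommGroup (M j)] [∀ j, Module ℝ (M j)] :
    (⨁ j, M j) →ₗ[ℝ] ⨁ j, M j :=
  DirectSum.toModule ℝ ℕ _ fun j => (-1 : ℝ) ^ j • DirectSum.lof ℝ ℕ M j

/-- The operator on `⨁ j, M j` with components `d j : M j → M (j + 1)`. -/
def total (d : ∀ j, M j →ₗ[ℝ] M (j + 1)) : (⨁ j, M j) →ₗ[ℝ] ⨁ j, M j :=
  DirectSum.toModule ℝ ℕ _ fun j => DirectSum.lof ℝ ℕ M (j + 1) ∘ₗ d j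

/-- `Sym^l D(M, Q)`: the `l`-linear differential operators `Φ` on the graded module `⨁ j, M j` with
values in `Q` that are symmetric in the graded sense: exchanging two neighbouring homogeneous
arguments of degrees `a` and `b` multiplies the value by `(-1)^(a b)`. -/
def symDiffOp (A : Type*) [CommRing A] [Algebra ℝ A]
    (M : ℕ → Type*) [∀ j, AddCommGroup (M j)] [∀ j, Module ℝ (M j)] [∀ j, Module A (M j)]
    [∀ j, IsScalarTower ℝ A (M j)]
    (Q : Type*) [AddCommGroup Q] [Module ℝ Q] [Module A Q] [IsScalarTower ℝ A Q] (l : ℕ) :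
    Submodule A (MultilinearMap ℝ (fun _ : Fin l => ⨁ j, M j) Q) where
  carrier := {Φ | Φ ∈ multiDiffOp A (⨁ j, M j) Q l ∧
    ∀ (i i' : Fin l), (i' : ℕ) = i + 1 → ∀ (a b : ℕ) (m : Fin l → ⨁ j, M j),
      m i ∈ homog M a → m i' ∈ homog M b →
        Φ (m ∘ Equiv.swap i i') = (-1 : ℝ) ^ (a * b) • Φ m}
  add_mem' := by
    rintro Φ Ψ ⟨h1, h2⟩ ⟨h3, h4⟩
    refine ⟨add_mem h1 h3, fun i i' hi a b m ha hb => ?_⟩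
    simp only [add_apply, h2 i i' hi a b m ha hb, h4 i i' hi a b m ha hb, smul_add]
  zero_mem' := ⟨zero_mem _, by simp⟩
  smul_mem' := by
    rintro f Φ ⟨h1, h2⟩
    refine ⟨Submodule.smul_mem _ f h1, fun i i' hi a b m ha hb => ?_⟩
    simp only [smul_apply, h2 i i' hi a b m ha hb]
    rw [smul_comm]

/-- The operators of degree `i`, where an element of `M j` has degree `j` and `Q` has degree `0`:
`Φ` vanishes on homogeneous arguments whose degrees do not add up to `-i`. -/
def ofDegree (A : Type*) [CommRing A] [Algebra ℝ A]
    (M : ℕ → Type*) [∀ j, AddCommGroup (M j)] [∀ j, Module ℝ (M j)] [∀ j, Module A (M j)]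
    [∀ j, IsScalarTower ℝ A (M j)]
    (Q : Type*) [AddCommGroup Q] [Module ℝ Q] [Module A Q] [IsScalarTower ℝ A Q] (l : ℕ) (i : ℤ) :
    Submodule A (MultilinearMap ℝ (fun _ : Fin l => ⨁ j, M j) Q) where
  carrier := {Φ | ∀ (a : Fin l → ℕ) (m : Fin l → ⨁ j, M j), (∀ k, m k ∈ homog M (a k)) →
    -(∑ k, (a k : ℤ)) ≠ i → Φ m = 0}
  add_mem' {Φ Ψ} h1 h2 a m hm ha := by
    rw [add_apply, h1 a m hm ha, h2 a m hm ha, add_zero]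
  zero_mem' _ _ _ _ := rfl
  smul_mem' f Φ h a m hm ha := by
    rw [smul_apply, h a m hm ha, smul_zero]

/-- The maps applied to the arguments in the `k`-th term of the differential. -/
def leibnizMaps (d : ∀ j, M j →ₗ[ℝ] M (j + 1)) (k : Fin l) (r : Fin l) :
    (⨁ j, M j) →ₗ[ℝ] ⨁ j, M j :=
  if r < k then parity M else if r = k then total d else LinearMap.id

/-- Right composition of an `l`-linear operator with the extension of `d` to `l` arguments by the
graded Leibniz rule:
`(δ Φ)(m_1, …, m_l) = ∑ k, (-1)^(|m_1| + … + |m_{k-1}|) Φ (m_1, …, d m_k, …, m_l)`. -/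
def rightComp (A : Type*) [CommRing A] [Algebra ℝ A]
    {M : ℕ → Type*} [∀ j, AddCommGroup (M j)] [∀ j, Module ℝ (M j)] [∀ j, Module A (M j)]
    [∀ j, IsScalarTower ℝ A (M j)]
    (Q : Type*) [AddCommGroup Q] [Module ℝ Q] [Module A Q] [IsScalarTower ℝ A Q]
    (d : ∀ j, M j →ₗ[ℝ] M (j + 1)) (l : ℕ) :
    MultilinearMap ℝ (fun _ : Fin l => ⨁ j, M j) Q →ₗ[A]
      MultilinearMap ℝ (fun _ : Fin l => ⨁ j, M j) Q where
  toFun Φ := ∑ k : Fin l, Φ.compLinearMap (leibnizMaps d k)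
  map_add' Φ Ψ := by
    rw [← Finset.sum_add_distrib]; rfl
  map_smul' f Φ := by
    rw [Finset.smul_sum]; rfl

theorem rightComp_apply (d : ∀ j, M j →ₗ[ℝ] M (j + 1))
    (Φ : MultilinearMap ℝ (fun _ : Fin l => ⨁ j, M j) Q) (m : Fin l → ⨁ j, M j) :
    rightComp A Q d l Φ m = ∑ k : Fin l, Φ fun r => leibnizMaps d k r (m r) := by
  simp [rightComp]

theorem parity_lof (a : ℕ) (x : M a) :
    parity M (DirectSum.lof ℝ ℕ M a x) = (-1 : ℝ) ^ a • DirectSum.lof ℝ ℕ M a x := by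
  simp [parity]

theorem total_lof (d : ∀ j, M j →ₗ[ℝ] M (j + 1)) (a : ℕ) (x : M a) :
    total d (DirectSum.lof ℝ ℕ M a x) = DirectSum.lof ℝ ℕ M (a + 1) (d a x) := by
  simp [total]

theorem parity_eq {a : ℕ} {x : ⨁ j, M j} (hx : x ∈ homog M a) :
    parity M x = (-1 : ℝ) ^ a • x := by
  obtain ⟨y, rfl⟩ := hx
  exact parity_lof a y

theorem total_mem {a : ℕ} {x : ⨁ j, M j} (d : ∀ j, M j →ₗ[ℝ] M (j + 1)) (hx : x ∈ homog M a) :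
    total d x ∈ homog M (a + 1) := by
  obtain ⟨y, rfl⟩ := hx
  rw [total_lof]
  exact ⟨_, rfl⟩

theorem parity_mem {a : ℕ} {x : ⨁ j, M j} (hx : x ∈ homog M a) : parity M x ∈ homog M a := by
  rw [parity_eq hx]
  exact Submodule.smul_mem _ _ hx

theorem parity_smul (f : A) (x : ⨁ j, M j) : parity M (f • x) = f • parity M x := by
  induction x using DirectSum.induction_on with
  | zero => simp
  | of j x =>
    have h : f • DirectSum.of M j x = DirectSum.lof ℝ ℕ M j (f • x) :=
      (DirectSum.lof A ℕ M j).map_smul f x |>.symm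
    rw [h, parity_lof]
    change _ = f • parity M (DirectSum.lof ℝ ℕ M j x)
    rw [parity_lof, smul_comm f]
    congr 1
    exact h.symm
  | add x y hx hy => simp [smul_add, hx, hy]

/-- `d` is a differential operator of order at most one. -/
def FirstOrder (A : Type*) [CommRing A]
    {M : ℕ → Type*} [∀ j, AddCommGroup (M j)] [∀ j, Module ℝ (M j)] [∀ j, Module A (M j)]
    (d : ∀ j, M j →ₗ[ℝ] M (j + 1)) : Prop :=
  ∀ j (f g : A) (x : M j), d j (f • g • x) - f • d j (g • x) = g • (d j (f • x) - f • d j x)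

theorem total_comm {d : ∀ j, M j →ₗ[ℝ] M (j + 1)} (hd : FirstOrder A d) (f g : A)
    (x : ⨁ j, M j) :
    total d (f • g • x) - f • total d (g • x) = g • (total d (f • x) - f • total d x) := by
  induction x using DirectSum.induction_on with
  | zero => simp
  | of j x =>
    have h (f : A) (j : ℕ) (x : M j) :
        f • DirectSum.lof ℝ ℕ M j x = DirectSum.lof ℝ ℕ M j (f • x) :=
      (DirectSum.lof A ℕ M j).map_smul f x |>.symm
    change total d (f • g • DirectSum.lof ℝ ℕ M j x) - f • total d (g • DirectSum.lof ℝ ℕ M j x) =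
      g • (total d (f • DirectSum.lof ℝ ℕ M j x) - f • total d (DirectSum.lof ℝ ℕ M j x))
    simp only [h, total_lof, ← map_sub, hd j f g x]
  | add x y hx hy =>
    have e (a b c d e f' : ⨁ j, M j) (h1 : a - b = c) (h2 : d - e = f') :
      a + d - (b + e) = c + f' := by rw [← h1, ← h2]; abel
    simp only [smul_add, map_add, e _ _ _ _ _ _ hx hy]
    rw [← smul_add]
    congr 1
    abel

theorem rightComp_mem_multiDiffOp {d : ∀ j, M j →ₗ[ℝ] M (j + 1)} (hd : FirstOrder A d)
    {Φ : MultilinearMap ℝ (fun _ : Fin l => ⨁ j, M j) Q}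
    (hΦ : Φ ∈ multiDiffOp A (⨁ j, M j) Q l) :
    rightComp A Q d l Φ ∈ multiDiffOp A (⨁ j, M j) Q l := by
  change ∑ k : Fin l, Φ.compLinearMap (leibnizMaps d k) ∈ _
  refine Submodule.sum_mem _ fun k _ => compLinearMap_mem_multiDiffOp _ (fun i f g m => ?_) Φ hΦ
  unfold leibnizMaps
  split_ifs
  · simp [parity_smul]
  · exact total_comm hd f g m
  · simp

theorem rightComp_mem_symDiffOp {d : ∀ j, M j →ₗ[ℝ] M (j + 1)} (hd : FirstOrder A d)
    {Φ : MultilinearMap ℝ (fun _ : Fin l => ⨁ j, M j) Q} (hΦ : Φ ∈ symDiffOp A M Q l) :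
    rightComp A Q d l Φ ∈ symDiffOp A M Q l := by
  refine ⟨rightComp_mem_multiDiffOp hd hΦ.1, fun i i' hi a b m ha hb => ?_⟩
  have hs := hΦ.2 i i' hi
  have hne : i ≠ i' := fun h => by rw [h] at hi; omega
  have hlt : i < i' := Fin.lt_def.2 (by omega)
  rw [rightComp_apply, rightComp_apply, Finset.smul_sum]
  refine Fintype.sum_equiv (Equiv.swap i i') _ _ fun k => ?_
  have hcomp : (fun r => leibnizMaps d k r ((m ∘ Equiv.swap i i') r)) =
      (fun r => leibnizMaps d k (Equiv.swap i i' r) (m r)) ∘ Equiv.swap i i' := by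
    funext r; simp
  have hlow (k r : Fin l) (h : r < k) : leibnizMaps d k r = parity M := by
    simp [leibnizMaps, h]
  have hmid (k : Fin l) : leibnizMaps d k k = total d := by
    simp [leibnizMaps]
  have hhigh (k r : Fin l) (h : k < r) : leibnizMaps d k r = LinearMap.id := by
    simp [leibnizMaps, not_lt.2 h.le, h.ne']
  have hsgn (p q : ℕ) : (-1 : ℝ) ^ (p + 2 * q) = (-1 : ℝ) ^ p := by
    rw [pow_add, pow_mul]; simp
  rw [hcomp]
  by_cases h1 : k = i
  · subst h1
    rw [Equiv.swap_apply_left]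
    set N : Fin l → ⨁ j, M j := fun r => leibnizMaps d k (Equiv.swap k i' r) (m r) with hN
    have hNi : N k = m k := by
      simp only [hN, Equiv.swap_apply_left, hhigh _ _ hlt, LinearMap.id_apply]
    have hNi' : N i' = total d (m i') := by
      simp only [hN, Equiv.swap_apply_right, hmid]
    have hR : (fun r => leibnizMaps d i' r (m r)) =
        Function.update N k ((-1 : ℝ) ^ a • N k) := by
      funext r
      by_cases h2 : r = k
      · subst h2
        rw [Function.update_self, hNi, hlow _ _ hlt, parity_eq ha]
      · rw [Function.update_of_ne h2]
        by_cases h3 : r = i'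
        · subst h3; rw [hNi', hmid]
        · simp only [hN, Equiv.swap_apply_of_ne_of_ne h2 h3]
          rcases lt_or_gt_of_ne h2 with h4 | h4
          · rw [hlow _ _ h4, hlow _ _ (h4.trans hlt)]
          · have h5 : i' < r := by
              have h6 : (r : ℕ) ≠ i' := fun h => h3 (Fin.ext h)
              have h7 := Fin.lt_def.1 h4
              exact Fin.lt_def.2 (by omega)
            rw [hhigh _ _ h4, hhigh _ _ h5]
    rw [hR, MultilinearMap.map_update_smul, Function.update_eq_self,
      hs a (b + 1) N (hNi ▸ ha) (hNi' ▸ total_mem d hb), smul_smul, ← pow_add]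
    congr 2
  · by_cases h2 : k = i'
    · subst h2
      rw [Equiv.swap_apply_right]
      set N : Fin l → ⨁ j, M j := fun r => leibnizMaps d k (Equiv.swap i k r) (m r) with hN
      set R : Fin l → ⨁ j, M j := fun r => leibnizMaps d i r (m r) with hR
      have hNi : N i = total d (m i) := by
        simp only [hN, Equiv.swap_apply_left, hmid]
      have hNi' : N k = (-1 : ℝ) ^ b • m k := by
        simp only [hN, Equiv.swap_apply_right, hlow _ _ hlt, parity_eq hb]
      have hRk : R k = m k := by
        simp only [hR, hhigh _ _ hlt, LinearMap.id_apply]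
      have hNR : N = Function.update R k ((-1 : ℝ) ^ b • R k) := by
        funext r
        by_cases h2 : r = k
        · subst h2
          rw [Function.update_self, hNi', hRk]
        · rw [Function.update_of_ne h2]
          by_cases h3 : r = i
          · subst h3; rw [hNi]; simp only [hR, hmid]
          · simp only [hN, hR, Equiv.swap_apply_of_ne_of_ne h3 h2]
            rcases lt_or_gt_of_ne h3 with h4 | h4
            · rw [hlow _ _ h4, hlow _ _ (h4.trans hlt)]
            · have h5 : k < r := by
                have h6 : (r : ℕ) ≠ k := fun h => h2 (Fin.ext h)
                have h7 := Fin.lt_def.1 h4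
                exact Fin.lt_def.2 (by omega)
              rw [hhigh _ _ h4, hhigh _ _ h5]
      have hΦN : Φ N = (-1 : ℝ) ^ b • Φ R := by
        rw [hNR, MultilinearMap.map_update_smul, Function.update_eq_self]
      rw [hs (a + 1) b N (hNi ▸ total_mem d ha) (hNi' ▸ Submodule.smul_mem _ _ hb), hΦN, smul_smul,
        ← pow_add]
      congr 1
      rw [← hsgn (a * b) b]
      congr 1
      ring
    · rw [Equiv.swap_apply_of_ne_of_ne h1 h2]
      have hN : (fun r => leibnizMaps d k (Equiv.swap i i' r) (m r)) =
          fun r => leibnizMaps d k r (m r) := by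
        have h3 : leibnizMaps d k i = leibnizMaps d k i' := by
          rcases lt_or_gt_of_ne h1 with h4 | h4
          · rw [hhigh _ _ h4, hhigh _ _ (h4.trans hlt)]
          · have h5 : i' < k := by
              have h6 : (k : ℕ) ≠ i' := fun h => h2 (Fin.ext h)
              have h7 := Fin.lt_def.1 h4
              exact Fin.lt_def.2 (by omega)
            rw [hlow _ _ h4, hlow _ _ h5]
        funext r
        by_cases h4 : r = i
        · subst h4; rw [Equiv.swap_apply_left, h3]
        · by_cases h5 : r = i'
          · subst h5; rw [Equiv.swap_apply_right, h3]
          · rw [Equiv.swap_apply_of_ne_of_ne h4 h5]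
      have hmem (r : Fin l) (hr : r ≠ k) (c : ℕ) (h : m r ∈ homog M c) :
          leibnizMaps d k r (m r) ∈ homog M c := by
        rcases lt_or_gt_of_ne hr with h4 | h4
        · rw [hlow _ _ h4]; exact parity_mem h
        · rw [hhigh _ _ h4]; exact h
      rw [hN]
      exact hs a b (fun r => leibnizMaps d k r (m r)) (hmem i (Ne.symm h1) a ha)
        (hmem i' (Ne.symm h2) b hb)

theorem rightComp_mem_ofDegree (d : ∀ j, M j →ₗ[ℝ] M (j + 1)) {i : ℤ}
    {Φ : MultilinearMap ℝ (fun _ : Fin l => ⨁ j, M j) Q} (hΦ : Φ ∈ ofDegree A M Q l i) :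
    rightComp A Q d l Φ ∈ ofDegree A M Q l (i + 1) := by
  intro a m hm ha
  rw [rightComp_apply]
  refine Finset.sum_eq_zero fun k _ => hΦ (Function.update a k (a k + 1)) _ (fun r => ?_) ?_
  · unfold leibnizMaps
    split_ifs with h1 h2
    · rw [Function.update_of_ne h1.ne]
      exact parity_mem (hm r)
    · subst h2
      rw [Function.update_self]
      exact total_mem d (hm r)
    · rw [Function.update_of_ne h2]
      exact hm r
  · contrapose! ha
    have : (fun r => ((Function.update a k (a k + 1) r : ℕ) : ℤ)) =
        Function.update (fun r => (a r : ℤ)) k ((a k : ℤ) + 1) := by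
      funext r
      by_cases hr : r = k
      · subst hr; simp
      · simp [hr]
    rw [this, Finset.sum_update_of_mem (Finset.mem_univ k)] at ha
    rw [← ha, ← Finset.sum_sdiff (Finset.subset_univ {k})]
    simp
    ring

/-- The type of elements of `symDiffOp`. -/
def SymDiffOp (A : Type*) [CommRing A] [Algebra ℝ A]
    (M : ℕ → Type*) [∀ j, AddCommGroup (M j)] [∀ j, Module ℝ (M j)] [∀ j, Module A (M j)]
    [∀ j, IsScalarTower ℝ A (M j)]
    (Q : Type*) [AddCommGroup Q] [Module ℝ Q] [Module A Q] [IsScalarTower ℝ A Q] (l : ℕ) : Type _ :=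
  symDiffOp A M Q l

instance : AddCommGroup (SymDiffOp A M Q l) := inferInstanceAs (AddCommGroup (symDiffOp A M Q l))

instance : Module A (SymDiffOp A M Q l) := inferInstanceAs (Module A (symDiffOp A M Q l))

/-- The operator underlying an element of `SymDiffOp`. -/
def SymDiffOp.op : SymDiffOp A M Q l →ₗ[A] MultilinearMap ℝ (fun _ : Fin l => ⨁ j, M j) Q :=
  (symDiffOp A M Q l).subtype

/-- `Sym^+ D(M, Q)`, the direct sum of the spaces `Sym^l D(M, Q)` over all `l ≥ 1`. -/
abbrev SymPlus (A : Type*) [CommRing A] [Algebra ℝ A]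
    (M : ℕ → Type*) [∀ j, AddCommGroup (M j)] [∀ j, Module ℝ (M j)] [∀ j, Module A (M j)]
    [∀ j, IsScalarTower ℝ A (M j)]
    (Q : Type*) [AddCommGroup Q] [Module ℝ Q] [Module A Q] [IsScalarTower ℝ A Q] : Type _ :=
  ⨁ l : ℕ+, SymDiffOp A M Q (l : ℕ)

variable (A M Q) in
/-- The elements of `Sym^+ D(M, Q)` of degree `i`. -/
def degreePart (i : ℤ) : Submodule A (SymPlus A M Q) :=
  ⨅ l : ℕ+, (ofDegree A M Q (l : ℕ) i).comap
    (SymDiffOp.op ∘ₗ DirectSum.component A ℕ+ (fun l : ℕ+ => SymDiffOp A M Q (l : ℕ)) l)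

variable (Q) in
/-- The differential of `Sym^l D(M, Q)` given by right composition with `d`. -/
def differentialOp {d : ∀ j, M j →ₗ[ℝ] M (j + 1)} (hd : FirstOrder A d) (l : ℕ) :
    SymDiffOp A M Q l →ₗ[A] SymDiffOp A M Q l where
  toFun Φ := ⟨rightComp A Q d l (SymDiffOp.op Φ), rightComp_mem_symDiffOp hd (Subtype.property Φ)⟩
  map_add' _ _ := Subtype.ext ((rightComp A Q d l).map_add _ _)
  map_smul' _ _ := Subtype.ext ((rightComp A Q d l).map_smul _ _)

variable (Q) in
/-- The differential of `Sym^+ D(M, Q)` given by right composition with `d`. -/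
def differential {d : ∀ j, M j →ₗ[ℝ] M (j + 1)} (hd : FirstOrder A d) :
    SymPlus A M Q →ₗ[A] SymPlus A M Q :=
  DirectSum.lmap fun l : ℕ+ => differentialOp Q hd (l : ℕ)

theorem op_differential {d : ∀ j, M j →ₗ[ℝ] M (j + 1)} (hd : FirstOrder A d)
    (Φ : SymPlus A M Q) (l : ℕ+) :
    SymDiffOp.op (differential Q hd Φ l) = rightComp A Q d l (SymDiffOp.op (Φ l)) := by
  rw [differential, DirectSum.lmap_apply]
  rfl

theorem mem_degreePart {i : ℤ} {Φ : SymPlus A M Q} :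
    Φ ∈ degreePart A M Q i ↔ ∀ l : ℕ+, SymDiffOp.op (Φ l) ∈ ofDegree A M Q (l : ℕ) i := by
  simp only [degreePart, Submodule.mem_iInf]
  rfl

variable (Q) in
/-- The cocycles of degree `i`. -/
def cocycles {d : ∀ j, M j →ₗ[ℝ] M (j + 1)} (hd : FirstOrder A d) (i : ℤ) :
    Submodule A (SymPlus A M Q) :=
  degreePart A M Q i ⊓ LinearMap.ker (differential Q hd)

variable (Q) in
/-- The cohomology in degree `i`: the cocycles of degree `i` modulo the images of the elements of
degree `i - 1` under the differential. -/
abbrev Cohomology {d : ∀ j, M j →ₗ[ℝ] M (j + 1)} (hd : FirstOrder A d) (i : ℤ) : Type _ :=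
  cocycles Q hd i ⧸
    ((degreePart A M Q (i - 1)).map (differential Q hd)).submoduleOf (cocycles Q hd i)

end GradedOperators

section DeRham

variable {n : ℕ} {X : Type*} [TopologicalSpace X] [ChartedSpace (EuclideanSpace ℝ (Fin n)) X]
  {F : Type*} [NormedAddCommGroup F] [NormedSpace ℝ F]
  {γ : X → Type*} [TopologicalSpace (TotalSpace F γ)]
  [∀ x, AddCommGroup (γ x)] [∀ x, Module ℝ (γ x)] [∀ x, TopologicalSpace (γ x)]
  [FiberBundle F γ] [VectorBundle ℝ F γ]
  {G : Type*} [NormedAddCommGroup G] [NormedSpace ℝ G]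
  {β : X → Type*} [TopologicalSpace (TotalSpace G β)]
  [∀ x, AddCommGroup (β x)] [∀ x, Module ℝ (β x)] [∀ x, TopologicalSpace (β x)]
  [FiberBundle G β] [VectorBundle ℝ G β]

variable (n F γ G β) in
/-- `Γ(Sym^l(γ^*) ⊗ β)`: families of symmetric `l`-linear maps `s x` from `γ x` to `β x` which
depend smoothly on `x` (smooth sections of `γ` are sent to smooth sections of `β`). -/
def SymSection (l : ℕ) :
    Submodule ℝ (∀ x : X, MultilinearMap ℝ (fun _ : Fin l => γ x) (β x)) where
  carrier := {s | (∀ (x : X) (σ : Equiv.Perm (Fin l)) (v : Fin l → γ x), s x (v ∘ σ) = s x v) ∧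
    ∀ t : Fin l → SmoothSection n F γ, ContMDiff (𝓡 n) ((𝓡 n).prod 𝓘(ℝ, G)) ∞
      (fun x => TotalSpace.mk' G x (s x fun i => t i x))}
  add_mem' h1 h2 := ⟨fun x σ v => by simp [h1.1 x σ v, h2.1 x σ v],
    fun t => (h1.2 t).add_section (h2.2 t)⟩
  zero_mem' := ⟨fun _ _ _ => rfl, fun _ => (0 : SmoothSection n G β).contMDiff⟩
  smul_mem' _ _ h := ⟨fun x σ v => by simp [h.1 x σ v], fun t => (h.2 t).const_smul_section⟩

namespace SymSection

variable {l : ℕ}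

theorem ext {s t : SymSection n F γ G β l} (h : ∀ x, s.1 x = t.1 x) : s = t :=
  Subtype.ext (funext h)

/-- Pointwise multiplication by functions. -/
instance : SMul (SmoothFun n X) (SymSection n F γ G β l) :=
  ⟨fun f s => ⟨fun x => f x • s.1 x, fun x σ v => by simp [s.2.1 x σ v],
    fun t => f.contMDiff.smul_section (s.2.2 t)⟩⟩

@[simp]
theorem smul_val_apply (f : SmoothFun n X) (s : SymSection n F γ G β l) (x : X) :
    (f • s).1 x = f x • s.1 x := rfl

instance : Module (SmoothFun n X) (SymSection n F γ G β l) where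
  one_smul s := ext fun x => by simp
  mul_smul f g s := ext fun x => by simp [mul_smul]
  smul_zero f := ext fun x => by simp
  smul_add f s t := ext fun x => by simp
  add_smul f g s := ext fun x => by simp [add_smul]
  zero_smul s := ext fun x => by simp

end SymSection

variable [IsManifold (𝓡 n) ∞ X]

/-- The section of `γ` underlying a `γ`-valued form of degree `0`. -/
def zeroFormSection : TwistedForm n F γ 0 →ₗ[ℝ] SmoothSection n F γ where
  toFun θ := TwistedForm.eval θ fun i => i.elim0
  map_add' _ _ := rfl
  map_smul' _ _ := rfl

/-- The degree `0` component of an inhomogeneous form, as a section. -/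
def zeroComponent : (⨁ j, TwistedForm n F γ j) →ₗ[ℝ] SmoothSection n F γ :=
  zeroFormSection ∘ₗ DirectSum.component ℝ ℕ (fun j => TwistedForm n F γ j) 0

/-- The operator of order zero given by `s ∈ Γ(Sym^l(γ^*) ⊗ β)`: it applies `s` pointwise to the
degree `0` components of its arguments. -/
def zeroOrderOp {l : ℕ} (s : SymSection n F γ G β l) :
    MultilinearMap ℝ (fun _ : Fin l => ⨁ j, TwistedForm n F γ j) (SmoothSection n G β) where
  toFun θ := ⟨fun x => s.1 x fun k => zeroComponent (θ k) x,
    s.2.2 fun k => zeroComponent (θ k)⟩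
  map_update_add' θ k a b := by
    ext x
    have h (w) : (fun r => zeroComponent (Function.update θ k w r) x) =
        Function.update (fun r => zeroComponent (θ r) x) k (zeroComponent w x) :=
      funext fun r => by by_cases hr : r = k <;> [subst hr; skip] <;> simp [*]
    simp [h]
  map_update_smul' θ k c a := by
    ext x
    have h (w) : (fun r => zeroComponent (Function.update θ k w r) x) =
        Function.update (fun r => zeroComponent (θ r) x) k (zeroComponent w x) :=
      funext fun r => by by_cases hr : r = k <;> [subst hr; skip] <;> simp [*]
    simp [h]

theorem zeroOrderOp_apply {l : ℕ} (s : SymSection n F γ G β l)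
    (θ : Fin l → ⨁ j, TwistedForm n F γ j) (x : X) :
    zeroOrderOp s θ x = s.1 x fun k => zeroComponent (θ k) x := rfl

theorem zeroComponent_smul (f : SmoothFun n X) (θ : ⨁ j, TwistedForm n F γ j) (x : X) :
    zeroComponent (f • θ) x = f x • zeroComponent θ x := by
  rfl

theorem zeroComponent_eq_zero {a : ℕ} (ha : a ≠ 0) {θ : ⨁ j, TwistedForm n F γ j}
    (hθ : θ ∈ homog (fun j => TwistedForm n F γ j) a) : zeroComponent θ = 0 := by
  obtain ⟨η, rfl⟩ := hθ
  have : DirectSum.component ℝ ℕ (fun j => TwistedForm n F γ j) 0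
      (DirectSum.lof ℝ ℕ (fun j => TwistedForm n F γ j) a η) = 0 := by
    rw [DirectSum.component.of, dif_neg ha]
  rw [zeroComponent, LinearMap.comp_apply, this, map_zero]

theorem zeroOrderOp_eq_zero {l : ℕ} (s : SymSection n F γ G β l)
    (θ : Fin l → ⨁ j, TwistedForm n F γ j) (k : Fin l) (hk : zeroComponent (θ k) = 0) :
    zeroOrderOp s θ = 0 := by
  ext x
  rw [zeroOrderOp_apply]
  exact (s.1 x).map_coord_zero k (by rw [hk]; rfl)

theorem zeroOrderOp_mem {l : ℕ} (s : SymSection n F γ G β l) :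
    zeroOrderOp s ∈ symDiffOp (SmoothFun n X) (fun j => TwistedForm n F γ j)
      (SmoothSection n G β) l := by
  refine ⟨⟨0, fun i => mem_orderLE_zero.2 fun f => ?_⟩, fun i i' _ a b θ ha hb => ?_⟩
  · refine MultilinearMap.ext fun θ => ?_
    rw [slotComm_apply]
    have : zeroOrderOp s (Function.update θ i (f • θ i)) = f • zeroOrderOp s θ := by
      ext x
      have h : (fun k => zeroComponent (Function.update θ i (f • θ i) k) x) =
          Function.update (fun k => zeroComponent (θ k) x) i (f x • zeroComponent (θ i) x) := by
        funext k
        by_cases hk : k = i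
        · subst hk; simp [zeroComponent_smul]
        · simp [hk]
      rw [smul_section_apply, zeroOrderOp_apply, zeroOrderOp_apply, h,
        MultilinearMap.map_update_smul, Function.update_eq_self]
    rw [this, sub_self]
    rfl
  · by_cases h : a = 0 ∧ b = 0
    · rw [h.1, zero_mul, pow_zero, one_smul]
      ext x
      exact s.2.1 x (Equiv.swap i i') fun k => zeroComponent (θ k) x
    · have h0 : ∃ k, zeroComponent (θ k) = 0 := by
        by_cases h1 : a = 0
        · exact ⟨i', zeroComponent_eq_zero (fun h2 => h ⟨h1, h2⟩) hb⟩
        · exact ⟨i, zeroComponent_eq_zero h1 ha⟩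
      obtain ⟨k, hk⟩ := h0
      rw [zeroOrderOp_eq_zero s θ k hk, smul_zero]
      exact zeroOrderOp_eq_zero s _ (Equiv.swap i i' k) (by simpa using hk)

theorem zeroOrderOp_mem_ofDegree {l : ℕ} (s : SymSection n F γ G β l) :
    zeroOrderOp s ∈ ofDegree (SmoothFun n X) (fun j => TwistedForm n F γ j)
      (SmoothSection n G β) l 0 := by
  intro a θ hθ ha
  have h : ∃ k, a k ≠ 0 := by
    by_contra! h
    simp [h] at ha
  obtain ⟨k, hk⟩ := h
  exact zeroOrderOp_eq_zero s θ k (zeroComponent_eq_zero hk (hθ k))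

/-- Sections of `Sym^l(γ^*) ⊗ β` as operators of order zero. -/
def zeroOrder (l : ℕ) : SymSection n F γ G β l →ₗ[SmoothFun n X]
    SymDiffOp (SmoothFun n X) (fun j => TwistedForm n F γ j) (SmoothSection n G β) l where
  toFun s := (⟨zeroOrderOp s, zeroOrderOp_mem s⟩ :
    symDiffOp (SmoothFun n X) (fun j => TwistedForm n F γ j) (SmoothSection n G β) l)
  map_add' _ _ := rfl
  map_smul' _ _ := rfl

theorem op_zeroOrder {l : ℕ} (s : SymSection n F γ G β l) :
    SymDiffOp.op (zeroOrder l s) = zeroOrderOp s := rfl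

variable [T2Space X] [∀ x, IsTopologicalAddGroup (γ x)] [∀ x, ContinuousSMul ℝ (γ x)]
  [ContMDiffVectorBundle ∞ F γ (𝓡 n)]
  (cov : CovariantDerivative (𝓡 n) F γ) [cov.ContMDiffCovariantDerivative ∞]

theorem firstOrder_dTwisted : FirstOrder (SmoothFun n X) (dTwisted cov) :=
  fun j f g θ => dTwisted_comm cov j θ f g

variable (n X F γ G β) in
/-- The `C^∞(X)`-module `Sym^+ D(Λ^•_X ⊗ γ, β)`. -/
abbrev SymPlusDiffOp : Type _ :=
  SymPlus (SmoothFun n X) (fun j => TwistedForm n F γ j) (SmoothSection n G β)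

variable (n X F γ G β) in
/-- The elements of degree `i` of `Sym^+ D(Λ^•_X ⊗ γ, β)`. -/
abbrev degreeSubmodule (i : ℤ) : Submodule (SmoothFun n X) (SymPlusDiffOp n X F γ G β) :=
  degreePart (SmoothFun n X) (fun j => TwistedForm n F γ j) (SmoothSection n G β) i

variable (G β) in
/-- The differential of `Sym^+ D(Λ^•_X ⊗ γ, β)`: right composition with the twisted de Rham
operator. -/
abbrev deRhamDifferential :
    SymPlusDiffOp n X F γ G β →ₗ[SmoothFun n X] SymPlusDiffOp n X F γ G β :=
  differential (SmoothSection n G β) (firstOrder_dTwisted cov)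

variable (G β) in
/-- The cohomology of `Sym^+ D(Λ^•_X ⊗ γ, β)` in degree `i`. -/
abbrev deRhamCohomology (i : ℤ) : Type _ :=
  Cohomology (SmoothSection n G β) (firstOrder_dTwisted cov) i

theorem zeroComponent_total (θ : ⨁ j, TwistedForm n F γ j) :
    zeroComponent (total (dTwisted cov) θ) = 0 := by
  induction θ using DirectSum.induction_on with
  | zero => simp
  | of j θ =>
    exact zeroComponent_eq_zero (Nat.succ_ne_zero j) (total_mem (dTwisted cov) ⟨θ, rfl⟩)
  | add θ η h1 h2 => simp [h1, h2]

theorem rightComp_zeroOrderOp {l : ℕ} (s : SymSection n F γ G β l) :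
    rightComp (SmoothFun n X) (SmoothSection n G β) (dTwisted cov) l (zeroOrderOp s) = 0 := by
  refine MultilinearMap.ext fun θ => ?_
  rw [rightComp_apply]
  refine Finset.sum_eq_zero fun k _ => zeroOrderOp_eq_zero s _ k ?_
  simp only [leibnizMaps, lt_irrefl, if_false, if_true]
  exact zeroComponent_total cov (θ k)

variable (n X F γ G β) in
/-- `Γ(Sym^+(γ^*) ⊗ β)`, the direct sum of the modules `Γ(Sym^l(γ^*) ⊗ β)` over all `l ≥ 1`. -/
abbrev SymPlusSection : Type _ := ⨁ l : ℕ+, SymSection n F γ G β (l : ℕ)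

variable (n X F γ G β) in
/-- Sections of `Sym^+(γ^*) ⊗ β` as operators of order zero. -/
def zeroOrderPlus : SymPlusSection n X F γ G β →ₗ[SmoothFun n X] SymPlusDiffOp n X F γ G β :=
  DirectSum.lmap (R := SmoothFun n X) (M := fun l : ℕ+ => SymSection n F γ G β (l : ℕ))
    (N := fun l : ℕ+ => SymDiffOp (SmoothFun n X) (fun j => TwistedForm n F γ j)
      (SmoothSection n G β) (l : ℕ)) fun l : ℕ+ => zeroOrder (l : ℕ)

theorem op_zeroOrderPlus (s : SymPlusSection n X F γ G β) (l : ℕ+) :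
    SymDiffOp.op (zeroOrderPlus n X F γ G β s l) = zeroOrderOp (s l) := by
  rw [zeroOrderPlus, DirectSum.lmap_apply]
  rfl

theorem zeroOrderPlus_mem (s : SymPlusSection n X F γ G β) :
    zeroOrderPlus n X F γ G β s ∈
      cocycles (SmoothSection n G β) (firstOrder_dTwisted cov) 0 := by
  refine ⟨mem_degreePart.2 fun l => ?_, ?_⟩
  · rw [op_zeroOrderPlus]
    exact zeroOrderOp_mem_ofDegree (s l)
  · refine LinearMap.mem_ker.2 (DFinsupp.ext fun l => Subtype.ext ?_)
    refine (op_differential (firstOrder_dTwisted cov) _ l).trans ?_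
    rw [op_zeroOrderPlus, rightComp_zeroOrderOp]
    rfl

/-- The map from `Γ(Sym^+(γ^*) ⊗ β)` to the cohomology in degree `0` which sends a section to the
class of the operator of order zero it defines. -/
def zeroOrderClass : SymPlusSection n X F γ G β →ₗ[SmoothFun n X] deRhamCohomology G β cov 0 :=
  Submodule.mkQ _ ∘ₗ LinearMap.codRestrict _ (zeroOrderPlus n X F γ G β) (zeroOrderPlus_mem cov)

end DeRham

end

end TwistedDeRham

/-!
# Symmetric differential operators on twisted forms

Write `δ` for the right composition with the twisted de Rham operator `d`. That `δ² = 0` is the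
flatness of the connection (`dTwisted_dTwisted`). The cohomology is computed with a homotopy which
inverts `δ` up to lower order.

Let `x a` be functions and `U a` vector fields which form a dual frame on an open set, and `ι a` the
contraction with `U a`. For an operator `Φ` of one argument put `h Φ = ∑ a, [Φ, x a] ∘ ι a`, and for
several arguments extend this to each of them by the graded Leibniz rule (`localHomotopy`). The
commutator of `Φ` with `x a` is the derivative of its symbol in the direction of a covector and `d`
multiplies the symbol by a covector, so that on symbols `δ` and `h` are the two differentials of a
Koszul complex. By Euler's formula `δ h + h δ` is then the multiplication by `k + p` on operators
of total order `k` and form degree `p`, up to operators of total order less than `k`. The proof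
(`IsLocalContraction.smul_anticomm_sub_mem`) avoids symbols and goes by induction on `k`: the
commutator of `δ h + h δ` with a function `f` is computed from the fact that the Lie derivative
`d ι a + ι a d` is a derivation over `U a`, and what is left over is
`∑ a, U a f • [Φ, x a] - [Φ, f]`, which is of order two less than `Φ` because a derivation at a
point is determined by its values on coordinates (`pointDerivation_eq_zero`). For `k = 0` the
formula is `∑ a, dx a ∧ ι a = p` on `p`-forms.

The local homotopies are glued by a partition of unity multiplying the values of the operators.
Both `δ` and the commutators with functions are linear over the functions of the target, so that
all the properties above survive (`isOrderHomotopy_glueHomotopy`, `exists_isOrderHomotopy`).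

If `p > 0`, the number `k + p` never vanishes, and descending through the orders one sees that
every cocycle is a coboundary (`IsOrderHomotopy.exists_rightComp_eq`). If `p = 0`, the descent
stops at order zero: each class is represented by an operator of order zero
(`IsOrderHomotopy.exists_sub_rightComp_mem`), which is a section of `Sym^l(γ^*) ⊗ β` by
tensoriality (`exists_zeroOrderOp_eq`). Conversely `h` annihilates operators of order zero, and if
`h δ Ψ = 0` with `Ψ` of degree `-1`, then `δ Ψ = 0` by the same descent
(`IsOrderHomotopy.rightComp_eq_zero`), so that no nonzero operator of order zero is a coboundary.
-/

namespace TwistedDeRham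

noncomputable section

set_option linter.unusedSectionVars false

/-! ### Precomposition and the filtration by total order -/

section Precomposition

variable {A : Type*} [CommRing A] [Algebra ℝ A]
  {M : Type*} [AddCommGroup M] [Module ℝ M] [Module A M] [IsScalarTower ℝ A M]
  {Q : Type*} [AddCommGroup Q] [Module ℝ Q] [Module A Q] [IsScalarTower ℝ A Q]
  {l : ℕ}

variable (A Q) in
/-- Precomposition with a linear map in each argument, as a map which is `A`-linear in the
operator. -/
def precomp (T : Fin l → M →ₗ[ℝ] M) :
    MultilinearMap ℝ (fun _ : Fin l => M) Q →ₗ[A] MultilinearMap ℝ (fun _ : Fin l => M) Q where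
  toFun Φ := Φ.compLinearMap T
  map_add' _ _ := rfl
  map_smul' _ _ := rfl

theorem precomp_apply (T : Fin l → M →ₗ[ℝ] M) (Φ : MultilinearMap ℝ (fun _ : Fin l => M) Q)
    (m : Fin l → M) : precomp A Q T Φ m = Φ fun r => T r (m r) := rfl

variable (A Q) in
/-- Precomposition with a linear map in the `r`-th argument. -/
def slotComp (r : Fin l) (T : M →ₗ[ℝ] M) :
    MultilinearMap ℝ (fun _ : Fin l => M) Q →ₗ[A] MultilinearMap ℝ (fun _ : Fin l => M) Q :=
  precomp A Q (Function.update (fun _ => LinearMap.id) r T)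

theorem slotComp_apply (r : Fin l) (T : M →ₗ[ℝ] M)
    (Φ : MultilinearMap ℝ (fun _ : Fin l => M) Q) (m : Fin l → M) :
    slotComp A Q r T Φ m = Φ (Function.update m r (T (m r))) := by
  rw [slotComp, precomp_apply]
  congr 1
  funext k
  by_cases hk : k = r
  · subst hk; simp
  · simp [hk]

theorem slotComp_add (r : Fin l) (S T : M →ₗ[ℝ] M)
    (Φ : MultilinearMap ℝ (fun _ : Fin l => M) Q) :
    slotComp A Q r (S + T) Φ = slotComp A Q r S Φ + slotComp A Q r T Φ := by
  ext m
  simp [slotComp_apply]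

theorem slotComp_sub (r : Fin l) (S T : M →ₗ[ℝ] M)
    (Φ : MultilinearMap ℝ (fun _ : Fin l => M) Q) :
    slotComp A Q r (S - T) Φ = slotComp A Q r S Φ - slotComp A Q r T Φ := by
  ext m
  simp [slotComp_apply]

theorem slotComp_sum {ι : Type*} (s : Finset ι) (r : Fin l) (T : ι → M →ₗ[ℝ] M)
    (Φ : MultilinearMap ℝ (fun _ : Fin l => M) Q) :
    slotComp A Q r (∑ a ∈ s, T a) Φ = ∑ a ∈ s, slotComp A Q r (T a) Φ := by
  ext m
  simp only [slotComp_apply, LinearMap.sum_apply, sum_apply]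
  exact map_sum (Φ.toLinearMap m r) (fun a => T a (m r)) s

theorem slotComp_slotComp_self (r : Fin l) (S T : M →ₗ[ℝ] M)
    (Φ : MultilinearMap ℝ (fun _ : Fin l => M) Q) :
    slotComp A Q r S (slotComp A Q r T Φ) = slotComp A Q r (T ∘ₗ S) Φ := by
  ext m
  simp [slotComp_apply]

theorem slotComp_comm {r s : Fin l} (h : r ≠ s) (S T : M →ₗ[ℝ] M)
    (Φ : MultilinearMap ℝ (fun _ : Fin l => M) Q) :
    slotComp A Q r S (slotComp A Q s T Φ) = slotComp A Q s T (slotComp A Q r S Φ) := by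
  ext m
  simp only [slotComp_apply, Function.update_of_ne h, Function.update_of_ne h.symm]
  rw [Function.update_comm h]

theorem slotComm_eq (r : Fin l) (f : A) (Φ : MultilinearMap ℝ (fun _ : Fin l => M) Q) :
    slotComm r f Φ = slotComp A Q r (Algebra.lsmul ℝ ℝ M f) Φ - f • Φ := rfl

theorem slotComm_comm (r s : Fin l) (f g : A) (Φ : MultilinearMap ℝ (fun _ : Fin l => M) Q) :
    slotComm r f (slotComm s g Φ) = slotComm s g (slotComm r f Φ) := by
  have h : slotComp A Q r (Algebra.lsmul ℝ ℝ M f) (slotComp A Q s (Algebra.lsmul ℝ ℝ M g) Φ) =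
      slotComp A Q s (Algebra.lsmul ℝ ℝ M g) (slotComp A Q r (Algebra.lsmul ℝ ℝ M f) Φ) := by
    by_cases h : r = s
    · subst h
      rw [slotComp_slotComp_self, slotComp_slotComp_self]
      congr 2
      ext m
      simp [smul_smul, mul_comm]
    · exact slotComp_comm h _ _ Φ
  simp only [slotComm_eq, map_sub, map_smul, smul_sub, h, smul_smul, mul_comm f g]
  abel

variable (A Q) in
/-- The sum over all arguments of the precompositions with `T`. -/
def evenComp (l : ℕ) (T : M →ₗ[ℝ] M) :
    MultilinearMap ℝ (fun _ : Fin l => M) Q →ₗ[A] MultilinearMap ℝ (fun _ : Fin l => M) Q :=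
  ∑ r : Fin l, slotComp A Q r T

theorem evenComp_eq (T : M →ₗ[ℝ] M) (Φ : MultilinearMap ℝ (fun _ : Fin l => M) Q) :
    evenComp A Q l T Φ = ∑ r : Fin l, slotComp A Q r T Φ := by
  simp [evenComp]

/-- The commutator of `T` with the multiplication by `f`. -/
def mulComm (T : M →ₗ[ℝ] M) (f : A) : M →ₗ[ℝ] M :=
  T ∘ₗ Algebra.lsmul ℝ ℝ M f - Algebra.lsmul ℝ ℝ M f ∘ₗ T

theorem mulComm_apply (T : M →ₗ[ℝ] M) (f : A) (m : M) :
    mulComm T f m = T (f • m) - f • T m := rfl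

theorem slotComm_evenComp (r : Fin l) (f : A) (T : M →ₗ[ℝ] M)
    (Φ : MultilinearMap ℝ (fun _ : Fin l => M) Q) :
    slotComm r f (evenComp A Q l T Φ) =
      evenComp A Q l T (slotComm r f Φ) + slotComp A Q r (mulComm T f) Φ := by
  have h (k : Fin l) : slotComm r f (slotComp A Q k T Φ) = slotComp A Q k T (slotComm r f Φ) +
      if k = r then slotComp A Q r (mulComm T f) Φ else 0 := by
    simp only [slotComm_eq, map_sub, map_smul]
    split_ifs with hk
    · subst hk
      rw [slotComp_slotComp_self, slotComp_slotComp_self, mulComm, slotComp_sub]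
      abel
    · rw [slotComp_comm (Ne.symm hk), add_zero]
  rw [evenComp_eq, evenComp_eq, map_sum, Finset.sum_congr rfl fun k _ => h k,
    Finset.sum_add_distrib]
  simp

/-- The filtration of the `l`-linear operators by total order: the members of the `k`-th step are
the operators all of whose `k`-fold commutators with functions, in any arguments, vanish. For
differential operators this says that the total order is less than `k`. -/
def totalOrderLT (A M Q : Type*) [CommRing A] [Algebra ℝ A]
    [AddCommGroup M] [Module ℝ M] [Module A M] [IsScalarTower ℝ A M]
    [AddCommGroup Q] [Module ℝ Q] [Module A Q] [IsScalarTower ℝ A Q]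
    (l : ℕ) : ℕ → Submodule A (MultilinearMap ℝ (fun _ : Fin l => M) Q)
  | 0 => ⊥
  | k + 1 => ⨅ (r : Fin l) (f : A), (totalOrderLT A M Q l k).comap (slotComm r f)

theorem mem_totalOrderLT_zero {Φ : MultilinearMap ℝ (fun _ : Fin l => M) Q} :
    Φ ∈ totalOrderLT A M Q l 0 ↔ Φ = 0 := by
  simp [totalOrderLT]

theorem mem_totalOrderLT_succ {k : ℕ} {Φ : MultilinearMap ℝ (fun _ : Fin l => M) Q} :
    Φ ∈ totalOrderLT A M Q l (k + 1) ↔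
      ∀ (r : Fin l) (f : A), slotComm r f Φ ∈ totalOrderLT A M Q l k := by
  simp [totalOrderLT]

theorem mem_totalOrderLT_one {Φ : MultilinearMap ℝ (fun _ : Fin l => M) Q} :
    Φ ∈ totalOrderLT A M Q l 1 ↔ ∀ (r : Fin l) (f : A), slotComm r f Φ = 0 := by
  simp [mem_totalOrderLT_succ, mem_totalOrderLT_zero]

theorem map_smul_of_mem_totalOrderLT_one {Φ : MultilinearMap ℝ (fun _ : Fin l => M) Q}
    (hΦ : Φ ∈ totalOrderLT A M Q l 1) (f : A) (r : Fin l) (m : Fin l → M) (w : M) :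
    Φ (Function.update m r (f • w)) = f • Φ (Function.update m r w) := by
  have h := DFunLike.congr_fun (mem_totalOrderLT_one.1 hΦ r f) (Function.update m r w)
  rw [slotComm_apply] at h
  simpa [sub_eq_zero] using h

theorem slotComm_mem_orderLE (r s : Fin l) (g : A) (k : ℕ) :
    ∀ Φ : MultilinearMap ℝ (fun _ : Fin l => M) Q, Φ ∈ orderLE A M Q r k →
      slotComm s g Φ ∈ orderLE A M Q r k := by
  induction k with
  | zero =>
    intro Φ hΦ
    rw [mem_orderLE_zero] at hΦ ⊢
    intro f
    rw [slotComm_comm, hΦ f, map_zero]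
  | succ k ih =>
    intro Φ hΦ
    rw [mem_orderLE_succ] at hΦ ⊢
    intro f
    rw [slotComm_comm]
    exact ih _ (hΦ f)

theorem mem_totalOrderLT_of_mem_orderLE (N : ℕ) :
    ∀ (κ : Fin l → ℕ) (Φ : MultilinearMap ℝ (fun _ : Fin l => M) Q), ∑ r, κ r = N →
      (∀ r, Φ ∈ orderLE A M Q r (κ r)) → Φ ∈ totalOrderLT A M Q l (N + 1) := by
  induction N with
  | zero =>
    intro κ Φ hκ hΦ
    rw [mem_totalOrderLT_one]
    intro r f
    have h : κ r = 0 := by simpa using (Finset.sum_eq_zero_iff.1 hκ) r (Finset.mem_univ r)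
    exact mem_orderLE_zero.1 (h ▸ hΦ r) f
  | succ N ih =>
    intro κ Φ hκ hΦ
    rw [mem_totalOrderLT_succ]
    intro r f
    cases h : κ r with
    | zero =>
      rw [mem_orderLE_zero.1 (h ▸ hΦ r) f]
      exact zero_mem _
    | succ c =>
      refine ih (Function.update κ r c) _ ?_ fun s => ?_
      · have h1 := Finset.sum_update_of_mem (Finset.mem_univ r) κ c
        have h2 := Finset.sum_sdiff (f := κ) (Finset.subset_univ {r})
        rw [Finset.sum_singleton] at h2
        omega
      · by_cases hs : s = r
        · subst hs
          rw [Function.update_self]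
          exact mem_orderLE_succ.1 (h ▸ hΦ s) f
        · rw [Function.update_of_ne hs]
          exact slotComm_mem_orderLE s r f _ Φ (hΦ s)

theorem exists_mem_totalOrderLT {Φ : MultilinearMap ℝ (fun _ : Fin l => M) Q}
    (hΦ : Φ ∈ multiDiffOp A M Q l) : ∃ k, Φ ∈ totalOrderLT A M Q l (k + 1) := by
  obtain ⟨k, hk⟩ := hΦ
  exact ⟨_, mem_totalOrderLT_of_mem_orderLE _ (fun _ => k) Φ rfl hk⟩

/-- Differential operators are local: if the `r`-th argument is unchanged by the multiplication
with a function `g` which vanishes at a point, then the value vanishes at this point. -/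
theorem apply_eq_zero_of_smul_eq_self {W : Type*} [AddCommGroup W] [Module ℝ W]
    (ev : Q →ₗ[ℝ] W) (g : A) (hev : ∀ q : Q, ev (g • q) = 0) (r : Fin l) (m : Fin l → M)
    (hm : g • m r = m r) (k : ℕ) :
    ∀ Φ ∈ totalOrderLT A M Q l k, ev (Φ m) = 0 := by
  induction k with
  | zero =>
    intro Φ hΦ
    rw [mem_totalOrderLT_zero.1 hΦ]
    simp
  | succ k ih =>
    intro Φ hΦ
    have h := ih _ (mem_totalOrderLT_succ.1 hΦ r g)
    rwa [slotComm_apply, hm, Function.update_eq_self, map_sub, hev, sub_zero] at h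

/-- The commutators of an operator of total order at most one with functions obey the Leibniz
rule. -/
theorem slotComm_mul {Φ : MultilinearMap ℝ (fun _ : Fin l => M) Q}
    (hΦ : Φ ∈ totalOrderLT A M Q l 2) (r : Fin l) (f g : A) :
    slotComm r (f * g) Φ = f • slotComm r g Φ + g • slotComm r f Φ := by
  ext m
  have h := DFunLike.congr_fun (mem_totalOrderLT_one.1 (mem_totalOrderLT_succ.1 hΦ r f) r g) m
  simp only [slotComm_apply, Function.update_self, Function.update_idem, smul_smul,
    zero_apply] at h
  simp only [slotComm_apply, add_apply, smul_apply, smul_sub, mul_smul]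
  simp only [smul_sub, smul_smul, mul_comm g f] at h
  simp only [smul_smul, mul_comm g f]
  rw [sub_eq_zero, sub_eq_iff_eq_add] at h
  rw [h]
  abel

theorem slotComm_add_fun (r : Fin l) (f g : A) (Φ : MultilinearMap ℝ (fun _ : Fin l => M) Q) :
    slotComm r (f + g) Φ = slotComm r f Φ + slotComm r g Φ := by
  ext m
  simp only [slotComm_apply, add_smul, MultilinearMap.map_update_add, add_apply]
  abel

theorem slotComm_smul_fun (r : Fin l) (c : ℝ) (f : A)
    (Φ : MultilinearMap ℝ (fun _ : Fin l => M) Q) :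
    slotComm r (c • f) Φ = c • slotComm r f Φ := by
  ext m
  simp only [slotComm_apply, smul_assoc, MultilinearMap.map_update_smul, smul_apply, smul_sub]

end Precomposition

section Graded

variable {A : Type*} [CommRing A] [Algebra ℝ A]
  {M : ℕ → Type*} [∀ j, AddCommGroup (M j)] [∀ j, Module ℝ (M j)] [∀ j, Module A (M j)]
  [∀ j, IsScalarTower ℝ A (M j)]
  {Q : Type*} [AddCommGroup Q] [Module ℝ Q] [Module A Q] [IsScalarTower ℝ A Q]
  {l : ℕ}

theorem smul_lof (f : A) (j : ℕ) (x : M j) :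
    f • DirectSum.lof ℝ ℕ M j x = DirectSum.lof ℝ ℕ M j (f • x) :=
  ((DirectSum.lof A ℕ M j).map_smul f x).symm

theorem smul_mem_homog (f : A) {a : ℕ} {x : ⨁ j, M j} (hx : x ∈ homog M a) :
    f • x ∈ homog M a := by
  obtain ⟨y, rfl⟩ := hx
  exact ⟨f • y, (smul_lof f a y).symm⟩

theorem parity_parity (x : ⨁ j, M j) : parity M (parity M x) = x := by
  induction x using DirectSum.induction_on with
  | zero => simp
  | of j x =>
    change parity M (parity M (DirectSum.lof ℝ ℕ M j x)) = DirectSum.lof ℝ ℕ M j x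
    rw [parity_lof, map_smul, parity_lof, smul_smul, ← mul_pow]
    simp
  | add x y hx hy => rw [map_add, map_add, hx, hy]

/-- An odd operator on a graded module: it changes the parity of the degree. -/
def IsOddMap (D : (⨁ j, M j) →ₗ[ℝ] ⨁ j, M j) : Prop :=
  ∀ a, ∀ x ∈ homog M a, ∃ c, Odd (a + c) ∧ D x ∈ homog M c

/-- An operator of degree `-1` on a graded module. -/
def LowersDegree (D : (⨁ j, M j) →ₗ[ℝ] ⨁ j, M j) : Prop :=
  (∀ x ∈ homog M 0, D x = 0) ∧ ∀ a, ∀ x ∈ homog M (a + 1), D x ∈ homog M a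

theorem LowersDegree.isOddMap {D : (⨁ j, M j) →ₗ[ℝ] ⨁ j, M j} (hD : LowersDegree D) :
    IsOddMap D := by
  rintro (_ | a) x hx
  · exact ⟨1, by simp, by rw [hD.1 x hx]; exact zero_mem _⟩
  · exact ⟨a, ⟨a, by ring⟩, hD.2 a x hx⟩

theorem LowersDegree.smul {D : (⨁ j, M j) →ₗ[ℝ] ⨁ j, M j} (hD : LowersDegree D) (f : A) :
    LowersDegree (Algebra.lsmul ℝ ℝ (⨁ j, M j) f ∘ₗ D) :=
  ⟨fun x hx => by simp [hD.1 x hx], fun a x hx => smul_mem_homog f (hD.2 a x hx)⟩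

theorem isOddMap_total (d : ∀ j, M j →ₗ[ℝ] M (j + 1)) : IsOddMap (total d) :=
  fun a _ hx => ⟨a + 1, ⟨a, by ring⟩, total_mem d hx⟩

theorem neg_one_pow_eq_of_odd_add {a c : ℕ} (h : Odd (a + c)) : (-1 : ℝ) ^ c = -(-1) ^ a := by
  rcases Nat.even_or_odd a with ha | ha
  · rw [ha.neg_one_pow, ((Nat.odd_add'.1 h).2 ha).neg_one_pow]
  · rw [ha.neg_one_pow, neg_neg, ((Nat.odd_add.1 h).1 ha).neg_one_pow]

theorem IsOddMap.parity_apply {D : (⨁ j, M j) →ₗ[ℝ] ⨁ j, M j} (hD : IsOddMap D) (x : ⨁ j, M j) :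
    parity M (D x) = -D (parity M x) := by
  induction x using DirectSum.induction_on with
  | zero => simp
  | of j x =>
    have hx : DirectSum.of M j x ∈ homog M j := ⟨x, rfl⟩
    obtain ⟨c, hc, h⟩ := hD j _ hx
    rw [parity_eq h, parity_eq hx, map_smul, neg_one_pow_eq_of_odd_add hc, neg_smul]
  | add x y hx hy => rw [map_add, map_add, hx, hy, map_add, map_add, neg_add]

/-- The maps applied to the arguments in the `k`-th term of the extension of the odd operator `D`
to several arguments by the graded Leibniz rule. -/
def signedMaps (D : (⨁ j, M j) →ₗ[ℝ] ⨁ j, M j) (k r : Fin l) : (⨁ j, M j) →ₗ[ℝ] ⨁ j, M j :=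
  if r < k then parity M else if r = k then D else LinearMap.id

theorem signedMaps_of_lt (D : (⨁ j, M j) →ₗ[ℝ] ⨁ j, M j) {k r : Fin l} (h : r < k) :
    signedMaps D k r = parity M := if_pos h

theorem signedMaps_self (D : (⨁ j, M j) →ₗ[ℝ] ⨁ j, M j) (k : Fin l) : signedMaps D k k = D := by
  simp [signedMaps]

theorem signedMaps_of_gt (D : (⨁ j, M j) →ₗ[ℝ] ⨁ j, M j) {k r : Fin l} (h : k < r) :
    signedMaps D k r = LinearMap.id := by
  simp [signedMaps, not_lt.2 h.le, h.ne']

variable (A Q) in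
/-- Right composition of an `l`-linear operator with the extension of the odd operator `D` to `l`
arguments by the graded Leibniz rule. -/
def oddComp (l : ℕ) (D : (⨁ j, M j) →ₗ[ℝ] ⨁ j, M j) :
    MultilinearMap ℝ (fun _ : Fin l => ⨁ j, M j) Q →ₗ[A]
      MultilinearMap ℝ (fun _ : Fin l => ⨁ j, M j) Q :=
  ∑ k : Fin l, precomp A Q (signedMaps D k)

theorem oddComp_eq (D : (⨁ j, M j) →ₗ[ℝ] ⨁ j, M j)
    (Φ : MultilinearMap ℝ (fun _ : Fin l => ⨁ j, M j) Q) :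
    oddComp A Q l D Φ = ∑ k : Fin l, Φ.compLinearMap (signedMaps D k) := by
  simp [oddComp]
  rfl

theorem oddComp_apply (D : (⨁ j, M j) →ₗ[ℝ] ⨁ j, M j)
    (Φ : MultilinearMap ℝ (fun _ : Fin l => ⨁ j, M j) Q) (m : Fin l → ⨁ j, M j) :
    oddComp A Q l D Φ m = ∑ k : Fin l, Φ fun r => signedMaps D k r (m r) := by
  simp [oddComp_eq]

theorem oddComp_total (d : ∀ j, M j →ₗ[ℝ] M (j + 1))
    (Φ : MultilinearMap ℝ (fun _ : Fin l => ⨁ j, M j) Q) :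
    oddComp A Q l (total d) Φ = rightComp A Q d l Φ := oddComp_eq _ _

/-- The anticommutator of the right compositions with two odd operators is the right composition
with their anticommutator; the cross terms cancel because of the signs. -/
theorem oddComp_anticomm {D D' : (⨁ j, M j) →ₗ[ℝ] ⨁ j, M j} (hD : IsOddMap D) (hD' : IsOddMap D')
    (Φ : MultilinearMap ℝ (fun _ : Fin l => ⨁ j, M j) Q) :
    oddComp A Q l D (oddComp A Q l D' Φ) + oddComp A Q l D' (oddComp A Q l D Φ) =
      evenComp A Q l (D' ∘ₗ D + D ∘ₗ D') Φ := by
  have cross {D D' : (⨁ j, M j) →ₗ[ℝ] ⨁ j, M j} (hD : IsOddMap D)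
      (m : Fin l → ⨁ j, M j) {k k' : Fin l} (h : k < k') :
      Φ (fun r => signedMaps D' k' r (signedMaps D k r (m r))) =
        -Φ (fun r => signedMaps D k r (signedMaps D' k' r (m r))) := by
    have : (fun r => signedMaps D' k' r (signedMaps D k r (m r))) =
        Function.update (fun r => signedMaps D k r (signedMaps D' k' r (m r))) k
          ((-1 : ℝ) • D (parity M (m k))) := by
      funext r
      by_cases hr : r = k
      · subst hr
        rw [Function.update_self, signedMaps_self, signedMaps_of_lt _ h, hD.parity_apply,
          neg_one_smul]
      · rw [Function.update_of_ne hr]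
        rcases lt_or_gt_of_ne hr with h1 | h1
        · rw [signedMaps_of_lt _ h1, signedMaps_of_lt _ (h1.trans h)]
        · rw [signedMaps_of_gt _ h1]
          rfl
    rw [this, MultilinearMap.map_update_smul, neg_one_smul]
    congr 2
    refine Function.update_eq_iff.2 ⟨?_, fun _ _ => rfl⟩
    rw [signedMaps_self, signedMaps_of_lt _ h]
  refine MultilinearMap.ext fun m => ?_
  simp only [add_apply, oddComp_apply, evenComp_eq, sum_apply, slotComp_apply]
  rw [Finset.sum_comm (f := fun k k' => Φ fun r => signedMaps D k' r (signedMaps D' k r (m r))),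
    ← Finset.sum_add_distrib]
  refine Finset.sum_congr rfl fun k _ => ?_
  rw [← Finset.sum_add_distrib, Finset.sum_eq_single k]
  · have h (D D' : (⨁ j, M j) →ₗ[ℝ] ⨁ j, M j) :
        (fun r => signedMaps D' k r (signedMaps D k r (m r))) =
          Function.update m k (D' (D (m k))) := by
      funext r
      rcases lt_trichotomy r k with h1 | h1 | h1
      · rw [Function.update_of_ne h1.ne, signedMaps_of_lt _ h1, signedMaps_of_lt _ h1,
          parity_parity]
      · subst h1
        rw [Function.update_self, signedMaps_self, signedMaps_self]
      · rw [Function.update_of_ne h1.ne', signedMaps_of_gt _ h1, signedMaps_of_gt _ h1]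
        rfl
    rw [h, h, ← MultilinearMap.map_update_add]
    rfl
  · intro k' _ hk
    rcases lt_or_gt_of_ne hk with h1 | h1
    · rw [cross hD' m h1, add_neg_cancel]
    · rw [cross hD m h1, neg_add_cancel]
  · simp

theorem rightComp_rightComp {d : ∀ j, M j →ₗ[ℝ] M (j + 1)} (hd : ∀ j x, d (j + 1) (d j x) = 0)
    (Φ : MultilinearMap ℝ (fun _ : Fin l => ⨁ j, M j) Q) :
    rightComp A Q d l (rightComp A Q d l Φ) = 0 := by
  have h0 : total d ∘ₗ total d = 0 := by
    refine LinearMap.ext fun x => ?_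
    induction x using DirectSum.induction_on with
    | zero => simp
    | of j x =>
      change total d (total d (DirectSum.lof ℝ ℕ M j x)) = 0
      rw [total_lof, total_lof, hd, map_zero]
    | add x y hx hy => rw [map_add, hx, hy, map_add]
  have h := oddComp_anticomm (A := A) (isOddMap_total d) (isOddMap_total d) Φ
  rw [h0, oddComp_total, oddComp_total, ← two_smul ℝ] at h
  have h1 : evenComp A Q l ((0 : (⨁ j, M j) →ₗ[ℝ] ⨁ j, M j) + 0) Φ = 0 := by
    ext m
    simp [evenComp_eq, slotComp_apply]
  rw [h1] at h
  exact (smul_eq_zero.1 h).resolve_left two_ne_zero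

theorem oddComp_mem_orderLE {D : (⨁ j, M j) →ₗ[ℝ] ⨁ j, M j}
    (hlin : ∀ (f : A) x, D (f • x) = f • D x) {r : Fin l} {k : ℕ}
    {Φ : MultilinearMap ℝ (fun _ : Fin l => ⨁ j, M j) Q} (hΦ : Φ ∈ orderLE A (⨁ j, M j) Q r k) :
    oddComp A Q l D Φ ∈ orderLE A (⨁ j, M j) Q r k := by
  rw [oddComp_eq]
  refine Submodule.sum_mem _ fun s _ =>
    compLinearMap_mem_orderLE_of_linear _ r (fun f m => ?_) k Φ hΦ
  unfold signedMaps
  split_ifs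
  · exact parity_smul f m
  · exact hlin f m
  · rfl

theorem oddComp_mem_ofDegree {D : (⨁ j, M j) →ₗ[ℝ] ⨁ j, M j} (hD : LowersDegree D) {i : ℤ}
    {Φ : MultilinearMap ℝ (fun _ : Fin l => ⨁ j, M j) Q} (hΦ : Φ ∈ ofDegree A M Q l i) :
    oddComp A Q l D Φ ∈ ofDegree A M Q l (i - 1) := by
  intro a m hm ha
  rw [oddComp_apply]
  refine Finset.sum_eq_zero fun k _ => ?_
  cases hk : a k with
  | zero =>
    refine Φ.map_coord_zero k ?_
    rw [signedMaps_self]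
    exact hD.1 _ (hk ▸ hm k)
  | succ c =>
    refine hΦ (Function.update a k c) _ (fun r => ?_) ?_
    · rcases lt_trichotomy r k with h1 | h1 | h1
      · rw [Function.update_of_ne h1.ne, signedMaps_of_lt _ h1]
        exact parity_mem (hm r)
      · subst h1
        rw [Function.update_self, signedMaps_self]
        exact hD.2 c _ (hk ▸ hm r)
      · rw [Function.update_of_ne h1.ne', signedMaps_of_gt _ h1]
        exact hm r
    · contrapose! ha
      have h1 := Finset.sum_update_of_mem (Finset.mem_univ k) a c
      have h2 := Finset.sum_sdiff (f := a) (Finset.subset_univ {k})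
      rw [Finset.sum_singleton] at h2
      rw [← Nat.cast_sum] at ha ⊢
      omega

/-- The extension of an odd operator to several arguments preserves the graded symmetry. Exchanging
the arguments `i` and `i'` exchanges the `i`-th and `i'`-th terms and keeps the others. -/
theorem oddComp_symm {D : (⨁ j, M j) →ₗ[ℝ] ⨁ j, M j} (hD : IsOddMap D)
    {Φ : MultilinearMap ℝ (fun _ : Fin l => ⨁ j, M j) Q} {i i' : Fin l} (hi : (i' : ℕ) = i + 1)
    (hs : ∀ (a b : ℕ) (m : Fin l → ⨁ j, M j), m i ∈ homog M a → m i' ∈ homog M b →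
      Φ (m ∘ Equiv.swap i i') = (-1 : ℝ) ^ (a * b) • Φ m)
    (a b : ℕ) (m : Fin l → ⨁ j, M j) (ha : m i ∈ homog M a) (hb : m i' ∈ homog M b) :
    oddComp A Q l D Φ (m ∘ Equiv.swap i i') = (-1 : ℝ) ^ (a * b) • oddComp A Q l D Φ m := by
  have hlt : i < i' := Fin.lt_def.2 (by omega)
  have hle {r : Fin l} (h : r ≠ i') (h' : i < r) : i' < r := by
    have h6 : (r : ℕ) ≠ i' := fun h2 => h (Fin.ext h2)
    have h7 := Fin.lt_def.1 h'
    exact Fin.lt_def.2 (by omega)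
  rw [oddComp_apply, oddComp_apply, Finset.smul_sum]
  refine Fintype.sum_equiv (Equiv.swap i i') _ _ fun k => ?_
  have hcomp : (fun r => signedMaps D k r ((m ∘ Equiv.swap i i') r)) =
      (fun r => signedMaps D k (Equiv.swap i i' r) (m r)) ∘ Equiv.swap i i' := by
    funext r; simp
  have hsq (p : ℕ) : (-1 : ℝ) ^ p * (-1) ^ p = 1 := by rw [← mul_pow]; simp
  rw [hcomp]
  by_cases h1 : k = i
  · subst h1
    rw [Equiv.swap_apply_left]
    set N : Fin l → ⨁ j, M j := fun r => signedMaps D k (Equiv.swap k i' r) (m r) with hN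
    have hNi : N k = m k := by
      simp only [hN, Equiv.swap_apply_left, signedMaps_of_gt _ hlt, LinearMap.id_apply]
    have hNi' : N i' = D (m i') := by
      simp only [hN, Equiv.swap_apply_right, signedMaps_self]
    have hR : (fun r => signedMaps D i' r (m r)) =
        Function.update N k ((-1 : ℝ) ^ a • N k) := by
      funext r
      by_cases h2 : r = k
      · subst h2
        rw [Function.update_self, hNi, signedMaps_of_lt _ hlt, parity_eq ha]
      · rw [Function.update_of_ne h2]
        by_cases h3 : r = i'
        · subst h3; rw [hNi', signedMaps_self]
        · simp only [hN, Equiv.swap_apply_of_ne_of_ne h2 h3]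
          rcases lt_or_gt_of_ne h2 with h4 | h4
          · rw [signedMaps_of_lt _ h4, signedMaps_of_lt _ (h4.trans hlt)]
          · rw [signedMaps_of_gt _ h4, signedMaps_of_gt _ (hle h3 h4)]
    obtain ⟨c, hc, hDc⟩ := hD b _ hb
    rw [hR, MultilinearMap.map_update_smul, Function.update_eq_self,
      hs a c N (hNi ▸ ha) (hNi' ▸ hDc), smul_smul, pow_mul', neg_one_pow_eq_of_odd_add hc,
      neg_pow, ← pow_mul', mul_comm]
  · by_cases h2 : k = i'
    · subst h2
      rw [Equiv.swap_apply_right]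
      set N : Fin l → ⨁ j, M j := fun r => signedMaps D k (Equiv.swap i k r) (m r) with hN
      set R : Fin l → ⨁ j, M j := fun r => signedMaps D i r (m r) with hR
      have hNi : N i = D (m i) := by
        simp only [hN, Equiv.swap_apply_left, signedMaps_self]
      have hNi' : N k = (-1 : ℝ) ^ b • m k := by
        simp only [hN, Equiv.swap_apply_right, signedMaps_of_lt _ hlt, parity_eq hb]
      have hRk : R k = m k := by
        simp only [hR, signedMaps_of_gt _ hlt, LinearMap.id_apply]
      have hNR : N = Function.update R k ((-1 : ℝ) ^ b • R k) := by
        funext r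
        by_cases h2 : r = k
        · subst h2
          rw [Function.update_self, hNi', hRk]
        · rw [Function.update_of_ne h2]
          by_cases h3 : r = i
          · subst h3; rw [hNi]; simp only [hR, signedMaps_self]
          · simp only [hN, hR, Equiv.swap_apply_of_ne_of_ne h3 h2]
            rcases lt_or_gt_of_ne h3 with h4 | h4
            · rw [signedMaps_of_lt _ h4, signedMaps_of_lt _ (h4.trans hlt)]
            · rw [signedMaps_of_gt _ h4, signedMaps_of_gt _ (hle h2 h4)]
      have hΦN : Φ N = (-1 : ℝ) ^ b • Φ R := by
        rw [hNR, MultilinearMap.map_update_smul, Function.update_eq_self]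
      obtain ⟨c, hc, hDc⟩ := hD a _ ha
      rw [hs c b N (hNi ▸ hDc) (hNi' ▸ Submodule.smul_mem _ _ hb), hΦN, smul_smul, pow_mul,
        neg_one_pow_eq_of_odd_add hc, neg_pow, ← pow_mul, mul_right_comm, hsq, one_mul]
    · rw [Equiv.swap_apply_of_ne_of_ne h1 h2]
      have h3 : signedMaps D k i = signedMaps D k i' := by
        rcases lt_or_gt_of_ne h1 with h4 | h4
        · rw [signedMaps_of_gt _ h4, signedMaps_of_gt _ (h4.trans hlt)]
        · rw [signedMaps_of_lt _ h4, signedMaps_of_lt _ (hle h2 h4)]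
      have hN : (fun r => signedMaps D k (Equiv.swap i i' r) (m r)) =
          fun r => signedMaps D k r (m r) := by
        funext r
        by_cases h4 : r = i
        · subst h4; rw [Equiv.swap_apply_left, h3]
        · by_cases h5 : r = i'
          · subst h5; rw [Equiv.swap_apply_right, h3]
          · rw [Equiv.swap_apply_of_ne_of_ne h4 h5]
      have hmem (r : Fin l) (hr : r ≠ k) (c : ℕ) (h : m r ∈ homog M c) :
          signedMaps D k r (m r) ∈ homog M c := by
        rcases lt_or_gt_of_ne hr with h4 | h4
        · rw [signedMaps_of_lt _ h4]; exact parity_mem h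
        · rw [signedMaps_of_gt _ h4]; exact h
      rw [hN]
      exact hs a b (fun r => signedMaps D k r (m r)) (hmem i (Ne.symm h1) a ha)
        (hmem i' (Ne.symm h2) b hb)

/-- Multilinear maps on a graded module are determined by their values on homogeneous
arguments. -/
theorem ext_homog {Φ Ψ : MultilinearMap ℝ (fun _ : Fin l => ⨁ j, M j) Q}
    (h : ∀ (a : Fin l → ℕ) (m : Fin l → ⨁ j, M j), (∀ r, m r ∈ homog M (a r)) → Φ m = Ψ m) :
    Φ = Ψ := by
  ext a x
  exact h a _ fun r => ⟨x r, rfl⟩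

variable (M) in
/-- The degree operator, multiplication by `j` in degree `j`. -/
def degreeMap : (⨁ j, M j) →ₗ[ℝ] ⨁ j, M j :=
  DirectSum.toModule ℝ ℕ _ fun j => (j : ℝ) • DirectSum.lof ℝ ℕ M j

theorem degreeMap_lof (a : ℕ) (x : M a) :
    degreeMap M (DirectSum.lof ℝ ℕ M a x) = (a : ℝ) • DirectSum.lof ℝ ℕ M a x := by
  simp [degreeMap]

theorem evenComp_degreeMap {p : ℕ} {Φ : MultilinearMap ℝ (fun _ : Fin l => ⨁ j, M j) Q}
    (hΦ : Φ ∈ ofDegree A M Q l (-(p : ℤ))) :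
    evenComp A Q l (degreeMap M) Φ = (p : ℝ) • Φ := by
  refine ext_homog fun a m hm => ?_
  have h1 (r : Fin l) : slotComp A Q r (degreeMap M) Φ m = (a r : ℝ) • Φ m := by
    obtain ⟨x, hx⟩ := hm r
    rw [slotComp_apply, ← hx, degreeMap_lof, MultilinearMap.map_update_smul, hx,
      Function.update_eq_self]
  rw [evenComp_eq, sum_apply, Finset.sum_congr rfl fun r _ => h1 r, ← Finset.sum_smul, smul_apply]
  by_cases h : ∑ r, a r = p
  · rw [← h, Nat.cast_sum]
  · rw [hΦ a m hm (by rw [← Nat.cast_sum]; omega), smul_zero, smul_zero]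

theorem degreeMap_smul (f : A) (x : ⨁ j, M j) : degreeMap M (f • x) = f • degreeMap M x := by
  induction x using DirectSum.induction_on with
  | zero => simp
  | of j x =>
    change degreeMap M (f • DirectSum.lof ℝ ℕ M j x) = f • degreeMap M (DirectSum.lof ℝ ℕ M j x)
    rw [smul_lof, degreeMap_lof, degreeMap_lof, smul_comm f, ← smul_lof]
  | add x y hx hy => simp [smul_add, hx, hy]

end Graded

/-! ### Homotopies from contractions -/

instance {A : Type*} [CommRing A] [Algebra ℝ A] {M : Type*} [AddCommGroup M] [Module ℝ M]
    {Q : Type*} [AddCommGroup Q] [Module ℝ Q] [Module A Q] [IsScalarTower ℝ A Q] {l : ℕ} :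
    IsScalarTower ℝ A (MultilinearMap ℝ (fun _ : Fin l => M) Q) :=
  ⟨fun c f Φ => MultilinearMap.ext fun m => smul_assoc c f (Φ m)⟩

section LocalHomotopy

variable {A : Type*} [CommRing A] [Algebra ℝ A]
  {M : ℕ → Type*} [∀ j, AddCommGroup (M j)] [∀ j, Module ℝ (M j)] [∀ j, Module A (M j)]
  [∀ j, IsScalarTower ℝ A (M j)]
  {Q : Type*} [AddCommGroup Q] [Module ℝ Q] [Module A Q] [IsScalarTower ℝ A Q]
  {l : ℕ} {ι : Type*} [Fintype ι]

variable (Q l) in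
/-- The homotopy built from functions `x a` and `A`-linear contractions `c a`. For `l = 1` it sends
`Φ` to `∑ a, [Φ, x a] ∘ c a`, and in general it applies this to each argument. -/
def localHomotopy (x : ι → A) (c : ι → (⨁ j, M j) →ₗ[ℝ] ⨁ j, M j) :
    MultilinearMap ℝ (fun _ : Fin l => ⨁ j, M j) Q →ₗ[A]
      MultilinearMap ℝ (fun _ : Fin l => ⨁ j, M j) Q :=
  ∑ a, (oddComp A Q l (Algebra.lsmul ℝ ℝ _ (x a) ∘ₗ c a) - x a • oddComp A Q l (c a))

theorem localHomotopy_apply (x : ι → A) (c : ι → (⨁ j, M j) →ₗ[ℝ] ⨁ j, M j)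
    (Φ : MultilinearMap ℝ (fun _ : Fin l => ⨁ j, M j) Q) :
    localHomotopy Q l x c Φ =
      ∑ a, (oddComp A Q l (Algebra.lsmul ℝ ℝ _ (x a) ∘ₗ c a) Φ - x a • oddComp A Q l (c a) Φ) := by
  simp [localHomotopy]

section Preserves

variable (x : ι → A) {c : ι → (⨁ j, M j) →ₗ[ℝ] ⨁ j, M j}
  {Φ : MultilinearMap ℝ (fun _ : Fin l => ⨁ j, M j) Q}

theorem localHomotopy_mem_orderLE (hlin : ∀ a (f : A) m, c a (f • m) = f • c a m) {r : Fin l}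
    {k : ℕ} (hΦ : Φ ∈ orderLE A (⨁ j, M j) Q r k) :
    localHomotopy Q l x c Φ ∈ orderLE A (⨁ j, M j) Q r k := by
  rw [localHomotopy_apply]
  refine Submodule.sum_mem _ fun a _ => sub_mem (oddComp_mem_orderLE (fun f m => ?_) hΦ)
    (Submodule.smul_mem _ _ (oddComp_mem_orderLE (hlin a) hΦ))
  simp [hlin, smul_smul, mul_comm]

theorem localHomotopy_mem_ofDegree (hc : ∀ a, LowersDegree (c a)) {i : ℤ}
    (hΦ : Φ ∈ ofDegree A M Q l i) : localHomotopy Q l x c Φ ∈ ofDegree A M Q l (i - 1) := by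
  rw [localHomotopy_apply]
  exact Submodule.sum_mem _ fun a _ => sub_mem (oddComp_mem_ofDegree ((hc a).smul (x a)) hΦ)
    (Submodule.smul_mem _ _ (oddComp_mem_ofDegree (hc a) hΦ))

theorem localHomotopy_symm (hc : ∀ a, LowersDegree (c a)) {i i' : Fin l} (hi : (i' : ℕ) = i + 1)
    (hs : ∀ (a b : ℕ) (m : Fin l → ⨁ j, M j), m i ∈ homog M a → m i' ∈ homog M b →
      Φ (m ∘ Equiv.swap i i') = (-1 : ℝ) ^ (a * b) • Φ m)
    (a b : ℕ) (m : Fin l → ⨁ j, M j) (ha : m i ∈ homog M a) (hb : m i' ∈ homog M b) :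
    localHomotopy Q l x c Φ (m ∘ Equiv.swap i i') =
      (-1 : ℝ) ^ (a * b) • localHomotopy Q l x c Φ m := by
  simp only [localHomotopy_apply, sum_apply, Finset.smul_sum, sub_apply, smul_apply]
  refine Finset.sum_congr rfl fun e _ => ?_
  rw [oddComp_symm ((hc e).smul (x e)).isOddMap hi hs a b m ha hb,
    oddComp_symm (hc e).isOddMap hi hs a b m ha hb, smul_sub, smul_comm (x e)]

/-- The homotopy annihilates the operators of order zero. -/
theorem localHomotopy_eq_zero (hΦ : Φ ∈ totalOrderLT A (⨁ j, M j) Q l 1) :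
    localHomotopy Q l x c Φ = 0 := by
  rw [localHomotopy_apply]
  refine Finset.sum_eq_zero fun a _ => sub_eq_zero.2 (MultilinearMap.ext fun m => ?_)
  rw [smul_apply, oddComp_apply, oddComp_apply, Finset.smul_sum]
  refine Finset.sum_congr rfl fun k _ => ?_
  rw [← Function.update_eq_self k (fun r => signedMaps (c a) k r (m r)),
    ← map_smul_of_mem_totalOrderLT_one hΦ]
  congr 1
  funext r
  by_cases hr : r = k
  · subst hr
    simp [signedMaps_self]
  · simp [signedMaps, hr]

end Preserves

/-- The hypotheses under which `localHomotopy x c` is, after multiplication with the function `ρ`,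
a homotopy up to lower order: the contractions `c a` are `A`-linear of degree `-1`, their
anticommutators with `d` are derivations over derivations `u a` of `A`, and on the support of `ρ`
the `x a` and `c a` are dual to each other, in their action on operators of total order at most
one and on graded elements. -/
structure IsLocalContraction (Q : Type*) [AddCommGroup Q] [Module ℝ Q] [Module A Q]
    [IsScalarTower ℝ A Q] (l : ℕ) (d : ∀ j, M j →ₗ[ℝ] M (j + 1)) (ρ : A) (x : ι → A)
    (c : ι → (⨁ j, M j) →ₗ[ℝ] ⨁ j, M j) (u : ι → A → A) : Prop where
  lowers : ∀ a, LowersDegree (c a)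
  map_smul : ∀ a (f : A) m, c a (f • m) = f • c a m
  mulComm_lie : ∀ a f, mulComm (total d ∘ₗ c a + c a ∘ₗ total d) f = Algebra.lsmul ℝ ℝ _ (u a f)
  smul_sum_slotComm : ∀ Ψ ∈ totalOrderLT A (⨁ j, M j) Q l 2, ∀ (r : Fin l) (f : A),
    ρ • (∑ a, u a f • slotComm r (x a) Ψ - slotComm r f Ψ) = 0
  smul_slotComp : ∀ k, ∀ Φ ∈ totalOrderLT A (⨁ j, M j) Q l k, ∀ r,
    ρ • slotComp A Q r (∑ a, mulComm (total d) (x a) ∘ₗ c a - degreeMap M) Φ = 0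

namespace IsLocalContraction

variable {d : ∀ j, M j →ₗ[ℝ] M (j + 1)} {ρ : A} {x : ι → A}
  {c : ι → (⨁ j, M j) →ₗ[ℝ] ⨁ j, M j} {u : ι → A → A}

/-- The anticommutator of the differential with `localHomotopy x c`. -/
theorem anticomm (h : IsLocalContraction Q l d ρ x c u)
    (Φ : MultilinearMap ℝ (fun _ : Fin l => ⨁ j, M j) Q) :
    rightComp A Q d l (localHomotopy Q l x c Φ) + localHomotopy Q l x c (rightComp A Q d l Φ) =
      ∑ a, (evenComp A Q l (Algebra.lsmul ℝ ℝ _ (x a) ∘ₗ (total d ∘ₗ c a + c a ∘ₗ total d) +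
          mulComm (total d) (x a) ∘ₗ c a) Φ -
        x a • evenComp A Q l (total d ∘ₗ c a + c a ∘ₗ total d) Φ) := by
  have h1 (a : ι) : Algebra.lsmul ℝ ℝ _ (x a) ∘ₗ (total d ∘ₗ c a + c a ∘ₗ total d) +
      mulComm (total d) (x a) ∘ₗ c a = (Algebra.lsmul ℝ ℝ _ (x a) ∘ₗ c a) ∘ₗ total d +
        total d ∘ₗ (Algebra.lsmul ℝ ℝ _ (x a) ∘ₗ c a) := by
    refine LinearMap.ext fun m => ?_
    simp [mulComm_apply, add_comm]
  rw [localHomotopy_apply, localHomotopy_apply, map_sum, ← Finset.sum_add_distrib]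
  refine Finset.sum_congr rfl fun a _ => ?_
  rw [h1, ← oddComp_anticomm (isOddMap_total d) ((h.lowers a).smul (x a)).isOddMap,
    add_comm (total d ∘ₗ c a), ← oddComp_anticomm (isOddMap_total d) (h.lowers a).isOddMap]
  simp only [oddComp_total, map_sub, LinearMap.map_smul, smul_add]
  abel

theorem mulComm_eq_zero {T : (⨁ j, M j) →ₗ[ℝ] ⨁ j, M j}
    (hT : ∀ (f : A) m, T (f • m) = f • T m) (f : A) : mulComm T f = 0 :=
  LinearMap.ext fun m => by simp [mulComm_apply, hT]

/-- The anticommutator of the differential with the homotopy commutes with the commutators with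
functions up to the terms produced by the Lie derivatives along the `u a`. -/
theorem slotComm_anticomm (h : IsLocalContraction Q l d ρ x c u) (hd : FirstOrder A d)
    (Φ : MultilinearMap ℝ (fun _ : Fin l => ⨁ j, M j) Q) (r : Fin l) (f : A) :
    slotComm r f (rightComp A Q d l (localHomotopy Q l x c Φ) +
        localHomotopy Q l x c (rightComp A Q d l Φ)) =
      rightComp A Q d l (localHomotopy Q l x c (slotComm r f Φ)) +
        localHomotopy Q l x c (rightComp A Q d l (slotComm r f Φ)) +
      ∑ a, (slotComm r (x a) (slotComm r (u a f) Φ) + u a f • slotComm r (x a) Φ) := by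
  rw [h.anticomm, h.anticomm, map_sum, ← Finset.sum_add_distrib]
  refine Finset.sum_congr rfl fun a _ => ?_
  have h1 : mulComm (Algebra.lsmul ℝ ℝ _ (x a) ∘ₗ (total d ∘ₗ c a + c a ∘ₗ total d) +
      mulComm (total d) (x a) ∘ₗ c a) f =
      Algebra.lsmul ℝ ℝ _ (u a f) ∘ₗ Algebra.lsmul ℝ ℝ _ (x a) := by
    refine LinearMap.ext fun m => ?_
    have h2 := LinearMap.congr_fun (h.mulComm_lie a f) m
    have h3 : mulComm (total d) (x a) (c a (f • m)) = f • mulComm (total d) (x a) (c a m) := by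
      rw [h.map_smul, mulComm_apply, mulComm_apply, total_comm hd]
    rw [mulComm_apply] at h2 ⊢
    simp only [LinearMap.add_apply, LinearMap.comp_apply, Algebra.lsmul_coe] at h2 ⊢
    rw [h3, smul_smul, mul_comm (u a f), ← smul_smul, ← h2]
    simp only [smul_add, smul_sub, smul_smul, mul_comm (x a) f]
    abel
  rw [map_sub, slotComm_evenComp, LinearMap.map_smul, slotComm_evenComp, h1, h.mulComm_lie,
    ← slotComp_slotComp_self]
  simp only [slotComm_eq, map_sub, LinearMap.map_smul, smul_add, smul_sub]
  rw [smul_comm (u a f) (x a)]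
  abel

/-- Up to lower total order, the anticommutator of the differential with the homotopy is the
multiplication with the total order plus the form degree. -/
theorem smul_anticomm_sub_mem (h : IsLocalContraction Q l d ρ x c u) (hd : FirstOrder A d)
    (p : ℝ) (k : ℕ) :
    ∀ Φ ∈ totalOrderLT A (⨁ j, M j) Q l (k + 1), evenComp A Q l (degreeMap M) Φ = p • Φ →
      ρ • (rightComp A Q d l (localHomotopy Q l x c Φ) +
        localHomotopy Q l x c (rightComp A Q d l Φ) - ((k : ℝ) + p) • Φ) ∈
      totalOrderLT A (⨁ j, M j) Q l k := by
  induction k with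
  | zero =>
    intro Φ hΦ hp
    rw [mem_totalOrderLT_zero, h.anticomm]
    have hlin (S : (⨁ j, M j) →ₗ[ℝ] ⨁ j, M j) (f : A) (r : Fin l) :
        slotComp A Q r (Algebra.lsmul ℝ ℝ _ f ∘ₗ S) Φ = f • slotComp A Q r S Φ := by
      refine MultilinearMap.ext fun m => ?_
      rw [smul_apply, slotComp_apply, slotComp_apply]
      exact map_smul_of_mem_totalOrderLT_one hΦ f r m _
    have h1 (a : ι) : evenComp A Q l (Algebra.lsmul ℝ ℝ _ (x a) ∘ₗ
          (total d ∘ₗ c a + c a ∘ₗ total d) + mulComm (total d) (x a) ∘ₗ c a) Φ -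
        x a • evenComp A Q l (total d ∘ₗ c a + c a ∘ₗ total d) Φ =
        ∑ r, slotComp A Q r (mulComm (total d) (x a) ∘ₗ c a) Φ := by
      simp only [evenComp_eq, slotComp_add _ (Algebra.lsmul ℝ ℝ _ (x a) ∘ₗ _), hlin,
        Finset.sum_add_distrib, ← Finset.smul_sum]
      abel
    rw [Finset.sum_congr rfl fun a _ => h1 a, Finset.sum_comm, Nat.cast_zero, zero_add, ← hp,
      evenComp_eq, ← Finset.sum_sub_distrib, Finset.smul_sum]
    refine Finset.sum_eq_zero fun r _ => ?_
    rw [← slotComp_sum, ← slotComp_sub]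
    exact h.smul_slotComp 1 Φ hΦ r
  | succ k ih =>
    intro Φ hΦ hp
    rw [mem_totalOrderLT_succ]
    intro r f
    have hΦf := mem_totalOrderLT_succ.1 hΦ r f
    have hpf : evenComp A Q l (degreeMap M) (slotComm r f Φ) = p • slotComm r f Φ := by
      have h1 := slotComm_evenComp r f (degreeMap M) Φ
      have h2 : slotComp A Q r (0 : (⨁ j, M j) →ₗ[ℝ] ⨁ j, M j) Φ = 0 := by
        refine MultilinearMap.ext fun m => ?_
        simp [slotComp_apply]
      rw [mulComm_eq_zero degreeMap_smul, h2, add_zero, hp] at h1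
      rw [← h1]
      exact (slotComm r f).map_smul_of_tower p Φ
    have h1 := ih _ hΦf hpf
    -- the commutators of the error term with `k` functions vanish
    have h2 (k : ℕ) : ∀ Ψ ∈ totalOrderLT A (⨁ j, M j) Q l (k + 2),
        ρ • (∑ a, u a f • slotComm r (x a) Ψ - slotComm r f Ψ) ∈
          totalOrderLT A (⨁ j, M j) Q l k := by
      induction k with
      | zero =>
        intro Ψ hΨ
        rw [mem_totalOrderLT_zero]
        exact h.smul_sum_slotComm Ψ hΨ r f
      | succ k ih =>
        intro Ψ hΨ
        rw [mem_totalOrderLT_succ]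
        intro s g
        have h3 := ih _ (mem_totalOrderLT_succ.1 hΨ s g)
        simpa only [LinearMap.map_smul, map_sub, map_sum, slotComm_comm s r] using h3
    have h3 := h2 k Φ hΦ
    have h4 (a : ι) : slotComm r (x a) (slotComm r (u a f) Φ) ∈
        totalOrderLT A (⨁ j, M j) Q l k :=
      mem_totalOrderLT_succ.1 (mem_totalOrderLT_succ.1 hΦ r (u a f)) r (x a)
    have h5 := add_mem (add_mem h1 h3)
      (Submodule.smul_mem _ ρ (Submodule.sum_mem _ fun a (_ : a ∈ Finset.univ) => h4 a))
    convert h5 using 1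
    have h6 : slotComm r f (((k + 1 : ℕ) + p : ℝ) • Φ) = ((k + 1 : ℕ) + p : ℝ) • slotComm r f Φ :=
      (slotComm r f).map_smul_of_tower _ Φ
    rw [LinearMap.map_smul, map_sub, h.slotComm_anticomm hd, h6, ← smul_add, ← smul_add,
      Finset.sum_add_distrib]
    congr 1
    push_cast
    module

end IsLocalContraction

end LocalHomotopy

section Homotopy

variable {A : Type*} [CommRing A] [Algebra ℝ A]
  {M : ℕ → Type*} [∀ j, AddCommGroup (M j)] [∀ j, Module ℝ (M j)] [∀ j, Module A (M j)]
  [∀ j, IsScalarTower ℝ A (M j)]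
  {Q : Type*} [AddCommGroup Q] [Module ℝ Q] [Module A Q] [IsScalarTower ℝ A Q]
  {l : ℕ}

/-- A homotopy on the complex of `l`-linear symmetric differential operators whose anticommutator
with the differential is, up to lower total order, the multiplication with the total order plus
the form degree. -/
structure IsOrderHomotopy (d : ∀ j, M j →ₗ[ℝ] M (j + 1))
    (h : MultilinearMap ℝ (fun _ : Fin l => ⨁ j, M j) Q →ₗ[ℝ]
      MultilinearMap ℝ (fun _ : Fin l => ⨁ j, M j) Q) : Prop where
  mem_symDiffOp : ∀ Φ ∈ symDiffOp A M Q l, h Φ ∈ symDiffOp A M Q l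
  mem_ofDegree : ∀ i, ∀ Φ ∈ ofDegree A M Q l i, h Φ ∈ ofDegree A M Q l (i - 1)
  eq_zero : ∀ Φ ∈ totalOrderLT A (⨁ j, M j) Q l 1, h Φ = 0
  anticomm_sub_mem : ∀ k (p : ℕ), ∀ Φ ∈ totalOrderLT A (⨁ j, M j) Q l (k + 1),
    Φ ∈ ofDegree A M Q l (-(p : ℤ)) →
    rightComp A Q d l (h Φ) + h (rightComp A Q d l Φ) - ((k : ℝ) + p) • Φ ∈
      totalOrderLT A (⨁ j, M j) Q l k

theorem real_smul_mem {E : Type*} [AddCommGroup E] [Module ℝ E] [Module A E] [IsScalarTower ℝ A E]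
    (S : Submodule A E) (c : ℝ) {e : E} (he : e ∈ S) : c • e ∈ S := by
  rw [← algebraMap_smul A c e]
  exact S.smul_mem _ he

theorem rightComp_real_smul (d : ∀ j, M j →ₗ[ℝ] M (j + 1)) (c : ℝ)
    (Φ : MultilinearMap ℝ (fun _ : Fin l => ⨁ j, M j) Q) :
    rightComp A Q d l (c • Φ) = c • rightComp A Q d l Φ := by
  exact (rightComp A Q d l).map_smul_of_tower c Φ

variable (A M Q l) in
/-- The symmetric differential operators of degree `i`. -/
def symDiffOpOfDegree (i : ℤ) : Submodule A (MultilinearMap ℝ (fun _ : Fin l => ⨁ j, M j) Q) :=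
  symDiffOp A M Q l ⊓ ofDegree A M Q l i

namespace IsOrderHomotopy

variable {d : ∀ j, M j →ₗ[ℝ] M (j + 1)}
  {h : MultilinearMap ℝ (fun _ : Fin l => ⨁ j, M j) Q →ₗ[ℝ]
      MultilinearMap ℝ (fun _ : Fin l => ⨁ j, M j) Q}

theorem homotopy_mem (hh : IsOrderHomotopy (A := A) d h) {i : ℤ}
    {Φ : MultilinearMap ℝ (fun _ : Fin l => ⨁ j, M j) Q} (hΦ : Φ ∈ symDiffOpOfDegree A M Q l i) :
    h Φ ∈ symDiffOpOfDegree A M Q l (i - 1) :=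
  ⟨hh.mem_symDiffOp Φ hΦ.1, hh.mem_ofDegree i Φ hΦ.2⟩

theorem rightComp_mem (hd : FirstOrder A d) {i : ℤ}
    {Φ : MultilinearMap ℝ (fun _ : Fin l => ⨁ j, M j) Q} (hΦ : Φ ∈ symDiffOpOfDegree A M Q l i) :
    rightComp A Q d l Φ ∈ symDiffOpOfDegree A M Q l (i + 1) :=
  ⟨rightComp_mem_symDiffOp hd hΦ.1, rightComp_mem_ofDegree d hΦ.2⟩

/-- A cocycle of degree `-p` is a coboundary as soon as the total order plus `p` cannot vanish. -/
theorem exists_rightComp_eq (hh : IsOrderHomotopy (A := A) d h) (hd : FirstOrder A d)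
    (hd2 : ∀ j x, d (j + 1) (d j x) = 0) {p : ℕ} (hp : 0 < p) (k : ℕ) :
    ∀ Φ ∈ symDiffOpOfDegree A M Q l (-(p : ℤ)), rightComp A Q d l Φ = 0 →
      Φ ∈ totalOrderLT A (⨁ j, M j) Q l k →
      ∃ Ψ ∈ symDiffOpOfDegree A M Q l (-(p : ℤ) - 1), rightComp A Q d l Ψ = Φ := by
  induction k with
  | zero =>
    intro Φ _ _ h0
    exact ⟨0, zero_mem _, by rw [map_zero, mem_totalOrderLT_zero.1 h0]⟩
  | succ k ih =>
    intro Φ hΦ hδ hk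
    have h1 := hh.anticomm_sub_mem k p Φ hk hΦ.2
    rw [hδ, map_zero, add_zero] at h1
    have h2 : rightComp A Q d l (h Φ) ∈ symDiffOpOfDegree A M Q l (-(p : ℤ)) := by
      simpa using rightComp_mem hd (hh.homotopy_mem hΦ)
    obtain ⟨Ψ, hΨ, hΨ'⟩ := ih _ (sub_mem h2 (real_smul_mem _ ((k : ℝ) + p) hΦ))
      (by rw [map_sub, rightComp_rightComp hd2, rightComp_real_smul, hδ, smul_zero, sub_zero]) h1
    have hne : ((k : ℝ) + p) ≠ 0 := by positivity
    refine ⟨((k : ℝ) + p)⁻¹ • (h Φ - Ψ), real_smul_mem _ _ (sub_mem (hh.homotopy_mem hΦ) hΨ), ?_⟩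
    rw [rightComp_real_smul, map_sub, hΨ', sub_sub_cancel, inv_smul_smul₀ hne]

/-- In degree zero every operator is cohomologous to one of order zero. -/
theorem exists_sub_rightComp_mem (hh : IsOrderHomotopy (A := A) d h) (hd : FirstOrder A d)
    (k : ℕ) : ∀ Φ ∈ symDiffOpOfDegree A M Q l 0, rightComp A Q d l Φ = 0 →
      (∀ Ψ ∈ symDiffOpOfDegree A M Q l 0, rightComp A Q d l Ψ = 0) →
      Φ ∈ totalOrderLT A (⨁ j, M j) Q l (k + 1) →
      ∃ Ψ ∈ symDiffOpOfDegree A M Q l (-1),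
        Φ - rightComp A Q d l Ψ ∈ totalOrderLT A (⨁ j, M j) Q l 1 := by
  induction k with
  | zero =>
    intro Φ _ _ _ h0
    exact ⟨0, zero_mem _, by simpa using h0⟩
  | succ k ih =>
    intro Φ hΦ hδ hall hk
    have h1 := hh.anticomm_sub_mem (k + 1) 0 Φ hk (by simpa using hΦ.2)
    rw [hδ, map_zero, add_zero, Nat.cast_zero, add_zero] at h1
    have h0 : h Φ ∈ symDiffOpOfDegree A M Q l (-1) := by simpa using hh.homotopy_mem hΦ
    have h2 : rightComp A Q d l (h Φ) ∈ symDiffOpOfDegree A M Q l 0 := by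
      simpa using rightComp_mem hd h0
    have h3 := sub_mem h2 (real_smul_mem _ ((k + 1 : ℕ) : ℝ) hΦ)
    obtain ⟨Ψ, hΨ, hΨ'⟩ := ih _ h3 (hall _ h3) hall h1
    have hne : ((k + 1 : ℕ) : ℝ) ≠ 0 := by positivity
    refine ⟨((k + 1 : ℕ) : ℝ)⁻¹ • (h Φ - Ψ), real_smul_mem _ _ (sub_mem h0 hΨ), ?_⟩
    have h4 := real_smul_mem _ (-((k + 1 : ℕ) : ℝ)⁻¹) hΨ'
    convert h4 using 1
    rw [rightComp_real_smul, map_sub]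
    simp only [smul_sub, neg_smul, inv_smul_smul₀ hne]
    abel

/-- An operator of order zero which is the coboundary of an operator of degree `-1` vanishes. -/
theorem rightComp_eq_zero (hh : IsOrderHomotopy (A := A) d h)
    (hd2 : ∀ j x, d (j + 1) (d j x) = 0) (k : ℕ) :
    ∀ Ψ ∈ ofDegree A M Q l (-1), h (rightComp A Q d l Ψ) = 0 →
      Ψ ∈ totalOrderLT A (⨁ j, M j) Q l k → rightComp A Q d l Ψ = 0 := by
  induction k with
  | zero =>
    intro Ψ _ _ h0
    rw [mem_totalOrderLT_zero.1 h0, map_zero]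
  | succ k ih =>
    intro Ψ hΨ h0 hk
    have h1 := hh.anticomm_sub_mem k 1 Ψ hk (by simpa using hΨ)
    rw [h0, add_zero] at h1
    have h2 : rightComp A Q d l (h Ψ) ∈ ofDegree A M Q l (-1) := by
      simpa using rightComp_mem_ofDegree d (hh.mem_ofDegree _ Ψ hΨ)
    have hne : ((k : ℝ) + (1 : ℕ)) ≠ 0 := by positivity
    have h3 : rightComp A Q d l (rightComp A Q d l (h Ψ) - ((k : ℝ) + (1 : ℕ)) • Ψ) =
        -(((k : ℝ) + (1 : ℕ)) • rightComp A Q d l Ψ) := by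
      rw [map_sub, rightComp_rightComp hd2, rightComp_real_smul, zero_sub]
    have h4 := ih _ (sub_mem h2 (real_smul_mem _ ((k : ℝ) + (1 : ℕ)) hΨ))
      (by rw [h3, map_neg, map_smul, h0, smul_zero, neg_zero]) h1
    rw [h3, neg_eq_zero] at h4
    exact (smul_eq_zero.1 h4).resolve_left hne

end IsOrderHomotopy

end Homotopy

/-! ### Cartan calculus and the flat twisted de Rham operator -/

section Alternatize

variable {R N N' : Type*} [CommRing R] [AddCommGroup N] [Module R N]
  [AddCommGroup N'] [Module R N'] {j : ℕ}

/-- Insertion of `u` as the first argument of an alternating map. -/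
def insertFirst (u : N) :
    AlternatingMap R N N' (Fin (j + 1)) →ₗ[R] AlternatingMap R N N' (Fin j) :=
  AlternatingMap.curryLeftLinearMap.flip u

theorem insertFirst_apply (u : N) (K : AlternatingMap R N N' (Fin (j + 1))) (v : Fin j → N) :
    insertFirst u K v = K (Fin.cons u v) := rfl

theorem ext_insertFirst {K L : AlternatingMap R N N' (Fin (j + 1))}
    (h : ∀ u : N, insertFirst u K = insertFirst u L) : K = L := by
  ext v
  have := AlternatingMap.congr_fun (h (v 0)) (Fin.tail v)
  rwa [insertFirst_apply, insertFirst_apply, Fin.cons_self_tail] at this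

theorem insertFirst_add_left (u w : N) (K : AlternatingMap R N N' (Fin (j + 1))) :
    insertFirst (u + w) K = insertFirst u K + insertFirst w K :=
  K.curryLeft.map_add u w

theorem insertFirst_neg_left (u : N) (K : AlternatingMap R N N' (Fin (j + 1))) :
    insertFirst (-u) K = -insertFirst u K :=
  K.curryLeft.map_neg u

theorem insertFirst_insertFirst (u w : N) (K : AlternatingMap R N N' (Fin (j + 2))) :
    insertFirst u (insertFirst w K) = -insertFirst w (insertFirst u K) := by
  have h (u : N) : insertFirst u (insertFirst u K) = 0 := K.curryLeft_same u
  have h1 := h (u + w)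
  simp only [insertFirst_add_left, map_add, h, zero_add, add_zero] at h1
  exact eq_neg_of_add_eq_zero_right h1

theorem insertFirst_alternatize (u : N) (g : N →ₗ[R] AlternatingMap R N N' (Fin (j + 1))) :
    insertFirst u (AlternatingMap.alternatizeUncurryFin g) =
      g u - AlternatingMap.alternatizeUncurryFin (insertFirst u ∘ₗ g) := by
  ext W
  have hs (i : Fin (j + 1)) :
      i.succ.removeNth (Fin.cons u W : Fin (j + 2) → N) = Fin.cons u (i.removeNth W) := by
    funext k
    refine Fin.cases ?_ (fun k => ?_) k <;> simp [Fin.removeNth_apply]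
  rw [insertFirst_apply, AlternatingMap.alternatizeUncurryFin_apply, Fin.sum_univ_succ,
    AlternatingMap.sub_apply, AlternatingMap.alternatizeUncurryFin_apply, sub_eq_add_neg,
    ← Finset.sum_neg_distrib]
  congr 1
  · simp
  · refine Finset.sum_congr rfl fun i _ => ?_
    rw [hs, Fin.cons_succ, Fin.val_succ, pow_succ, mul_neg, mul_one, neg_smul]
    rfl

theorem insertFirst_alternatize_zero (u : N) (g : N →ₗ[R] AlternatingMap R N N' (Fin 0)) :
    insertFirst u (AlternatingMap.alternatizeUncurryFin g) = g u := by
  ext W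
  rw [insertFirst_apply, AlternatingMap.alternatizeUncurryFin_apply]
  simp

theorem alternatize_neg (g : N →ₗ[R] AlternatingMap R N N' (Fin j)) :
    AlternatingMap.alternatizeUncurryFin (-g) = -AlternatingMap.alternatizeUncurryFin g := by
  rw [← neg_one_smul R g, AlternatingMap.alternatizeUncurryFin_smul, neg_one_smul]

theorem alternatize_sub (g h : N →ₗ[R] AlternatingMap R N N' (Fin j)) :
    AlternatingMap.alternatizeUncurryFin (g - h) =
      AlternatingMap.alternatizeUncurryFin g - AlternatingMap.alternatizeUncurryFin h := by
  rw [sub_eq_add_neg, AlternatingMap.alternatizeUncurryFin_add, alternatize_neg, sub_eq_add_neg]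

/-- Contraction is an antiderivation: `ι_u (φ ∧ K) + φ ∧ ι_u K = φ u • K`. -/
theorem insertFirst_wedge_add (u : N) (φ : N →ₗ[R] R)
    (K : AlternatingMap R N N' (Fin (j + 1))) :
    AlternatingMap.alternatizeUncurryFin (φ.smulRight (insertFirst u K)) +
      insertFirst u (AlternatingMap.alternatizeUncurryFin (φ.smulRight K)) = φ u • K := by
  have h : insertFirst u ∘ₗ φ.smulRight K = φ.smulRight (insertFirst u K) :=
    LinearMap.ext fun v => (insertFirst u).map_smul _ _
  rw [insertFirst_alternatize, h, add_sub_cancel]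
  rfl

theorem sum_wedge_insertFirst {ι : Type*} [Fintype ι] (φ : ι → N →ₗ[R] R) (U : ι → N)
    (h : ∀ v, ∑ a, φ a v • U a = v) (K : AlternatingMap R N N' (Fin (j + 1))) :
    ∑ a, AlternatingMap.alternatizeUncurryFin ((φ a).smulRight (insertFirst (U a) K)) =
      (j + 1) • K := by
  have h1 : ∑ a, (φ a).smulRight (insertFirst (U a) K) = K.curryLeft := by
    refine LinearMap.ext fun v => ?_
    rw [LinearMap.sum_apply]
    conv_rhs => rw [← h v, map_sum]
    refine Finset.sum_congr rfl fun a _ => ?_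
    rw [map_smul]
    rfl
  rw [← AlternatingMap.alternatizeUncurryFin_curryLeft, ← h1]
  exact (map_sum (AlternatingMap.alternatizeUncurryFinLM (R := R)) _ Finset.univ).symm

end Alternatize

section Cartan

variable {n : ℕ} {X : Type*} [TopologicalSpace X] [ChartedSpace (EuclideanSpace ℝ (Fin n)) X]
  [IsManifold (𝓡 n) ∞ X]
variable {F : Type*} [NormedAddCommGroup F] [NormedSpace ℝ F]
  {V : X → Type*} [TopologicalSpace (TotalSpace F V)]
  [∀ x, AddCommGroup (V x)] [∀ x, Module ℝ (V x)] [∀ x, TopologicalSpace (V x)]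
  [∀ x, IsTopologicalAddGroup (V x)] [∀ x, ContinuousSMul ℝ (V x)]
  [FiberBundle F V] [VectorBundle ℝ F V]
variable (cov : CovariantDerivative (𝓡 n) F V) [ContMDiffVectorBundle ∞ F V (𝓡 n)]
  [cov.ContMDiffCovariantDerivative ∞]

theorem bracket_jacobi (u v w : VecField n X) :
    bracket n X u (bracket n X v w) =
      bracket n X (bracket n X u v) w + bracket n X v (bracket n X u w) := by
  have h (u : VecField n X) := u.contMDiff.of_le (n := ∞) (m := minSmoothness ℝ 2)
    (by simpa using ENat.LEInfty.out)
  have : IsManifold (𝓡 n) (minSmoothness ℝ 3) X :=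
    IsManifold.of_le (n := ∞) (by simpa using ENat.LEInfty.out)
  ext x
  exact VectorField.leibniz_identity_mlieBracket_apply (h u x) (h v x) (h w x)

variable {j : ℕ}

theorem insertFirst_covTerm
    (K : AlternatingMap ℝ (VecField n X) (SmoothSection n F V) (Fin (j + 1)))
    (u w : VecField n X) :
    insertFirst u (covTerm cov K w) = covTerm cov (insertFirst u K) w := rfl

theorem bracketTerm_eq (K : AlternatingMap ℝ (VecField n X) (SmoothSection n F V) (Fin (j + 1)))
    (u w : VecField n X) : bracketTerm K u w = insertFirst (bracket n X u w) K := rfl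

theorem bracketTerm_swap (K : AlternatingMap ℝ (VecField n X) (SmoothSection n F V) (Fin (j + 1)))
    (u w : VecField n X) : bracketTerm K w u = -bracketTerm K u w := by
  rw [bracketTerm_eq, bracketTerm_eq, bracket_swap, insertFirst_neg_left]

theorem insertFirst_bracketTerm
    (K : AlternatingMap ℝ (VecField n X) (SmoothSection n F V) (Fin (j + 2)))
    (u v w : VecField n X) :
    insertFirst u (bracketTerm K v w) = -bracketTerm (insertFirst u K) v w := by
  rw [bracketTerm_eq, bracketTerm_eq, insertFirst_insertFirst]

/-- The Lie derivative, twisted by the connection, of an alternating map on vector fields. -/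
def lieDeriv : (j : ℕ) → VecField n X →
    AlternatingMap ℝ (VecField n X) (SmoothSection n F V) (Fin j) →
    AlternatingMap ℝ (VecField n X) (SmoothSection n F V) (Fin j)
  | 0, u, K => covTerm cov K u
  | _ + 1, u, K => covTerm cov K u - AlternatingMap.alternatizeUncurryFin (bracketTerm K u)

theorem lieDeriv_sub (u : VecField n X)
    (K L : AlternatingMap ℝ (VecField n X) (SmoothSection n F V) (Fin j)) :
    lieDeriv cov j u (K - L) = lieDeriv cov j u K - lieDeriv cov j u L := by
  have h1 : covTerm cov (K - L) u = covTerm cov K u - covTerm cov L u := by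
    ext; simp [covTerm_apply]
  cases j with
  | zero => exact h1
  | succ j =>
    have h2 : bracketTerm (K - L) u = bracketTerm K u - bracketTerm L u := by
      ext; simp [bracketTerm_apply]
    simp only [lieDeriv, h1, h2, alternatize_sub]
    abel

theorem koszul_sub (K L : AlternatingMap ℝ (VecField n X) (SmoothSection n F V) (Fin j)) :
    koszul cov j (K - L) = koszul cov j K - koszul cov j L := by
  rw [sub_eq_add_neg, koszul_add, ← neg_one_smul ℝ L, koszul_smul, neg_one_smul, sub_eq_add_neg]

/-- Cartan's formula in degree zero. -/
theorem insertFirst_koszul_zero (u : VecField n X)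
    (K : AlternatingMap ℝ (VecField n X) (SmoothSection n F V) (Fin 0)) :
    insertFirst u (koszul cov 0 K) = lieDeriv cov 0 u K :=
  insertFirst_alternatize_zero u _

/-- Cartan's formula. -/
theorem insertFirst_koszul (u : VecField n X)
    (K : AlternatingMap ℝ (VecField n X) (SmoothSection n F V) (Fin (j + 1))) :
    insertFirst u (koszul cov (j + 1) K) =
      lieDeriv cov (j + 1) u K - koszul cov j (insertFirst u K) := by
  have h1 : insertFirst u ∘ₗ covTerm cov K = covTerm cov (insertFirst u K) := rfl
  have h2 : AlternatingMap.alternatizeUncurryFin (bracketTerm K u) =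
      (1 / 2 : ℝ) • (AlternatingMap.alternatizeUncurryFin (bracketTerm K u) +
        AlternatingMap.alternatizeUncurryFin (bracketTerm K u)) := by
    rw [← two_smul ℝ, smul_smul]; norm_num
  cases j with
  | zero =>
    have h3 : insertFirst u ∘ₗ (AlternatingMap.alternatizeUncurryFinLM ∘ₗ bracketTerm K) =
        -bracketTerm K u := by
      refine LinearMap.ext fun w => ?_
      exact (insertFirst_alternatize_zero u (bracketTerm K w)).trans (bracketTerm_swap K u w)
    simp only [koszul, lieDeriv, map_sub, LinearMap.map_smul, insertFirst_alternatize, h1, h3,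
      LinearMap.comp_apply, AlternatingMap.alternatizeUncurryFinLM_apply, alternatize_neg]
    rw [h2]
    module
  | succ j =>
    have h3 : insertFirst u ∘ₗ (AlternatingMap.alternatizeUncurryFinLM ∘ₗ bracketTerm K) =
        -bracketTerm K u +
          AlternatingMap.alternatizeUncurryFinLM ∘ₗ bracketTerm (insertFirst u K) := by
      refine LinearMap.ext fun w => ?_
      have h4 : insertFirst u ∘ₗ bracketTerm K w = -bracketTerm (insertFirst u K) w :=
        LinearMap.ext fun v => insertFirst_bracketTerm K u w v
      simp only [LinearMap.comp_apply, AlternatingMap.alternatizeUncurryFinLM_apply,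
        insertFirst_alternatize, h4, alternatize_neg, LinearMap.add_apply, LinearMap.neg_apply,
        bracketTerm_swap K u w, sub_neg_eq_add]
    simp only [koszul, lieDeriv, map_sub, LinearMap.map_smul, insertFirst_alternatize, h1, h3,
      LinearMap.comp_apply, AlternatingMap.alternatizeUncurryFinLM_apply, alternatize_neg,
      AlternatingMap.alternatizeUncurryFin_add]
    rw [h2]
    module

theorem insertFirst_lieDeriv (u w : VecField n X)
    (K : AlternatingMap ℝ (VecField n X) (SmoothSection n F V) (Fin (j + 1))) :
    insertFirst w (lieDeriv cov (j + 1) u K) =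
      lieDeriv cov j u (insertFirst w K) - insertFirst (bracket n X u w) K := by
  cases j with
  | zero =>
    simp only [lieDeriv, map_sub, insertFirst_covTerm, insertFirst_alternatize_zero,
      bracketTerm_eq]
  | succ j =>
    have h4 : insertFirst w ∘ₗ bracketTerm K u = -bracketTerm (insertFirst w K) u :=
      LinearMap.ext fun v => insertFirst_bracketTerm K w u v
    simp only [lieDeriv, map_sub, insertFirst_covTerm, insertFirst_alternatize,
      bracketTerm_eq K u w, h4, alternatize_neg]
    abel

variable {cov}

/-- Flatness, stated for sections, extends to the Lie derivatives of forms of all degrees. -/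
theorem lieDeriv_comm (hflat : IsFlat cov) (u w : VecField n X) (j : ℕ) :
    ∀ K : AlternatingMap ℝ (VecField n X) (SmoothSection n F V) (Fin j),
      lieDeriv cov j u (lieDeriv cov j w K) - lieDeriv cov j w (lieDeriv cov j u K) =
        lieDeriv cov j (bracket n X u w) K := by
  induction j with
  | zero => exact fun K => AlternatingMap.ext fun v => hflat u w (K v)
  | succ j ih =>
    refine fun K => ext_insertFirst fun v => ?_
    have h := bracket_jacobi u w v
    simp only [map_sub, insertFirst_lieDeriv, lieDeriv_sub, h, insertFirst_add_left]
    rw [← ih]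
    abel

/-- The exterior covariant derivative commutes with Lie derivatives. -/
theorem lieDeriv_koszul (hflat : IsFlat cov) (j : ℕ) :
    ∀ (u : VecField n X) (K : AlternatingMap ℝ (VecField n X) (SmoothSection n F V) (Fin j)),
      lieDeriv cov (j + 1) u (koszul cov j K) = koszul cov j (lieDeriv cov j u K) := by
  induction j with
  | zero =>
    refine fun u K => ext_insertFirst fun w => ?_
    rw [insertFirst_lieDeriv, insertFirst_koszul_zero, insertFirst_koszul_zero,
      insertFirst_koszul_zero, ← lieDeriv_comm hflat]
    abel
  | succ j ih =>
    refine fun u K => ext_insertFirst fun w => ?_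
    rw [insertFirst_lieDeriv, insertFirst_koszul, insertFirst_koszul, insertFirst_koszul,
      insertFirst_lieDeriv, lieDeriv_sub, koszul_sub, ih, ← lieDeriv_comm hflat]
    abel

/-- By Cartan's formula and the commutation with Lie derivatives, the square of the exterior
covariant derivative commutes with insertions. Hence it vanishes, by induction on the degree. -/
theorem koszul_koszul (hflat : IsFlat cov) (j : ℕ) :
    ∀ K : AlternatingMap ℝ (VecField n X) (SmoothSection n F V) (Fin j),
      koszul cov (j + 1) (koszul cov j K) = 0 := by
  induction j with
  | zero =>
    refine fun K => ext_insertFirst fun w => ?_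
    rw [insertFirst_koszul, insertFirst_koszul_zero, lieDeriv_koszul hflat, sub_self, map_zero]
  | succ j ih =>
    refine fun K => ext_insertFirst fun w => ?_
    rw [insertFirst_koszul, insertFirst_koszul, koszul_sub, ih, lieDeriv_koszul hflat, sub_zero,
      sub_self, map_zero]

/-- The twisted de Rham operator of a flat connection squares to zero. -/
theorem dTwisted_dTwisted [T2Space X] (hflat : IsFlat cov) (j : ℕ) (θ : TwistedForm n F V j) :
    dTwisted cov (j + 1) (dTwisted cov j θ) = 0 := by
  refine TwistedForm.eval_injective ?_
  rw [eval_dTwisted, eval_dTwisted, koszul_koszul hflat]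
  rfl

end Cartan

/-! ### Contractions of forms with vector fields -/

/-- The direct sum of the components of a graded module. -/
abbrev GradedSum (M : ℕ → Type*) [∀ j, AddCommGroup (M j)] : Type _ := ⨁ j, M j

/-- The inclusion of the component of degree `j`. -/
abbrev gradedOf (M : ℕ → Type*) [∀ j, AddCommGroup (M j)] [∀ j, Module ℝ (M j)] (j : ℕ) :
    M j →ₗ[ℝ] GradedSum M := DirectSum.lof ℝ ℕ M j

section Contraction

variable {n : ℕ} {X : Type*} [TopologicalSpace X] [ChartedSpace (EuclideanSpace ℝ (Fin n)) X]
  [IsManifold (𝓡 n) ∞ X]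
variable {F : Type*} [NormedAddCommGroup F] [NormedSpace ℝ F]
  {V : X → Type*} [TopologicalSpace (TotalSpace F V)]
  [∀ x, AddCommGroup (V x)] [∀ x, Module ℝ (V x)] [∀ x, TopologicalSpace (V x)]
  [∀ x, IsTopologicalAddGroup (V x)] [∀ x, ContinuousSMul ℝ (V x)]
  [FiberBundle F V] [VectorBundle ℝ F V]

variable (n F V) in
/-- The inhomogeneous forms with values in `V`. -/
abbrev Forms : Type _ := GradedSum fun j => TwistedForm n F V j

variable (n F V) in
/-- The inclusion of the forms of degree `j` into the inhomogeneous forms. -/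
abbrev ofForm (j : ℕ) : TwistedForm n F V j →ₗ[ℝ] Forms n F V :=
  gradedOf (fun j => TwistedForm n F V j) j

/-- The derivative of the function `f` along the vector field `U`. -/
def derivFun (U : VecField n X) (f : SmoothFun n X) : SmoothFun n X :=
  ⟨fun x => mvfderiv (𝓡 n) f x (U x), by
    have h := (f.contMDiff.contMDiff_tangentMap (m := ∞) (by simp)).comp U.contMDiff
    exact ((contMDiff_snd_tangentBundle_modelSpace ℝ 𝓘(ℝ, ℝ)).comp h)⟩

theorem derivFun_apply (U : VecField n X) (f : SmoothFun n X) (x : X) :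
    derivFun U f x = mvfderiv (𝓡 n) f x (U x) := rfl

variable {j : ℕ}

/-- The contraction of a form with a vector field. -/
def contract (U : VecField n X) (j : ℕ) : TwistedForm n F V (j + 1) →ₗ[ℝ] TwistedForm n F V j where
  toFun θ := ⟨fun x => insertFirst (U x) (θ.1 x), fun W => by
    refine (θ.2 (Fin.cons U W)).congr fun x => ?_
    refine congrArg (TotalSpace.mk' F x) (congrArg (θ.1 x) (funext fun i => ?_))
    refine Fin.cases rfl (fun i => rfl) i⟩
  map_add' _ _ := rfl
  map_smul' _ _ := rfl

theorem contract_val (U : VecField n X) (θ : TwistedForm n F V (j + 1)) (x : X) :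
    (contract U j θ).1 x = insertFirst (U x) (θ.1 x) := rfl

/-- The components of `contraction`. -/
def contractLof (U : VecField n X) :
    (j : ℕ) → TwistedForm n F V j →ₗ[ℝ] Forms n F V
  | 0 => 0
  | j + 1 => ofForm n F V j ∘ₗ contract U j

variable (F V) in
/-- The contraction with a vector field, on inhomogeneous forms. -/
def contraction (U : VecField n X) :
    Forms n F V →ₗ[ℝ] Forms n F V :=
  DirectSum.toModule ℝ ℕ _ (contractLof U)

theorem contraction_lof_zero (U : VecField n X) (θ : TwistedForm n F V 0) :
    contraction F V U (ofForm n F V 0 θ) = 0 := by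
  rw [contraction, DirectSum.toModule_lof]
  rfl

theorem contraction_lof_succ (U : VecField n X) (θ : TwistedForm n F V (j + 1)) :
    contraction F V U (ofForm n F V (j + 1) θ) =
      ofForm n F V j (contract U j θ) := by
  rw [contraction, DirectSum.toModule_lof]
  rfl

theorem lowersDegree_contraction (U : VecField n X) : LowersDegree (contraction F V U) := by
  refine ⟨?_, ?_⟩
  · rintro _ ⟨θ, rfl⟩
    exact contraction_lof_zero U θ
  · rintro a _ ⟨θ, rfl⟩
    exact ⟨_, (contraction_lof_succ U θ).symm⟩

/-- Linear maps of inhomogeneous forms agree if they agree on homogeneous ones. -/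
theorem ext_lof {S T : Forms n F V →ₗ[ℝ] Forms n F V}
    (h : ∀ j θ, S (ofForm n F V j θ) =
      T (ofForm n F V j θ)) : S = T :=
  DirectSum.linearMap_ext ℝ fun j => LinearMap.ext (h j)

theorem contraction_smul (U : VecField n X) (f : SmoothFun n X) (θ : Forms n F V) :
    contraction F V U (f • θ) = f • contraction F V U θ := by
  suffices h : contraction F V U ∘ₗ Algebra.lsmul ℝ ℝ (Forms n F V) f =
      Algebra.lsmul ℝ ℝ (Forms n F V) f ∘ₗ contraction F V U from LinearMap.congr_fun h θ
  refine ext_lof fun j θ => ?_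
  simp only [LinearMap.comp_apply, Algebra.lsmul_coe]
  cases j with
  | zero => rw [smul_lof, contraction_lof_zero, contraction_lof_zero, smul_zero]
  | succ j =>
    rw [smul_lof, contraction_lof_succ, contraction_lof_succ, smul_lof]
    exact congrArg _ <| TwistedForm.ext fun x => ((insertFirst (U x)).map_smul (f x) (θ.1 x))

variable [T2Space X] (cov : CovariantDerivative (𝓡 n) F V) [ContMDiffVectorBundle ∞ F V (𝓡 n)]
  [cov.ContMDiffCovariantDerivative ∞]

/-- The commutator of `d` with a function `f` is the exterior multiplication with `df`. -/
theorem dTwisted_smul_sub_val (f : SmoothFun n X) (θ : TwistedForm n F V j) (x : X) :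
    (dTwisted cov j (f • θ) - f • dTwisted cov j θ).1 x = AlternatingMap.alternatizeUncurryFin
      (((mvfderiv (𝓡 n) f x : TangentSpace (𝓡 n) x →L[ℝ] ℝ) :
        TangentSpace (𝓡 n) x →ₗ[ℝ] ℝ).smulRight (θ.1 x)) := by
  ext v
  obtain ⟨e, he⟩ := TwistedForm.exists_extension (n := n) x
  have h := dTwisted_smul cov j θ f (fun i => e (v i)) x
  simp only [TwistedForm.eval_apply, he] at h
  have h1 : (dTwisted cov j (f • θ) - f • dTwisted cov j θ).1 x v =
      (dTwisted cov j (f • θ)).1 x v - f x • (dTwisted cov j θ).1 x v := rfl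
  rw [h1, h, add_sub_cancel_left, AlternatingMap.alternatizeUncurryFin_apply]
  refine Finset.sum_congr rfl fun i _ => ?_
  have h2 : (fun k => i.removeNth (fun r => e (v r)) k x) = i.removeNth v :=
    funext fun k => he _
  rw [h2]
  rfl

theorem mulComm_total_lof (f : SmoothFun n X) (θ : TwistedForm n F V j) :
    mulComm (M := Forms n F V) (total (dTwisted cov)) f (ofForm n F V j θ) =
      ofForm n F V (j + 1)
        (dTwisted cov j (f • θ) - f • dTwisted cov j θ) := by
  rw [mulComm_apply, smul_lof, total_lof, total_lof, smul_lof, ← map_sub]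

/-- The Lie derivative along `U`, the anticommutator of `d` and the contraction with `U`, is a
derivation over the derivation of functions along `U`. -/
theorem mulComm_lie_contraction (U : VecField n X) (f : SmoothFun n X) :
    mulComm (M := Forms n F V) (total (dTwisted cov) ∘ₗ contraction F V U +
      contraction F V U ∘ₗ total (dTwisted cov)) f =
        Algebra.lsmul ℝ ℝ (Forms n F V) (derivFun U f) := by
  have h : mulComm (M := Forms n F V) (total (dTwisted cov) ∘ₗ contraction F V U +
      contraction F V U ∘ₗ total (dTwisted cov)) f =
      mulComm (M := Forms n F V) (total (dTwisted cov)) f ∘ₗ contraction F V U +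
        contraction F V U ∘ₗ mulComm (M := Forms n F V) (total (dTwisted cov)) f := by
    refine LinearMap.ext fun θ => ?_
    simp only [mulComm_apply, LinearMap.add_apply, LinearMap.comp_apply, contraction_smul, map_sub,
      smul_add]
    abel
  rw [h]
  refine ext_lof fun j θ => ?_
  have h1 : contraction F V U (mulComm (M := Forms n F V) (total (dTwisted cov)) f
      (ofForm n F V j θ)) =
      ofForm n F V j (contract U j (dTwisted cov j (f • θ) - f • dTwisted cov j θ)) := by
    rw [mulComm_total_lof, contraction_lof_succ]
  have h2 : Algebra.lsmul ℝ ℝ (Forms n F V) (derivFun U f) (ofForm n F V j θ) =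
      ofForm n F V j (derivFun U f • θ) :=
    smul_lof (M := fun j => TwistedForm n F V j) (derivFun U f) j θ
  refine (congrArg₂ (· + ·) rfl h1).trans (Eq.trans ?_ h2.symm)
  cases j with
  | zero =>
    have h3 : mulComm (M := Forms n F V) (total (dTwisted cov)) f
        (contraction F V U (ofForm n F V 0 θ)) = 0 := by
      rw [contraction_lof_zero, map_zero]
    refine (congrArg₂ (· + ·) h3 rfl).trans ((zero_add _).trans
      (congrArg _ (TwistedForm.ext fun x => ?_)))
    rw [contract_val, dTwisted_smul_sub_val, insertFirst_alternatize_zero]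
    rfl
  | succ j =>
    have h3 : mulComm (M := Forms n F V) (total (dTwisted cov)) f
        (contraction F V U (ofForm n F V (j + 1) θ)) = ofForm n F V (j + 1)
          (dTwisted cov j (f • contract U j θ) - f • dTwisted cov j (contract U j θ)) :=
      (congrArg _ (contraction_lof_succ U θ)).trans (mulComm_total_lof cov f _)
    refine (congrArg₂ (· + ·) h3 rfl).trans (((ofForm n F V (j + 1)).map_add _ _).symm.trans
      (congrArg _ (TwistedForm.ext fun x => ?_)))
    have h4 := dTwisted_smul_sub_val cov f (contract U j θ) x
    have h5 := dTwisted_smul_sub_val cov f θ x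
    rw [contract_val] at h4
    generalize dTwisted cov j (f • contract U j θ) - f • dTwisted cov j (contract U j θ) = η at h4
    generalize dTwisted cov (j + 1) (f • θ) - f • dTwisted cov (j + 1) θ = η' at h5
    have h6 : (η + contract U (j + 1) η').1 x = η.1 x + insertFirst (U x) (η'.1 x) := rfl
    rw [h6, h4, h5, insertFirst_wedge_add]
    rfl

/-- If the functions `x a` and the vector fields `U a` form a dual frame on `W`, then
`∑ a, dx a ∧ ι_(U a)` is on `W` the multiplication with the degree. -/
theorem smul_sum_mulComm_contraction_sub {ι : Type*} [Fintype ι] {W : Set X}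
    {x : ι → SmoothFun n X} {U : ι → VecField n X}
    (h : ∀ y ∈ W, ∀ v : TangentSpace (𝓡 n) y, ∑ a, mvfderiv (𝓡 n) (x a) y v • U a y = v)
    (ψ : SmoothFun n X) (hψ : ∀ y ∉ W, ψ y = 0) (θ : Forms n F V) :
    ψ • (∑ a, mulComm (M := Forms n F V) (total (dTwisted cov)) (x a) ∘ₗ contraction F V (U a) -
      degreeMap (fun j => TwistedForm n F V j)) θ = 0 := by
  suffices h : Algebra.lsmul ℝ ℝ (Forms n F V) ψ ∘ₗ
      (∑ a, mulComm (M := Forms n F V) (total (dTwisted cov)) (x a) ∘ₗ contraction F V (U a) -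
        degreeMap (fun j => TwistedForm n F V j)) = 0 from
    LinearMap.congr_fun h θ
  refine ext_lof fun j θ => ?_
  simp only [LinearMap.sub_apply, LinearMap.comp_apply, Algebra.lsmul_coe, LinearMap.sum_apply,
    degreeMap_lof, LinearMap.zero_apply]
  cases j with
  | zero => simp [contraction_lof_zero]
  | succ j =>
    simp only [contraction_lof_succ, mulComm_total_lof]
    rw [← map_sum, ← map_smul, ← map_sub, smul_lof]
    refine (congrArg _ ?_).trans (map_zero _)
    refine TwistedForm.ext fun y => ?_
    rw [TwistedForm.smul_val_apply]
    by_cases hy : y ∈ W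
    · have h1 (η η' : TwistedForm n F V (j + 1)) : (η - η').1 y = η.1 y - η'.1 y := rfl
      have h2 (c : ℝ) (η : TwistedForm n F V (j + 1)) : (c • η).1 y = c • η.1 y := rfl
      have h3 (η : ι → TwistedForm n F V (j + 1)) : (∑ a, η a).1 y = ∑ a, (η a).1 y := by
        rw [Submodule.coe_sum, Finset.sum_apply]
      rw [h1, h2, h3]
      simp only [dTwisted_smul_sub_val, contract_val]
      rw [sum_wedge_insertFirst _ _ (h y hy), Nat.cast_smul_eq_nsmul ℝ, sub_self, smul_zero]
      rfl
    · rw [hψ y hy, zero_smul]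
      rfl

end Contraction

/-! ### Derivations at a point and dual frames -/

section PointDerivations

/-- Hadamard's lemma: a smooth function differs from its value at `z₀` by a smooth family of
linear forms applied to the displacement from `z₀`. -/
theorem hadamard {E : Type*} [NormedAddCommGroup E] [NormedSpace ℝ E] [FiniteDimensional ℝ E]
    {f : E → ℝ} (hf : ContDiff ℝ ∞ f) (z₀ : E) :
    ∃ g : E → E →L[ℝ] ℝ, ContDiff ℝ ∞ g ∧ g z₀ = fderiv ℝ f z₀ ∧
      ∀ z, f z = f z₀ + g z (z - z₀) := by
  have hf' : ContDiff ℝ ∞ (fderiv ℝ f) := hf.fderiv_right (by simp)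
  let χ : ContDiffBump (0 : ℝ) := ⟨1, 2, one_pos, one_lt_two⟩
  -- The integral over `[0, 1]` is written as a convolution with an indicator function.
  have hconv (z : E) : ∫ t in (0 : ℝ)..1, fderiv ℝ f (z₀ + t • (z - z₀)) =
      MeasureTheory.convolution (Set.indicator (Set.Ioc (0 : ℝ) 1) fun _ => (1 : ℝ))
        (fun s : ℝ => χ s • fderiv ℝ f (z₀ - s • (z - z₀)))
        (ContinuousLinearMap.lsmul ℝ ℝ) MeasureTheory.volume 0 := by
    rw [intervalIntegral.integral_of_le zero_le_one,
      ← MeasureTheory.integral_indicator measurableSet_Ioc, MeasureTheory.convolution_def]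
    refine MeasureTheory.integral_congr_ae (Filter.Eventually.of_forall fun t => ?_)
    by_cases ht : t ∈ Set.Ioc (0 : ℝ) 1
    · have h1 : χ (-t) = 1 := χ.one_of_mem_closedBall (by
        rw [Metric.mem_closedBall, dist_zero_right, norm_neg, Real.norm_eq_abs, abs_of_pos ht.1]
        exact ht.2)
      simp [Set.indicator_of_mem ht, h1]
    · simp [Set.indicator_of_notMem ht]
  refine ⟨fun z => ∫ t in (0 : ℝ)..1, fderiv ℝ f (z₀ + t • (z - z₀)), ?_, ?_, fun z => ?_⟩
  · simp only [hconv]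
    refine contDiffOn_univ.1 (MeasureTheory.contDiffOn_convolution_right_with_param_comp (n := ⊤)
      (k := Metric.closedBall 0 2) (v := fun _ => 0) _ contDiffOn_const isOpen_univ
      (isCompact_closedBall _ _) ?_ ?_ ?_)
    · intro z s _ hs
      rw [χ.zero_of_le_dist (by
        rw [Metric.mem_closedBall, not_le] at hs
        exact hs.le), zero_smul]
    · exact ((MeasureTheory.integrable_indicator_iff measurableSet_Ioc).2
        (by simp)).locallyIntegrable
    · refine ContDiff.contDiffOn ?_
      have h1 : ContDiff ℝ ∞ fun p : E × ℝ => χ p.2 := χ.contDiff.comp contDiff_snd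
      exact h1.smul (hf'.comp (by fun_prop))
  · simp
  · have h1 (t : ℝ) : HasDerivAt (fun t : ℝ => z₀ + t • (z - z₀)) (z - z₀) t := by
      simpa using ((hasDerivAt_id t).smul_const (z - z₀)).const_add z₀
    have h2 (t : ℝ) : HasDerivAt (fun t : ℝ => f (z₀ + t • (z - z₀)))
        (fderiv ℝ f (z₀ + t • (z - z₀)) (z - z₀)) t :=
      ((hf.differentiable (by simp) _).hasFDerivAt).comp_hasDerivAt t (h1 t)
    have hc : Continuous fun t : ℝ => fderiv ℝ f (z₀ + t • (z - z₀)) :=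
      hf'.continuous.comp (by fun_prop)
    have h3 := intervalIntegral.integral_eq_sub_of_hasDerivAt (a := 0) (b := 1)
      (fun t _ => h2 t) ((hc.clm_apply continuous_const).intervalIntegrable 0 1)
    rw [ContinuousLinearMap.intervalIntegral_apply (hc.intervalIntegrable 0 1), h3]
    simp

variable {n : ℕ} {X : Type*} [TopologicalSpace X] [ChartedSpace (EuclideanSpace ℝ (Fin n)) X]
  [IsManifold (𝓡 n) ∞ X] [T2Space X]

/-- A derivation at the point `y` annihilates the functions whose differential vanishes at `y`: by
Hadamard's lemma in a chart they are, near `y`, a constant plus a sum of products of functions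
vanishing at `y`. -/
theorem pointDerivation_eq_zero {W : Type*} [AddCommGroup W] [Module ℝ W] (y : X)
    (D : SmoothFun n X →ₗ[ℝ] W) (hD : ∀ f g, D (f * g) = f y • D g + g y • D f)
    (f : SmoothFun n X) (hf : mvfderiv (𝓡 n) f y = 0) : D f = 0 := by
  have hD1 : D 1 = 0 := by simpa using hD 1 1
  have hloc (f g : SmoothFun n X) (h : ∀ᶠ z in 𝓝 y, f z = g z) : D f = D g := by
    obtain ⟨u, hus, hu, hyu⟩ := mem_nhds_iff.1 h
    obtain ⟨ψ, hψ, hψu⟩ := exists_bump (n := n) (hu.mem_nhds hyu)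
    have h1 : ψ * (f - g) = 0 := by
      ext z
      by_cases hz : z ∈ tsupport ψ
      · have : f z = g z := hus (hψu hz)
        simp [this]
      · simp [image_eq_zero_of_notMem_tsupport hz]
    have h2 := hD ψ (f - g)
    rw [h1, map_zero, hψ.self_of_nhds, one_smul] at h2
    have h3 : (f - g) y = 0 := by
      have := h.self_of_nhds
      simp [this]
    rw [h3, zero_smul, add_zero, map_sub] at h2
    exact (sub_eq_zero.1 h2.symm)
  let φ := extChartAt (𝓡 n) y
  have htar : IsOpen φ.target := isOpen_extChartAt_target y
  have hF0 : ContDiffOn ℝ ∞ (f ∘ φ.symm) φ.target := by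
    rw [← contMDiffOn_iff_contDiffOn]
    exact f.contMDiff.comp_contMDiffOn (contMDiffOn_extChartAt_symm y)
  obtain ⟨r, hr, hrt⟩ := Metric.nhds_basis_closedBall.mem_iff.1
    (htar.mem_nhds (mem_extChartAt_target (I := 𝓡 n) y))
  let χ : ContDiffBump (φ y) := ⟨r / 2, r, half_pos hr, half_lt_self hr⟩
  have hF : ContDiff ℝ ∞ fun z => χ z * (f ∘ φ.symm) z := by
    rw [contDiff_iff_contDiffAt]
    intro z
    by_cases hz : z ∈ φ.target
    · exact χ.contDiffAt.mul (hF0.contDiffAt (htar.mem_nhds hz))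
    · have h1 : z ∉ tsupport χ := fun h => hz (hrt (χ.tsupport_eq ▸ h))
      refine contDiffAt_const (c := (0 : ℝ)) |>.congr_of_eventuallyEq ?_
      filter_upwards [(isClosed_tsupport χ).isOpen_compl.mem_nhds h1] with w hw
      simp [image_eq_zero_of_notMem_tsupport hw]
  have hFe : (fun z => χ z * (f ∘ φ.symm) z) =ᶠ[𝓝 (φ y)] f ∘ φ.symm := by
    filter_upwards [χ.eventuallyEq_one] with z hz
    simp [hz]
  obtain ⟨g, hg, hg0, hgz⟩ := hadamard hF (φ y)
  have hg1 : g (φ y) = 0 := by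
    rw [hg0, hFe.fderiv_eq]
    have h1 : mfderiv (𝓡 n) 𝓘(ℝ, ℝ) f y = fderiv ℝ (f ∘ φ.symm) (φ y) := by
      refine (f.contMDiff.mdifferentiable (by simp) y).mfderiv.trans ?_
      simp only [modelWithCornersSelf_coe, Set.range_id, fderivWithin_univ]
      rfl
    rw [← h1]
    exact hf
  have hsrc : IsOpen φ.source := isOpen_extChartAt_source y
  have hy : y ∈ φ.source := mem_extChartAt_source y
  have hφ : ContMDiffOn (𝓡 n) 𝓘(ℝ, EuclideanSpace ℝ (Fin n)) ∞ φ φ.source := by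
    have := contMDiffOn_extChartAt (I := 𝓡 n) (n := ∞) (x := y)
    rwa [← extChartAt_source (𝓡 n)] at this
  have hx (a : Fin n) : ∃ x : SmoothFun n X, ∀ᶠ z in 𝓝 y, x z = (φ z - φ y) a :=
    exists_global_fun hsrc hy _ (ContMDiff.comp_contMDiffOn (I' := 𝓘(ℝ, EuclideanSpace ℝ (Fin n)))
      (g := fun w => (w - φ y) a) (ContDiff.contMDiff (by fun_prop)) hφ)
  have hk (a : Fin n) : ∃ k : SmoothFun n X, ∀ᶠ z in 𝓝 y,
      k z = g (φ z) (EuclideanSpace.basisFun (Fin n) ℝ a) :=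
    exists_global_fun hsrc hy _ (ContMDiff.comp_contMDiffOn (I' := 𝓘(ℝ, EuclideanSpace ℝ (Fin n)))
      (g := fun w => g w (EuclideanSpace.basisFun (Fin n) ℝ a))
      (ContDiff.contMDiff (hg.clm_apply contDiff_const)) hφ)
  choose x hx using hx
  choose k hk using hk
  have key : D f = D (f y • (1 : SmoothFun n X) + ∑ a, x a * k a) := by
    refine hloc _ _ ?_
    have hcont : ContinuousAt φ y := continuousAt_extChartAt y
    filter_upwards [Filter.eventually_all.2 hx, Filter.eventually_all.2 hk, hsrc.mem_nhds hy,
      hcont.eventually hFe] with z h1 h2 h3 h4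
    have h5 : φ z - φ y = ∑ a, (φ z - φ y) a • EuclideanSpace.basisFun (Fin n) ℝ a := by
      conv_lhs => rw [← (EuclideanSpace.basisFun (Fin n) ℝ).sum_repr (φ z - φ y)]
      rfl
    have h6 := hgz (φ z)
    have h0 : χ (φ y) * (f ∘ φ.symm) (φ y) = (f ∘ φ.symm) (φ y) := hFe.self_of_nhds
    rw [h4, h0, h5, map_sum] at h6
    simp only [Function.comp_apply, φ.left_inv h3, φ.left_inv hy, map_smul] at h6
    have h7 : (f y • (1 : SmoothFun n X) + ∑ a, x a * k a) z = f y + ∑ a, x a z * k a z := by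
      have h8 : (∑ a, x a * k a : SmoothFun n X) z = ∑ a, x a z * k a z :=
        map_sum (ContMDiffMap.evalRingHom z) _ _
      simp [h8]
    rw [h7, h6]
    simp only [h1, h2, smul_eq_mul]
  rw [key, map_add, map_smul, hD1, smul_zero, zero_add, map_sum]
  refine Finset.sum_eq_zero fun a _ => ?_
  rw [hD, (hx a).self_of_nhds, (hk a).self_of_nhds, hg1]
  simp

/-- Near every point there are functions `x a` and vector fields `U a`, defined on all of `X`, such
that the `U a` are a frame and the differentials of the `x a` are the dual frame. -/
theorem exists_dual_frame (c : X) :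
    ∃ W : Set X, IsOpen W ∧ c ∈ W ∧ ∃ (x : Fin n → SmoothFun n X) (U : Fin n → VecField n X),
      ∀ y ∈ W, ∀ v : TangentSpace (𝓡 n) y, ∑ a, mvfderiv (𝓡 n) (x a) y v • U a y = v := by
  classical
  have : IsManifold (𝓡 n) 1 X := IsManifold.of_le (n := ∞) (by simp)
  have : ContMDiffVectorBundle 1 (EuclideanSpace ℝ (Fin n))
    (fun x : X => TangentSpace (𝓡 n) x) (𝓡 n) := ContMDiffVectorBundle.of_le (n := ∞) (by simp)
  let φ := extChartAt (𝓡 n) c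
  let e := trivializationAt (EuclideanSpace ℝ (Fin n)) (fun x : X => TangentSpace (𝓡 n) x) c
  let b := (EuclideanSpace.basisFun (Fin n) ℝ).toBasis
  have hsrc : IsOpen φ.source := isOpen_extChartAt_source c
  have hc : c ∈ φ.source := mem_extChartAt_source c
  have hφ : ContMDiffOn (𝓡 n) 𝓘(ℝ, EuclideanSpace ℝ (Fin n)) ∞ φ φ.source := by
    have := contMDiffOn_extChartAt (I := 𝓡 n) (n := ∞) (x := c)
    rwa [← extChartAt_source (𝓡 n)] at this
  have hce : c ∈ e.baseSet := FiberBundle.mem_baseSet_trivializationAt _ _ c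
  have hx (a : Fin n) : ∃ x : SmoothFun n X, ∀ᶠ z in 𝓝 c, x z = φ z a :=
    exists_global_fun hsrc hc _ (ContMDiff.comp_contMDiffOn (I' := 𝓘(ℝ, EuclideanSpace ℝ (Fin n)))
      (g := fun w => w a) (ContDiff.contMDiff (by fun_prop)) hφ)
  have hU (a : Fin n) : ∃ U : VecField n X, ∀ᶠ z in 𝓝 c, U z = e.localFrame b a z :=
    exists_global_section e.open_baseSet hce _
      (e.contMDiffOn_localFrame_baseSet (I := 𝓡 n) ∞ b a)
  choose x hx using hx
  choose U hU using hU
  have h1 : ∀ᶠ y in 𝓝 c, y ∈ φ.source ∧ y ∈ e.baseSet ∧ (∀ a, ∀ᶠ z in 𝓝 y, x a z = φ z a) ∧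
      ∀ a, U a y = e.localFrame b a y := by
    filter_upwards [hsrc.mem_nhds hc, e.open_baseSet.mem_nhds hce,
      Filter.eventually_all.2 fun a => (hx a).eventually_nhds, Filter.eventually_all.2 hU]
      with y h1 h2 h3 h4
    exact ⟨h1, h2, h3, h4⟩
  obtain ⟨W, hW, hWo, hcW⟩ := mem_nhds_iff.1 h1
  refine ⟨W, hWo, hcW, x, U, fun y hy v => ?_⟩
  obtain ⟨hys, hye, hxy, hUy⟩ := hW hy
  have hys' : y ∈ (chartAt (EuclideanSpace ℝ (Fin n)) c).source := by
    rwa [← extChartAt_source (𝓡 n)]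
  have h2 := e.eq_sum_localFrameCoeff_smul (I := 𝓡 n) (b := b) (s := Function.update 0 y v) hye
  rw [Function.update_self] at h2
  refine Eq.trans (Finset.sum_congr rfl fun a _ => ?_) h2.symm
  have h3 : (x a : X → ℝ) =ᶠ[𝓝 y] (EuclideanSpace.proj a : EuclideanSpace ℝ (Fin n) →L[ℝ] ℝ) ∘ φ :=
    hxy a
  have h4 : mfderiv (𝓡 n) 𝓘(ℝ, ℝ) (x a) y =
      (EuclideanSpace.proj a : EuclideanSpace ℝ (Fin n) →L[ℝ] ℝ).comp
        (mfderiv (𝓡 n) 𝓘(ℝ, EuclideanSpace ℝ (Fin n)) φ y) := by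
    rw [h3.mfderiv_eq, mfderiv_comp (I' := 𝓘(ℝ, EuclideanSpace ℝ (Fin n))) y
      (ContinuousLinearMap.mdifferentiableAt _) (mdifferentiableAt_extChartAt hys'),
      ContinuousLinearMap.mfderiv_eq]
    rfl
  have h5 : mvfderiv (𝓡 n) (x a) y v = (EuclideanSpace.proj a : EuclideanSpace ℝ (Fin n) →L[ℝ] ℝ)
      (e.continuousLinearMapAt ℝ y v) := by
    rw [TangentBundle.continuousLinearMapAt_trivializationAt hys']
    exact congrArg (fun L : TangentSpace (𝓡 n) y →L[ℝ] ℝ => L v) h4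
  have h6 := e.localFrameCoeff_apply_of_mem_baseSet (I := 𝓡 n) b hye (Function.update 0 y v) a
  rw [Function.update_self] at h6
  rw [h5, hUy a, h6]
  congr 1
  rw [Trivialization.continuousLinearMapAt_apply, e.coe_linearMapAt_of_mem hye,
    Trivialization.basisAt, Module.Basis.map_repr]
  rfl

end PointDerivations

/-! ### Gluing with a partition of unity -/

section Gluing

variable {A : Type*} [CommRing A] [Algebra ℝ A]
  {M : ℕ → Type*} [∀ j, AddCommGroup (M j)] [∀ j, Module ℝ (M j)] [∀ j, Module A (M j)]
  [∀ j, IsScalarTower ℝ A (M j)]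
  {Q : Type*} [AddCommGroup Q] [Module ℝ Q] [Module A Q] [IsScalarTower ℝ A Q]
  {l : ℕ} {κ : Type*}

/-- An abstract form of the formation of the locally finite sums `∑ c, ρ c • q c`, where `ρ` is a
partition of unity: a linear map of families which depends only on the `ρ c • q c` and sends
constant families to their value. -/
structure IsGluing (ρ : κ → A) (glue : (κ → Q) →ₗ[A] Q) : Prop where
  eq_zero : ∀ q, (∀ c, ρ c • q c = 0) → glue q = 0
  const : ∀ q, glue (fun _ => q) = q

/-- The gluing of families of operators, applied to the values. -/
def glueOp (l : ℕ) {N : Type*} [AddCommGroup N] [Module ℝ N] (glue : (κ → Q) →ₗ[A] Q) :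
    (κ → MultilinearMap ℝ (fun _ : Fin l => N) Q) →ₗ[A]
      MultilinearMap ℝ (fun _ : Fin l => N) Q where
  toFun Ψ := (glue.restrictScalars ℝ).compMultilinearMap (MultilinearMap.pi Ψ)
  map_add' Ψ Ψ' := MultilinearMap.ext fun m => glue.map_add (fun c => Ψ c m) fun c => Ψ' c m
  map_smul' f Ψ := MultilinearMap.ext fun m => glue.map_smul f fun c => Ψ c m

section

variable {N : Type*} [AddCommGroup N] [Module ℝ N] [Module A N] [IsScalarTower ℝ A N]
  {ρ : κ → A} {glue : (κ → Q) →ₗ[A] Q}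

theorem glueOp_apply (Ψ : κ → MultilinearMap ℝ (fun _ : Fin l => N) Q) (m : Fin l → N) :
    glueOp l glue Ψ m = glue fun c => Ψ c m := rfl

theorem glueOp_const (hg : IsGluing ρ glue) (Φ : MultilinearMap ℝ (fun _ : Fin l => N) Q) :
    glueOp l glue (fun _ => Φ) = Φ :=
  MultilinearMap.ext fun m => hg.const (Φ m)

theorem glueOp_eq_zero (hg : IsGluing ρ glue) (Ψ : κ → MultilinearMap ℝ (fun _ : Fin l => N) Q)
    (h : ∀ c, ρ c • Ψ c = 0) : glueOp l glue Ψ = 0 :=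
  MultilinearMap.ext fun m => hg.eq_zero _ fun c => DFunLike.congr_fun (h c) m

theorem slotComm_glueOp (r : Fin l) (f : A) (Ψ : κ → MultilinearMap ℝ (fun _ : Fin l => N) Q) :
    slotComm r f (glueOp l glue Ψ) = glueOp l glue fun c => slotComm r f (Ψ c) := by
  have h : slotComp A Q r (Algebra.lsmul ℝ ℝ N f) (glueOp l glue Ψ) =
      glueOp l glue fun c => slotComp A Q r (Algebra.lsmul ℝ ℝ N f) (Ψ c) := rfl
  rw [slotComm_eq, h, ← map_smul, ← map_sub]
  rfl

theorem glueOp_mem_orderLE (r : Fin l) (k : ℕ) :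
    ∀ Ψ : κ → MultilinearMap ℝ (fun _ : Fin l => N) Q, (∀ c, Ψ c ∈ orderLE A N Q r k) →
      glueOp l glue Ψ ∈ orderLE A N Q r k := by
  induction k with
  | zero =>
    intro Ψ h
    rw [mem_orderLE_zero]
    intro f
    rw [slotComm_glueOp]
    have : (fun c => slotComm r f (Ψ c)) = 0 := funext fun c => mem_orderLE_zero.1 (h c) f
    rw [this, map_zero]
  | succ k ih =>
    intro Ψ h
    rw [mem_orderLE_succ]
    intro f
    rw [slotComm_glueOp]
    exact ih _ fun c => mem_orderLE_succ.1 (h c) f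

theorem glueOp_mem_totalOrderLT (hg : IsGluing ρ glue) (k : ℕ) :
    ∀ Ψ : κ → MultilinearMap ℝ (fun _ : Fin l => N) Q,
      (∀ c, ρ c • Ψ c ∈ totalOrderLT A N Q l k) → glueOp l glue Ψ ∈ totalOrderLT A N Q l k := by
  induction k with
  | zero =>
    intro Ψ h
    rw [mem_totalOrderLT_zero]
    exact glueOp_eq_zero hg Ψ fun c => mem_totalOrderLT_zero.1 (h c)
  | succ k ih =>
    intro Ψ h
    rw [mem_totalOrderLT_succ]
    intro r f
    rw [slotComm_glueOp]
    refine ih _ fun c => ?_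
    rw [← LinearMap.map_smul]
    exact mem_totalOrderLT_succ.1 (h c) r f

end

theorem rightComp_glueOp (d : ∀ j, M j →ₗ[ℝ] M (j + 1)) (glue : (κ → Q) →ₗ[A] Q)
    (Ψ : κ → MultilinearMap ℝ (fun _ : Fin l => ⨁ j, M j) Q) :
    rightComp A Q d l (glueOp l glue Ψ) = glueOp l glue fun c => rightComp A Q d l (Ψ c) := by
  refine MultilinearMap.ext fun m => ?_
  simp only [rightComp_apply, glueOp_apply]
  rw [← map_sum]
  congr 1
  funext c
  simp [Finset.sum_apply]

variable {ι : κ → Type*} [∀ c, Fintype (ι c)]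

/-- The homotopy glued from local ones. -/
def glueHomotopy (l : ℕ) (glue : (κ → Q) →ₗ[A] Q) (x : ∀ c, ι c → A)
    (i : ∀ c, ι c → (⨁ j, M j) →ₗ[ℝ] ⨁ j, M j) :
    MultilinearMap ℝ (fun _ : Fin l => ⨁ j, M j) Q →ₗ[ℝ]
      MultilinearMap ℝ (fun _ : Fin l => ⨁ j, M j) Q :=
  (glueOp l glue ∘ₗ LinearMap.pi fun c => localHomotopy Q l (x c) (i c)).restrictScalars ℝ

theorem glueHomotopy_apply (glue : (κ → Q) →ₗ[A] Q) (x : ∀ c, ι c → A)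
    (i : ∀ c, ι c → (⨁ j, M j) →ₗ[ℝ] ⨁ j, M j)
    (Φ : MultilinearMap ℝ (fun _ : Fin l => ⨁ j, M j) Q) :
    glueHomotopy l glue x i Φ = glueOp l glue fun c => localHomotopy Q l (x c) (i c) Φ := rfl

/-- The local contraction homotopies glue to a homotopy as required. -/
theorem isOrderHomotopy_glueHomotopy {ρ : κ → A} {glue : (κ → Q) →ₗ[A] Q} (hg : IsGluing ρ glue)
    {d : ∀ j, M j →ₗ[ℝ] M (j + 1)} (hd : FirstOrder A d) {x : ∀ c, ι c → A}
    {i : ∀ c, ι c → (⨁ j, M j) →ₗ[ℝ] ⨁ j, M j} {u : ∀ c, ι c → A → A}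
    (h : ∀ c, IsLocalContraction Q l d (ρ c) (x c) (i c) (u c)) :
    IsOrderHomotopy (A := A) d (glueHomotopy (M := M) l glue x i) where
  mem_symDiffOp := by
    rintro Φ ⟨⟨k, hk⟩, hs⟩
    refine ⟨⟨k, fun r => glueOp_mem_orderLE r k _ fun c =>
      localHomotopy_mem_orderLE _ (h c).map_smul (hk r)⟩, fun r r' hr a b m ha hb => ?_⟩
    rw [glueHomotopy_apply, glueOp_apply, glueOp_apply]
    have h1 : (fun c => localHomotopy Q l (x c) (i c) Φ (m ∘ Equiv.swap r r')) =
        (-1 : ℝ) ^ (a * b) • fun c => localHomotopy Q l (x c) (i c) Φ m :=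
      funext fun c => localHomotopy_symm _ (h c).lowers hr (hs r r' hr) a b m ha hb
    rw [h1]
    exact glue.map_smul_of_tower _ _
  mem_ofDegree := by
    intro p Φ hΦ a m hm ha
    rw [glueHomotopy_apply, glueOp_apply]
    have h1 : (fun c => localHomotopy Q l (x c) (i c) Φ m) = 0 :=
      funext fun c => localHomotopy_mem_ofDegree _ (h c).lowers hΦ a m hm ha
    rw [h1, map_zero]
  eq_zero := by
    intro Φ hΦ
    rw [glueHomotopy_apply]
    have h1 : (fun c => localHomotopy Q l (x c) (i c) Φ) = 0 :=
      funext fun c => localHomotopy_eq_zero _ hΦ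
    rw [h1, map_zero]
  anticomm_sub_mem := by
    intro k p Φ hk hp
    have h1 : rightComp A Q d l (glueHomotopy l glue x i Φ) +
        glueHomotopy l glue x i (rightComp A Q d l Φ) - ((k : ℝ) + p) • Φ =
        glueOp l glue fun c => rightComp A Q d l (localHomotopy Q l (x c) (i c) Φ) +
          localHomotopy Q l (x c) (i c) (rightComp A Q d l Φ) - ((k : ℝ) + p) • Φ := by
      rw [glueHomotopy_apply, glueHomotopy_apply, rightComp_glueOp, ← map_add]
      conv_lhs => rw [← glueOp_const (l := l) hg (((k : ℝ) + p) • Φ), ← map_sub]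
      rfl
    rw [h1]
    exact glueOp_mem_totalOrderLT hg k _ fun c =>
      (h c).smul_anticomm_sub_mem hd p k Φ hk (evenComp_degreeMap hp)

end Gluing

section Manifold

variable {n : ℕ} {X : Type*} [TopologicalSpace X] [ChartedSpace (EuclideanSpace ℝ (Fin n)) X]
  [IsManifold (𝓡 n) ∞ X]
  {G : Type*} [NormedAddCommGroup G] [NormedSpace ℝ G]
  {β : X → Type*} [TopologicalSpace (TotalSpace G β)]
  [∀ x, AddCommGroup (β x)] [∀ x, Module ℝ (β x)] [∀ x, TopologicalSpace (β x)]
  [FiberBundle G β] [VectorBundle ℝ G β]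

theorem hasFiniteSupport_smul {κ : Type*} (ρ : SmoothPartitionOfUnity κ (𝓡 n) X)
    (s : κ → SmoothSection n G β) (y : X) :
    (Function.support fun c => ρ c y • s c y).Finite :=
  (ρ.locallyFinite.point_finite y).subset fun _ hc => left_ne_zero_of_smul hc

/-- The locally finite sum `∑ c, ρ c • s c` of sections, for a partition of unity `ρ`. -/
def glueSection {κ : Type*} (ρ : SmoothPartitionOfUnity κ (𝓡 n) X) :
    (κ → SmoothSection n G β) →ₗ[SmoothFun n X] SmoothSection n G β where
  toFun s := ⟨fun y => ∑ᶠ c, ρ c y • s c y, by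
    refine ContMDiff.finsum_section_of_locallyFinite (ρ.locallyFinite.subset fun c y hy => ?_)
      fun c => ((ρ c).contMDiff.smul_section (s c).contMDiff)
    rw [Set.mem_ofPred_eq] at hy
    exact left_ne_zero_of_smul hy⟩
  map_add' s t := by
    ext y
    refine Eq.trans (finsum_congr fun c => smul_add (ρ c y) (s c y) (t c y)) ?_
    exact finsum_add_distrib (hasFiniteSupport_smul ρ s y) (hasFiniteSupport_smul ρ t y)
  map_smul' f s := by
    ext y
    refine Eq.trans (finsum_congr fun c => smul_comm (ρ c y) (f y) (s c y)) ?_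
    exact (smul_finsum' (f y) (hasFiniteSupport_smul ρ s y)).symm

theorem isGluing_glueSection {κ : Type*} (ρ : SmoothPartitionOfUnity κ (𝓡 n) X) :
    IsGluing (A := SmoothFun n X) (fun c => ρ c)
      (glueSection (G := G) (β := β) ρ) where
  eq_zero q h := by
    ext y
    refine Eq.trans (finsum_congr fun c => ?_) finsum_zero
    exact DFunLike.congr_fun (h c) y
  const q := by
    ext y
    refine (finsum_smul' (ρ.locallyFinite.point_finite y) (q y)).symm.trans ?_
    rw [ρ.sum_eq_one (Set.mem_univ y), one_smul]

variable [T2Space X]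

theorem mvfderiv_sub_sum {ι : Type*} (s : Finset ι) (f : SmoothFun n X) (x : ι → SmoothFun n X)
    (k : ι → ℝ) (y : X) (v : TangentSpace (𝓡 n) y) :
    mvfderiv (𝓡 n) (f - ∑ a ∈ s, k a • x a : SmoothFun n X) y v =
      mvfderiv (𝓡 n) f y v - ∑ a ∈ s, k a * mvfderiv (𝓡 n) (x a) y v := by
  have hm (f : SmoothFun n X) : MDifferentiableAt (𝓡 n) 𝓘(ℝ, ℝ) f y :=
    f.contMDiff.mdifferentiable (by simp) y
  let D : SmoothFun n X →ₗ[ℝ] ℝ :=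
    { toFun := fun f => mvfderiv (𝓡 n) f y v
      map_add' := fun f g => by
        have := mvfderiv_add (hm f) (hm g)
        exact congrArg (fun L : TangentSpace (𝓡 n) y →L[ℝ] ℝ => L v) this
      map_smul' := fun c f => by
        have h := mvfderiv_smul (a := fun _ => c) (mdifferentiableAt_const (I := 𝓡 n)
          (I' := 𝓘(ℝ, ℝ)) (c := c)) (hm f)
        rw [mvfderiv_const] at h
        refine (congrArg (fun L : TangentSpace (𝓡 n) y →L[ℝ] ℝ => L v) h).trans ?_
        simp }
  have h : D (f - ∑ a ∈ s, k a • x a) = D f - ∑ a ∈ s, k a * D (x a) := by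
    simp only [map_sub, map_sum, map_smul, smul_eq_mul]
  exact h

/-- For `Ψ` of total order at most one, `f ↦ slotComm r f Ψ` is a derivation. If the functions `x a`
and the vector fields `U a` form a dual frame on `W`, it is therefore on `W` the combination of the
derivatives along the `U a` with coefficients `slotComm r (x a) Ψ`. -/
theorem smul_sum_slotComm_sub {N : Type*} [AddCommGroup N] [Module ℝ N] [Module (SmoothFun n X) N]
    [IsScalarTower ℝ (SmoothFun n X) N] {l : ℕ} {ι : Type*} [Fintype ι] {W : Set X}
    {x : ι → SmoothFun n X} {U : ι → VecField n X}
    (h : ∀ y ∈ W, ∀ v : TangentSpace (𝓡 n) y, ∑ a, mvfderiv (𝓡 n) (x a) y v • U a y = v)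
    (ρ : SmoothFun n X) (hρ : ∀ y ∉ W, ρ y = 0)
    {Ψ : MultilinearMap ℝ (fun _ : Fin l => N) (SmoothSection n G β)}
    (hΨ : Ψ ∈ totalOrderLT (SmoothFun n X) N (SmoothSection n G β) l 2) (r : Fin l)
    (f : SmoothFun n X) :
    ρ • (∑ a, derivFun (U a) f • slotComm r (x a) Ψ - slotComm r f Ψ) = 0 := by
  refine MultilinearMap.ext fun m => ContMDiffSection.ext fun y => ?_
  by_cases hy : y ∈ W
  swap
  · change ρ y • (∑ a, derivFun (U a) f • slotComm r (x a) Ψ - slotComm r f Ψ) m y = 0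
    rw [hρ y hy, zero_smul]
  let D : SmoothFun n X →ₗ[ℝ] β y :=
    { toFun := fun f => slotComm r f Ψ m y
      map_add' := fun f g => by rw [slotComm_add_fun]; rfl
      map_smul' := fun c f => by rw [slotComm_smul_fun]; rfl }
  have hD := pointDerivation_eq_zero y D
    (fun f g => by
      change slotComm r (f * g) Ψ m y = _
      rw [slotComm_mul hΨ]
      rfl)
    (f - ∑ a, derivFun (U a) f y • x a) (by
      ext v
      rw [mvfderiv_sub_sum]
      conv_lhs => enter [1]; rw [← h y hy v]
      rw [map_sum]
      simp only [map_smul, smul_eq_mul, derivFun_apply]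
      refine sub_eq_zero.2 ?_
      exact Finset.sum_congr rfl fun a _ => mul_comm _ _)
  rw [map_sub, map_sum] at hD
  have h1 : (∑ a, derivFun (U a) f • slotComm r (x a) Ψ - slotComm r f Ψ) m y =
      ∑ a, derivFun (U a) f y • D (x a) - D f := by
    rw [sub_apply, sum_apply, ← evalAt_apply, map_sub, map_sum]
    rfl
  have h2 : ∑ a, derivFun (U a) f y • D (x a) - D f = 0 := by
    rw [← neg_eq_zero, neg_sub, ← hD]
    simp only [map_smul]
  change ρ y • (∑ a, derivFun (U a) f • slotComm r (x a) Ψ - slotComm r f Ψ) m y = 0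
  rw [h1, h2, smul_zero]

/-- If the values of `T` vanish on the open set `W`, then so do those of a differential operator
precomposed with `T`, since differential operators are local. The vanishing on `W` is expressed by
multiplication with functions supported there. -/
theorem smul_slotComp_eq_zero {N : Type*} [AddCommGroup N] [Module ℝ N] [Module (SmoothFun n X) N]
    [IsScalarTower ℝ (SmoothFun n X) N] {l : ℕ} {W : Set X} (hW : IsOpen W) {T : N →ₗ[ℝ] N}
    (hT : ∀ ψ : SmoothFun n X, (∀ y ∉ W, ψ y = 0) → ∀ m, ψ • T m = 0)
    (ρ : SmoothFun n X) (hρ : ∀ y ∉ W, ρ y = 0) {k : ℕ}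
    {Φ : MultilinearMap ℝ (fun _ : Fin l => N) (SmoothSection n G β)}
    (hΦ : Φ ∈ totalOrderLT (SmoothFun n X) N (SmoothSection n G β) l k) (r : Fin l) :
    ρ • slotComp (SmoothFun n X) (SmoothSection n G β) r T Φ = 0 := by
  refine MultilinearMap.ext fun m => ContMDiffSection.ext fun y => ?_
  change ρ y • slotComp (SmoothFun n X) (SmoothSection n G β) r T Φ m y = 0
  by_cases hy : y ∈ W
  swap
  · rw [hρ y hy, zero_smul]
  obtain ⟨ψ, hψ, hψW⟩ := exists_bump (n := n) (hW.mem_nhds hy)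
  have h1 := hT ψ (fun z hz => image_eq_zero_of_notMem_tsupport fun h => hz (hψW h)) (m r)
  have h2 := apply_eq_zero_of_smul_eq_self (evalAt (n := n) (F := G) y) (1 - ψ)
    (fun q => by
      change (1 - ψ y) • q y = 0
      rw [hψ.self_of_nhds, sub_self, zero_smul]) r (Function.update m r (T (m r)))
    (by rw [Function.update_self, sub_smul, one_smul, h1, sub_zero]) k Φ hΦ
  rw [slotComp_apply]
  rw [evalAt_apply] at h2
  rw [h2, smul_zero]

variable {F : Type*} [NormedAddCommGroup F] [NormedSpace ℝ F]
  {γ : X → Type*} [TopologicalSpace (TotalSpace F γ)]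
  [∀ x, AddCommGroup (γ x)] [∀ x, Module ℝ (γ x)] [∀ x, TopologicalSpace (γ x)]
  [∀ x, IsTopologicalAddGroup (γ x)] [∀ x, ContinuousSMul ℝ (γ x)]
  [FiberBundle F γ] [VectorBundle ℝ F γ] [ContMDiffVectorBundle ∞ F γ (𝓡 n)]
  (cov : CovariantDerivative (𝓡 n) F γ) [cov.ContMDiffCovariantDerivative ∞]

theorem isLocalContraction_contraction {l : ℕ} {ι : Type*} [Fintype ι] {W : Set X} (hW : IsOpen W)
    {x : ι → SmoothFun n X} {U : ι → VecField n X}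
    (h : ∀ y ∈ W, ∀ v : TangentSpace (𝓡 n) y, ∑ a, mvfderiv (𝓡 n) (x a) y v • U a y = v)
    (ρ : SmoothFun n X) (hρ : ∀ y ∉ W, ρ y = 0) :
    IsLocalContraction (M := fun j => TwistedForm n F γ j) (SmoothSection n G β) l (dTwisted cov)
      ρ x (fun a => contraction F γ (U a)) (fun a => derivFun (U a)) where
  lowers a := lowersDegree_contraction (U a)
  map_smul a := contraction_smul (U a)
  mulComm_lie a := mulComm_lie_contraction cov (U a)
  smul_sum_slotComm _ hΨ r f := smul_sum_slotComm_sub h ρ hρ hΨ r f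
  smul_slotComp _ _ hΦ r := smul_slotComp_eq_zero hW
    (fun ψ hψ m => smul_sum_mulComm_contraction_sub cov h ψ hψ m) ρ hρ hΦ r

/-- On a second countable Hausdorff manifold the contraction homotopies of coordinate frames glue
to a homotopy for the twisted de Rham operator. -/
theorem exists_isOrderHomotopy [SecondCountableTopology X] (l : ℕ) :
    ∃ h : MultilinearMap ℝ (fun _ : Fin l => Forms n F γ) (SmoothSection n G β) →ₗ[ℝ]
        MultilinearMap ℝ (fun _ : Fin l => Forms n F γ) (SmoothSection n G β),
      IsOrderHomotopy (A := SmoothFun n X) (M := fun j => TwistedForm n F γ j)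
        (dTwisted cov) h := by
  choose W hWo hcW x U hxU using exists_dual_frame (n := n) (X := X)
  have : LocallyCompactSpace X := ChartedSpace.locallyCompactSpace (EuclideanSpace ℝ (Fin n)) X
  obtain ⟨ρ, hρ⟩ := SmoothPartitionOfUnity.exists_isSubordinate (𝓡 n) isClosed_univ W hWo
    fun c _ => Set.mem_iUnion.2 ⟨c, hcW c⟩
  exact ⟨_, isOrderHomotopy_glueHomotopy (isGluing_glueSection ρ) (firstOrder_dTwisted cov)
    fun c => isLocalContraction_contraction cov (hWo c) (hxU c) (ρ c) fun y hy =>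
      image_eq_zero_of_notMem_tsupport fun h => hy (hρ c h)⟩

end Manifold

/-! ### Operators of order zero and the cohomology -/

section DegreeZero

variable {A : Type*} [CommRing A] [Algebra ℝ A]
  {M : ℕ → Type*} [∀ j, AddCommGroup (M j)] [∀ j, Module ℝ (M j)] [∀ j, Module A (M j)]
  [∀ j, IsScalarTower ℝ A (M j)]
  {Q : Type*} [AddCommGroup Q] [Module ℝ Q] [Module A Q] [IsScalarTower ℝ A Q]
  {l : ℕ}

/-- Since all forms have non-negative degree, there are no operators of positive degree, so that all
operators of degree zero are cocycles. -/
theorem rightComp_eq_zero_of_mem_ofDegree_zero (d : ∀ j, M j →ₗ[ℝ] M (j + 1))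
    {Φ : MultilinearMap ℝ (fun _ : Fin l => ⨁ j, M j) Q} (hΦ : Φ ∈ ofDegree A M Q l 0) :
    rightComp A Q d l Φ = 0 :=
  ext_homog fun a m hm => rightComp_mem_ofDegree d hΦ a m hm (by
    rw [← Nat.cast_sum]
    omega)

variable (M) in
/-- The projection onto the component of degree zero. -/
def projZero : (⨁ j, M j) →ₗ[ℝ] ⨁ j, M j :=
  DirectSum.lof ℝ ℕ M 0 ∘ₗ DirectSum.component ℝ ℕ M 0

theorem projZero_eq_self {m : ⨁ j, M j} (hm : m ∈ homog M 0) : projZero M m = m := by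
  obtain ⟨x, rfl⟩ := hm
  simp [projZero, DirectSum.component.lof_self]

theorem projZero_eq_zero {a : ℕ} (ha : a ≠ 0) {m : ⨁ j, M j} (hm : m ∈ homog M a) :
    projZero M m = 0 := by
  obtain ⟨x, rfl⟩ := hm
  rw [projZero, LinearMap.comp_apply, DirectSum.component.of, dif_neg ha, map_zero]

theorem apply_projZero {Φ : MultilinearMap ℝ (fun _ : Fin l => ⨁ j, M j) Q}
    (hΦ : Φ ∈ ofDegree A M Q l 0) (m : Fin l → ⨁ j, M j) :
    Φ (fun k => projZero M (m k)) = Φ m := by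
  suffices h : Φ.compLinearMap (fun _ => projZero M) = Φ from DFunLike.congr_fun h m
  refine ext_homog fun a m hm => ?_
  rw [MultilinearMap.compLinearMap_apply]
  by_cases h : ∀ k, a k = 0
  · congr 1
    funext k
    exact projZero_eq_self (h k ▸ hm k)
  · push Not at h
    obtain ⟨k, hk⟩ := h
    rw [Φ.map_coord_zero k (projZero_eq_zero hk (hm k)), hΦ a m hm]
    have := Finset.single_le_sum (fun i _ => Nat.zero_le (a i)) (Finset.mem_univ k)
    rw [← Nat.cast_sum]
    omega

end DegreeZero

section ZeroOrder

variable {n : ℕ} {X : Type*} [TopologicalSpace X] [ChartedSpace (EuclideanSpace ℝ (Fin n)) X]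
  [IsManifold (𝓡 n) ∞ X]
  {F : Type*} [NormedAddCommGroup F] [NormedSpace ℝ F]
  {γ : X → Type*} [TopologicalSpace (TotalSpace F γ)]
  [∀ x, AddCommGroup (γ x)] [∀ x, Module ℝ (γ x)] [∀ x, TopologicalSpace (γ x)]
  [FiberBundle F γ] [VectorBundle ℝ F γ]
  {G : Type*} [NormedAddCommGroup G] [NormedSpace ℝ G]
  {β : X → Type*} [TopologicalSpace (TotalSpace G β)]
  [∀ x, AddCommGroup (β x)] [∀ x, Module ℝ (β x)] [∀ x, TopologicalSpace (β x)]
  [FiberBundle G β] [VectorBundle ℝ G β]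

/-- A section of `γ` as a form of degree zero. -/
def sectionForm : SmoothSection n F γ →ₗ[ℝ] TwistedForm n F γ 0 where
  toFun t := ⟨fun x => AlternatingMap.constOfIsEmpty ℝ _ _ (t x), fun _ => t.contMDiff⟩
  map_add' _ _ := rfl
  map_smul' _ _ := rfl

theorem zeroFormSection_sectionForm (t : SmoothSection n F γ) :
    zeroFormSection (sectionForm t) = t := rfl

theorem sectionForm_zeroFormSection (θ : TwistedForm n F γ 0) :
    sectionForm (zeroFormSection θ) = θ := by
  refine TwistedForm.ext fun x => AlternatingMap.ext fun v => ?_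
  exact congrArg (θ.1 x) (Subsingleton.elim _ _)

theorem sectionForm_smul (f : SmoothFun n X) (t : SmoothSection n F γ) :
    sectionForm (f • t) = f • sectionForm t := rfl

theorem ofForm_sectionForm_mem (t : SmoothSection n F γ) :
    ofForm n F γ 0 (sectionForm t) ∈ homog (fun j => TwistedForm n F γ j) 0 := ⟨_, rfl⟩

theorem zeroComponent_ofForm_sectionForm (t : SmoothSection n F γ) :
    zeroComponent (ofForm n F γ 0 (sectionForm t)) = t := by
  rw [zeroComponent, LinearMap.comp_apply, DirectSum.component.lof_self,
    zeroFormSection_sectionForm]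

theorem projZero_eq_ofForm_sectionForm (θ : Forms n F γ) :
    projZero (fun j => TwistedForm n F γ j) θ =
      ofForm n F γ 0 (sectionForm (zeroComponent θ)) := by
  rw [zeroComponent, LinearMap.comp_apply, sectionForm_zeroFormSection]
  rfl

theorem zeroOrderOp_mem_totalOrderLT {l : ℕ} (s : SymSection n F γ G β l) :
    zeroOrderOp s ∈ totalOrderLT (SmoothFun n X) (Forms n F γ) (SmoothSection n G β) l 1 := by
  rw [mem_totalOrderLT_one]
  intro i f
  refine MultilinearMap.ext fun θ => ContMDiffSection.ext fun x => ?_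
  have h : (fun k => zeroComponent (Function.update θ i (f • θ i) k) x) =
      Function.update (fun k => zeroComponent (θ k) x) i (f x • zeroComponent (θ i) x) := by
    funext k
    by_cases hk : k = i
    · subst hk; simp [zeroComponent_smul]
    · simp [hk]
  rw [slotComm_apply]
  change zeroOrderOp s (Function.update θ i (f • θ i)) x - f x • zeroOrderOp s θ x = 0
  rw [zeroOrderOp_apply, zeroOrderOp_apply, h, MultilinearMap.map_update_smul,
    Function.update_eq_self, sub_self]

variable [T2Space X] [ContMDiffVectorBundle ∞ F γ (𝓡 n)]

theorem zeroOrderOp_eq_zero_iff {l : ℕ} {s : SymSection n F γ G β l} :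
    zeroOrderOp s = 0 ↔ s = 0 := by
  refine ⟨fun h => SymSection.ext fun x => MultilinearMap.ext fun v => ?_, fun h => h ▸ rfl⟩
  choose t ht using fun k => evalAt_surjective (n := n) (F := F) x (v k)
  have h1 := congrArg (fun q : SmoothSection n G β => q x)
    (DFunLike.congr_fun h fun k => ofForm n F γ 0 (sectionForm (t k)))
  have h2 : (fun k => zeroComponent (ofForm n F γ 0 (sectionForm (t k))) x) = v :=
    funext fun k => (congrArg (fun q : SmoothSection n F γ => q x)
      (zeroComponent_ofForm_sectionForm (t k))).trans (ht k)
  refine Eq.trans ?_ h1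
  change _ = zeroOrderOp s _ x
  rw [zeroOrderOp_apply, h2]

/-- A multilinear operation on sections which is linear over the functions in each argument depends
at `x` only on the values of its arguments at `x`. -/
theorem multilinear_congr [FiniteDimensional ℝ F] {l : ℕ}
    (K : MultilinearMap ℝ (fun _ : Fin l => SmoothSection n F γ) (SmoothSection n G β))
    (hK : ∀ (f : SmoothFun n X) (t : Fin l → SmoothSection n F γ) (i : Fin l)
      (u : SmoothSection n F γ), K (Function.update t i (f • u)) = f • K (Function.update t i u))
    (x : X) (t t' : Fin l → SmoothSection n F γ) (h : ∀ i, t i x = t' i x) : K t x = K t' x := by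
  have key (i : Fin l) (t : Fin l → SmoothSection n F γ) (u u' : SmoothSection n F γ)
      (h : u x = u' x) : K (Function.update t i u) x = K (Function.update t i u') x := by
    have := tensorial_eq_zero (n := n) (F := F) x
      ((evalAt (n := n) (F := G) x) ∘ₗ (K.toLinearMap t i))
      (fun f s => by simp [hK]) (u - u') (by simp [h])
    rw [map_sub, sub_eq_zero] at this
    exact this
  have main (s : Finset (Fin l)) : K (s.piecewise t t') x = K t' x := by
    induction s using Finset.induction_on with
    | empty => simp
    | insert i s hi ih =>
      rw [Finset.piecewise_insert, ← ih, key i _ (t i) ((s.piecewise t t') i)]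
      · simp
      · simp [hi, h]
  simpa using main Finset.univ

/-- Transpositions of neighbours generate the symmetric group. -/
theorem perm_invariant_of_swap {E H : Type*} {l : ℕ} (K : (Fin l → E) → H)
    (hK : ∀ i i' : Fin l, (i' : ℕ) = i + 1 → ∀ t, K (t ∘ Equiv.swap i i') = K t)
    (σ : Equiv.Perm (Fin l)) (t : Fin l → E) : K (t ∘ σ) = K t := by
  cases l with
  | zero => exact congrArg K (Subsingleton.elim _ _)
  | succ l =>
    have hσ : σ ∈ Submonoid.closure
        (Set.range fun i : Fin l => Equiv.swap i.castSucc i.succ) := by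
      rw [Equiv.Perm.mclosure_swap_castSucc_succ]
      trivial
    induction hσ using Submonoid.closure_induction generalizing t with
    | mem σ h =>
      obtain ⟨i, rfl⟩ := h
      exact hK _ _ (by simp) t
    | one => rfl
    | mul σ τ _ _ h1 h2 => exact (h2 (t ∘ σ)).trans (h1 t)

/-- The symmetric operators of order zero and degree zero are given by sections of
`Sym^l(γ^*) ⊗ β`. -/
theorem exists_zeroOrderOp_eq [FiniteDimensional ℝ F] {l : ℕ}
    {Φ : MultilinearMap ℝ (fun _ : Fin l => Forms n F γ) (SmoothSection n G β)}
    (hs : Φ ∈ symDiffOpOfDegree (SmoothFun n X) (fun j => TwistedForm n F γ j)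
      (SmoothSection n G β) l 0)
    (hΦ : Φ ∈ totalOrderLT (SmoothFun n X) (Forms n F γ) (SmoothSection n G β) l 1) :
    ∃ s : SymSection n F γ G β l, zeroOrderOp s = Φ := by
  let K : MultilinearMap ℝ (fun _ : Fin l => SmoothSection n F γ) (SmoothSection n G β) :=
    Φ.compLinearMap fun _ => ofForm n F γ 0 ∘ₗ sectionForm
  have hKupd (t : Fin l → SmoothSection n F γ) (i : Fin l) (u : SmoothSection n F γ) :
      K (Function.update t i u) = Φ (Function.update
        (fun k => ofForm n F γ 0 (sectionForm (t k))) i (ofForm n F γ 0 (sectionForm u))) := by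
    refine congrArg Φ (funext fun k => ?_)
    by_cases hk : k = i
    · subst hk; simp
    · simp [hk]
  have hK (f : SmoothFun n X) (t : Fin l → SmoothSection n F γ) (i : Fin l)
      (u : SmoothSection n F γ) : K (Function.update t i (f • u)) =
        f • K (Function.update t i u) := by
    rw [hKupd, hKupd, sectionForm_smul, ← map_smul_of_mem_totalOrderLT_one hΦ]
    congr 2
    exact (smul_lof (M := fun j => TwistedForm n F γ j) f 0 _).symm
  have hsymm (σ : Equiv.Perm (Fin l)) (t : Fin l → SmoothSection n F γ) : K (t ∘ σ) = K t := by
    refine perm_invariant_of_swap K (fun i i' hi t => ?_) σ t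
    have h1 := hs.1.2 i i' hi 0 0 (fun k => ofForm n F γ 0 (sectionForm (t k)))
      (ofForm_sectionForm_mem _) (ofForm_sectionForm_mem _)
    rw [mul_zero, pow_zero, one_smul] at h1
    exact h1
  have hext (x : X) : ∃ e : γ x →ₗ[ℝ] SmoothSection n F γ, ∀ v, e v x = v := by
    obtain ⟨e, he⟩ := LinearMap.exists_rightInverse_of_surjective
      (evalAt (n := n) (F := F) (V := γ) x) (LinearMap.range_eq_top.2 (evalAt_surjective x))
    exact ⟨e, fun v => LinearMap.congr_fun he v⟩
  choose e he using hext
  have hval (x : X) (t : Fin l → SmoothSection n F γ) : K (fun k => e x (t k x)) x = K t x :=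
    multilinear_congr K hK x _ _ fun k => he x _
  refine ⟨⟨fun x => ((evalAt (n := n) (F := G) x).compMultilinearMap K).compLinearMap
    fun _ => e x, fun x σ v => ?_, fun t => ?_⟩, ?_⟩
  · exact congrArg (fun q : SmoothSection n G β => q x) (hsymm σ fun k => e x (v k))
  · exact (K t).contMDiff.congr fun x => congrArg (TotalSpace.mk' G x) (hval x t)
  · refine MultilinearMap.ext fun θ => ContMDiffSection.ext fun x => ?_
    rw [zeroOrderOp_apply, ← apply_projZero hs.2 θ]
    refine (hval x fun k => zeroComponent (θ k)).trans ?_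
    refine congrArg (fun m => Φ m x) (funext fun k => ?_)
    exact (projZero_eq_ofForm_sectionForm (θ k)).symm

end ZeroOrder

section Assembly

/-- Elements of a direct sum can be chosen componentwise; where the given element vanishes, the
choice is `0`, so that the support stays finite. -/
theorem exists_directSum {ι : Type*} [DecidableEq ι] {N N' : ι → Type*}
    [∀ i, AddCommGroup (N i)] [∀ i, AddCommGroup (N' i)] (P : ∀ i, N i → N' i → Prop)
    (h0 : ∀ i, P i 0 0) (Φ : ⨁ i, N' i) (h : ∀ i, ∃ ψ, P i ψ (Φ i)) :
    ∃ Ψ : ⨁ i, N i, ∀ i, P i (Ψ i) (Φ i) := by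
  classical
  choose ψ hψ using h
  refine ⟨DFinsupp.mk (DFinsupp.support Φ) fun i => ψ i, fun i => ?_⟩
  by_cases hi : i ∈ DFinsupp.support Φ
  · have : (DFinsupp.mk (DFinsupp.support Φ) fun i => ψ i : ⨁ i, N i) i = ψ i :=
      DFinsupp.mk_of_mem hi
    rw [this]
    exact hψ i
  · have : (DFinsupp.mk (DFinsupp.support Φ) fun i => ψ i : ⨁ i, N i) i = 0 :=
      DFinsupp.mk_of_notMem hi
    rw [this, DFinsupp.notMem_support_iff.1 hi]
    exact h0 i

variable {A : Type*} [CommRing A] [Algebra ℝ A]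
  {M : ℕ → Type*} [∀ j, AddCommGroup (M j)] [∀ j, Module ℝ (M j)] [∀ j, Module A (M j)]
  [∀ j, IsScalarTower ℝ A (M j)]
  {Q : Type*} [AddCommGroup Q] [Module ℝ Q] [Module A Q] [IsScalarTower ℝ A Q]

theorem SymPlus.ext {Φ Ψ : SymPlus A M Q} (h : ∀ l, SymDiffOp.op (Φ l) = SymDiffOp.op (Ψ l)) :
    Φ = Ψ :=
  DFinsupp.ext fun l => Subtype.ext (h l)

/-- Elements of a given degree of the direct sum can be chosen componentwise. -/
theorem exists_symPlus (i : ℤ) (P : ∀ l : ℕ, MultilinearMap ℝ (fun _ : Fin l => ⨁ j, M j) Q →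
      MultilinearMap ℝ (fun _ : Fin l => ⨁ j, M j) Q → Prop) (h0 : ∀ l, P l 0 0)
    (Φ : SymPlus A M Q)
    (h : ∀ l : ℕ+, ∃ Ψ ∈ symDiffOpOfDegree A M Q l i, P l Ψ (SymDiffOp.op (Φ l))) :
    ∃ Ψ ∈ degreePart A M Q i, ∀ l : ℕ+, P l (SymDiffOp.op (Ψ l)) (SymDiffOp.op (Φ l)) := by
  obtain ⟨Ψ, hΨ⟩ := exists_directSum (N := fun l : ℕ+ => SymDiffOp A M Q (l : ℕ))
    (N' := fun l : ℕ+ => SymDiffOp A M Q (l : ℕ))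
    (fun l ψ φ => SymDiffOp.op ψ ∈ ofDegree A M Q l i ∧ P l (SymDiffOp.op ψ) (SymDiffOp.op φ))
    (fun l => ⟨zero_mem (ofDegree A M Q l i), h0 l⟩) Φ
    (fun l => by
      obtain ⟨Ψ, hΨ, hP⟩ := h l
      exact ⟨(⟨Ψ, hΨ.1⟩ : symDiffOp A M Q l), hΨ.2, hP⟩)
  exact ⟨Ψ, mem_degreePart.2 fun l => (hΨ l).1, fun l => (hΨ l).2⟩

theorem op_mem_symDiffOpOfDegree {i : ℤ} {Φ : SymPlus A M Q} (hΦ : Φ ∈ degreePart A M Q i)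
    (l : ℕ+) : SymDiffOp.op (Φ l) ∈ symDiffOpOfDegree A M Q l i :=
  ⟨Subtype.property (Φ l), mem_degreePart.1 hΦ l⟩

theorem rightComp_op_eq_zero {d : ∀ j, M j →ₗ[ℝ] M (j + 1)} (hd : FirstOrder A d)
    {i : ℤ} {Φ : SymPlus A M Q} (hΦ : Φ ∈ cocycles Q hd i) (l : ℕ+) :
    rightComp A Q d l (SymDiffOp.op (Φ l)) = 0 := by
  rw [← op_differential hd, LinearMap.mem_ker.1 hΦ.2]
  exact map_zero _

theorem differential_differential {d : ∀ j, M j →ₗ[ℝ] M (j + 1)} (hd : FirstOrder A d)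
    (hd2 : ∀ j x, d (j + 1) (d j x) = 0) (Φ : SymPlus A M Q) :
    differential Q hd (differential Q hd Φ) = 0 := by
  refine SymPlus.ext fun l => ?_
  rw [op_differential, op_differential, rightComp_rightComp hd2]
  exact (map_zero _).symm

theorem differential_mem_degreePart {d : ∀ j, M j →ₗ[ℝ] M (j + 1)} (hd : FirstOrder A d)
    {i : ℤ} {Φ : SymPlus A M Q} (hΦ : Φ ∈ degreePart A M Q i) :
    differential Q hd Φ ∈ degreePart A M Q (i + 1) :=
  mem_degreePart.2 fun l => by
    rw [op_differential]
    exact rightComp_mem_ofDegree d (mem_degreePart.1 hΦ l)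

/-- If there is a homotopy for each number of arguments, the cohomology vanishes in negative
degrees. -/
theorem subsingleton_cohomology {d : ∀ j, M j →ₗ[ℝ] M (j + 1)} (hd : FirstOrder A d)
    (hd2 : ∀ j x, d (j + 1) (d j x) = 0)
    (hh : ∀ l : ℕ, ∃ h : MultilinearMap ℝ (fun _ : Fin l => ⨁ j, M j) Q →ₗ[ℝ]
      MultilinearMap ℝ (fun _ : Fin l => ⨁ j, M j) Q, IsOrderHomotopy (A := A) d h)
    {i : ℤ} (hi : i < 0) : Subsingleton (Cohomology Q hd i) := by
  refine Submodule.Quotient.subsingleton_iff.2 (eq_top_iff.2 ?_)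
  rintro ⟨Φ, hΦ⟩ -
  obtain ⟨p, rfl⟩ : ∃ p : ℕ, i = -(p : ℤ) := ⟨i.natAbs, by omega⟩
  obtain ⟨Ψ, hΨ, h1⟩ := exists_symPlus (-(p : ℤ) - 1) (fun l ψ φ => rightComp A Q d l ψ = φ)
    (fun l => map_zero _) Φ (fun l => by
      obtain ⟨h, hh⟩ := hh l
      obtain ⟨k, hk⟩ := exists_mem_totalOrderLT (Subtype.property (Φ l)).1
      exact hh.exists_rightComp_eq hd hd2 (by omega) (k + 1) _
        (op_mem_symDiffOpOfDegree hΦ.1 l) (rightComp_op_eq_zero hd hΦ l) hk)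
  exact ⟨Ψ, hΨ, SymPlus.ext fun l => (op_differential hd Ψ l).trans (h1 l)⟩

/-- If there is a homotopy for each number of arguments, every cohomology class of degree zero is
represented by an operator of order zero. -/
theorem exists_sub_differential_mem {d : ∀ j, M j →ₗ[ℝ] M (j + 1)} (hd : FirstOrder A d)
    (hh : ∀ l : ℕ, ∃ h : MultilinearMap ℝ (fun _ : Fin l => ⨁ j, M j) Q →ₗ[ℝ]
      MultilinearMap ℝ (fun _ : Fin l => ⨁ j, M j) Q, IsOrderHomotopy (A := A) d h)
    {Φ : SymPlus A M Q} (hΦ : Φ ∈ cocycles Q hd 0) :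
    ∃ Ψ ∈ degreePart A M Q (-1), Φ - differential Q hd Ψ ∈ degreePart A M Q 0 ∧
      ∀ l : ℕ+, SymDiffOp.op ((Φ - differential Q hd Ψ) l) ∈
        totalOrderLT A (⨁ j, M j) Q l 1 := by
  obtain ⟨Ψ, hΨ, h1⟩ := exists_symPlus (-1) (fun l ψ φ =>
      φ - rightComp A Q d l ψ ∈ totalOrderLT A (⨁ j, M j) Q l 1)
    (fun l => by rw [map_zero, sub_zero]; exact zero_mem _) Φ (fun l => by
      obtain ⟨h, hh⟩ := hh l
      obtain ⟨k, hk⟩ := exists_mem_totalOrderLT (Subtype.property (Φ l)).1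
      exact hh.exists_sub_rightComp_mem hd k _ (op_mem_symDiffOpOfDegree hΦ.1 l)
        (rightComp_op_eq_zero hd hΦ l)
        (fun Ψ hΨ => rightComp_eq_zero_of_mem_ofDegree_zero _ hΨ.2) hk)
  have h0 : differential Q hd Ψ ∈ degreePart A M Q 0 := by
    simpa using differential_mem_degreePart hd hΨ
  refine ⟨Ψ, hΨ, Submodule.sub_mem _ hΦ.1 h0, fun l => ?_⟩
  have h2 : SymDiffOp.op ((Φ - differential Q hd Ψ) l) =
      SymDiffOp.op (Φ l) - rightComp A Q d l (SymDiffOp.op (Ψ l)) := by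
    rw [← op_differential hd]
    rfl
  rw [h2]
  exact h1 l

theorem mkQ_eq_mkQ {d : ∀ j, M j →ₗ[ℝ] M (j + 1)} {hd : FirstOrder A d}
    {Φ Φ' : cocycles Q hd 0} {Ψ : SymPlus A M Q} (hΨ : Ψ ∈ degreePart A M Q (-1))
    (h : (Φ' : SymPlus A M Q) = Φ - differential Q hd Ψ) :
    (Submodule.mkQ _ Φ' : Cohomology Q hd 0) = Submodule.mkQ _ Φ := by
  have hΨ' : -Ψ ∈ degreePart A M Q (0 - 1) := by
    rw [zero_sub]
    exact Submodule.neg_mem _ hΨ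
  refine (Submodule.Quotient.eq _).2 ⟨-Ψ, hΨ', ?_⟩
  rw [map_neg, Submodule.subtype_apply, Submodule.coe_sub, h]
  abel

/-- If there is a homotopy for each number of arguments, and `Z` parametrizes the operators of order
zero and degree zero, then `Z` is surjective onto the cohomology in degree zero. -/
theorem mkQ_comp_surjective {d : ∀ j, M j →ₗ[ℝ] M (j + 1)} (hd : FirstOrder A d)
    (hh : ∀ l : ℕ, ∃ h : MultilinearMap ℝ (fun _ : Fin l => ⨁ j, M j) Q →ₗ[ℝ]
      MultilinearMap ℝ (fun _ : Fin l => ⨁ j, M j) Q, IsOrderHomotopy (A := A) d h)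
    {S : Type*} [AddCommMonoid S] [Module A S] (Z : S →ₗ[A] SymPlus A M Q)
    (hZ : ∀ s, Z s ∈ cocycles Q hd 0)
    (hZ' : ∀ Φ ∈ degreePart A M Q 0, (∀ l : ℕ+, SymDiffOp.op (Φ l) ∈
      totalOrderLT A (⨁ j, M j) Q l 1) → ∃ s, Z s = Φ) :
    Function.Surjective (Submodule.mkQ _ ∘ₗ LinearMap.codRestrict _ Z hZ :
      S →ₗ[A] Cohomology Q hd 0) := by
  intro q
  obtain ⟨Φ, rfl⟩ := Submodule.mkQ_surjective _ q
  obtain ⟨Ψ, hΨ, h0, h1⟩ := exists_sub_differential_mem hd hh Φ.2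
  obtain ⟨s, hs⟩ := hZ' _ h0 h1
  exact ⟨s, mkQ_eq_mkQ hΨ hs⟩

variable {n : ℕ} {X : Type*} [TopologicalSpace X] [ChartedSpace (EuclideanSpace ℝ (Fin n)) X]
  [IsManifold (𝓡 n) ∞ X] [T2Space X]
  {F : Type*} [NormedAddCommGroup F] [NormedSpace ℝ F]
  {γ : X → Type*} [TopologicalSpace (TotalSpace F γ)]
  [∀ x, AddCommGroup (γ x)] [∀ x, Module ℝ (γ x)] [∀ x, TopologicalSpace (γ x)]
  [∀ x, IsTopologicalAddGroup (γ x)] [∀ x, ContinuousSMul ℝ (γ x)]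
  [FiberBundle F γ] [VectorBundle ℝ F γ] [ContMDiffVectorBundle ∞ F γ (𝓡 n)]
  (cov : CovariantDerivative (𝓡 n) F γ) [cov.ContMDiffCovariantDerivative ∞]
  {G : Type*} [NormedAddCommGroup G] [NormedSpace ℝ G]
  {β : X → Type*} [TopologicalSpace (TotalSpace G β)]
  [∀ x, AddCommGroup (β x)] [∀ x, Module ℝ (β x)] [∀ x, TopologicalSpace (β x)]
  [FiberBundle G β] [VectorBundle ℝ G β]

theorem zeroOrderClass_injective [SecondCountableTopology X] (hflat : IsFlat cov) :
    Function.Injective (zeroOrderClass (G := G) (β := β) cov) := by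
  rw [injective_iff_map_eq_zero]
  intro s hs
  obtain ⟨Ψ, hΨ, h1⟩ := (Submodule.Quotient.mk_eq_zero _).1 hs
  refine DFinsupp.ext fun l => zeroOrderOp_eq_zero_iff.1 ?_
  obtain ⟨h, hh⟩ := exists_isOrderHomotopy cov (G := G) (β := β) (l : ℕ)
  have h2 : rightComp (SmoothFun n X) (SmoothSection n G β) (dTwisted cov) l
      (SymDiffOp.op (Ψ l)) = zeroOrderOp (s l) := by
    rw [← op_differential (firstOrder_dTwisted cov), ← op_zeroOrderPlus]
    exact congrArg (fun Φ : SymPlusDiffOp n X F γ G β => SymDiffOp.op (Φ l)) h1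
  obtain ⟨k, hk⟩ := exists_mem_totalOrderLT (Subtype.property (Ψ l)).1
  rw [← h2]
  exact hh.rightComp_eq_zero (dTwisted_dTwisted hflat) (k + 1) _ (mem_degreePart.1 hΨ l)
    (hh.eq_zero _ (h2 ▸ zeroOrderOp_mem_totalOrderLT (s l))) hk

theorem exists_zeroOrderPlus_eq [FiniteDimensional ℝ F] {Φ : SymPlusDiffOp n X F γ G β}
    (hΦ : Φ ∈ degreeSubmodule n X F γ G β 0)
    (h : ∀ l : ℕ+, SymDiffOp.op (Φ l) ∈
      totalOrderLT (SmoothFun n X) (Forms n F γ) (SmoothSection n G β) l 1) :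
    ∃ s, zeroOrderPlus n X F γ G β s = Φ := by
  obtain ⟨s, hs⟩ := exists_directSum (N := fun l : ℕ+ => SymSection n F γ G β (l : ℕ))
    (N' := fun l : ℕ+ =>
      SymDiffOp (SmoothFun n X) (fun j => TwistedForm n F γ j) (SmoothSection n G β) (l : ℕ))
    (fun l s φ => zeroOrderOp s = SymDiffOp.op φ) (fun l => rfl) Φ
    (fun l => exists_zeroOrderOp_eq (op_mem_symDiffOpOfDegree hΦ l) (h l))
  exact ⟨s, SymPlus.ext fun l => (op_zeroOrderPlus s l).trans (hs l)⟩

theorem zeroOrderClass_surjective [SecondCountableTopology X] [FiniteDimensional ℝ F] :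
    Function.Surjective (zeroOrderClass (G := G) (β := β) cov) :=
  mkQ_comp_surjective (Q := SmoothSection n G β) (firstOrder_dTwisted cov)
    (fun l => exists_isOrderHomotopy cov l) (zeroOrderPlus n X F γ G β)
    (zeroOrderPlus_mem cov) fun _ hΦ h => exists_zeroOrderPlus_eq hΦ h

end Assembly

end

end TwistedDeRham

theorem mainTheorem4 {n : ℕ} {X : Type*} [TopologicalSpace X]
    [ChartedSpace (EuclideanSpace ℝ (Fin n)) X] [IsManifold (𝓡 n) ∞ X]
    [T2Space X] [SecondCountableTopology X]
    -- the vector bundle `γ` with its flat connection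
    {F : Type*} [NormedAddCommGroup F] [NormedSpace ℝ F] [FiniteDimensional ℝ F]
    {γ : X → Type*} [TopologicalSpace (TotalSpace F γ)]
    [∀ x, AddCommGroup (γ x)] [∀ x, Module ℝ (γ x)] [∀ x, TopologicalSpace (γ x)]
    [∀ x, IsTopologicalAddGroup (γ x)] [∀ x, ContinuousSMul ℝ (γ x)]
    [FiberBundle F γ] [VectorBundle ℝ F γ] [ContMDiffVectorBundle ∞ F γ (𝓡 n)]
    (cov : CovariantDerivative (𝓡 n) F γ) [cov.ContMDiffCovariantDerivative ∞]
    (hflat : TwistedDeRham.IsFlat cov)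
    -- the vector bundle `β`
    {G : Type*} [NormedAddCommGroup G] [NormedSpace ℝ G] [FiniteDimensional ℝ G]
    {β : X → Type*} [TopologicalSpace (TotalSpace G β)]
    [∀ x, AddCommGroup (β x)] [∀ x, Module ℝ (β x)] [∀ x, TopologicalSpace (β x)]
    [FiberBundle G β] [VectorBundle ℝ G β] [ContMDiffVectorBundle ∞ G β (𝓡 n)] :
    -- `Sym^+ D(Λ^•_X ⊗ γ, β)` with the differential `δ` is a complex of `C^∞(X)`-modules
    TwistedDeRham.deRhamDifferential G β cov ∘ₗ TwistedDeRham.deRhamDifferential G β cov = 0 ∧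
    (∀ i : ℤ, (TwistedDeRham.degreeSubmodule n X F γ G β i).map
      (TwistedDeRham.deRhamDifferential G β cov) ≤
        TwistedDeRham.degreeSubmodule n X F γ G β (i + 1)) ∧
    -- its cohomology vanishes in negative degrees
    (∀ i : ℤ, i < 0 → Subsingleton (TwistedDeRham.deRhamCohomology G β cov i)) ∧
    -- and in degree `0` it is `Γ(Sym^+(γ^*) ⊗ β)`
    Function.Bijective (TwistedDeRham.zeroOrderClass (G := G) (β := β) cov) := by
  have hd := TwistedDeRham.firstOrder_dTwisted (n := n) (X := X) cov
  have hd2 := TwistedDeRham.dTwisted_dTwisted hflat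
  refine ⟨LinearMap.ext (TwistedDeRham.differential_differential hd hd2), fun i => ?_,
    fun i hi => ?_, TwistedDeRham.zeroOrderClass_injective cov hflat,
    TwistedDeRham.zeroOrderClass_surjective cov⟩
  · rintro _ ⟨Φ, hΦ, rfl⟩
    exact TwistedDeRham.differential_mem_degreePart hd hΦ
  · exact TwistedDeRham.subsingleton_cohomology hd hd2
      (fun l => TwistedDeRham.exists_isOrderHomotopy cov l) hi
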